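/- **Setting.** A *plane tree* is a finite tree with a clockwise cyclic order of the edges around each vertex. A *corner* at a vertex $v$ is a pair $(e,e')$ of edges at $v$ such that $e'$ follows $e$ in clockwise order around $v$. In a plane tree or planar map, $\kappa^\ell(u,w)$ denotes the corner at $u$ on the left of the edge $\{u,w\}$ followed from $u$ to $w$. A *blossom* is a vertex of degree one; all other vertices are *inner*; an edge between an inner vertex and a blossom is a *stem*. The tree is *blossoming* if each vertex of degree greater than one is adjacent to exactly two blossoms. The clockwise contour exploration goes from a corner $(e,e')$ at $u$, where $e'=\{u,w\}$, to the corner $(e',e'')$ at $w$; it gives a cyclic order $\preceq$ on the set $\mathcal C(T)$ of all corners. The planted tree $(T,\xi)$ is *balanced* if $\xi=(e,e')$ for distinct stems $e,e'$ at an inner vertex and, for every corner $c'$, $$3\,|\{k:\xi\preceq k\preceq c',\ k\text{ at a blossom}\}|+1\ \ge\ |\{k:\xi\preceq k\preceq c'\}|.$$ **Labels.** Let $\xi=\xi(0),\xi(1),\dots$ be the corners of $T$ in contour order from $\xi$. Put $\lambda(\xi(0))=2$, and let $\lambda(\xi(i+1))-\lambda(\xi(i))$ be $-1$ if both corners are at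 inner vertices, $0$ if $\xi(i+1)$ is at a blossom, and $+1$ if $\xi(i)$ is at a blossom. For a vertex $v$ of $T$ let $Y_T(v)$ be the minimum of $\lambda$ over the corners at $v$. **Closure.** For a corner $c$ at a blossom, the successor $s(c)$ is the first corner $c'$ after $c$ in the cyclic contour order with $3|\{k:c\preceq k\preceq c',\ k\text{ at a blossom}\}|<|\{k:c\preceq k\preceq c'\}|$, if there is one. The closure $G$ of a balanced blossoming tree $(T,\xi)$ has as vertices the inner vertices of $T$ and two new vertices $A,B$. It is obtained by identifying the blossom of each blossom corner $c$ with the vertex of $s(c)$, its stem being attached inside the corner $s(c)$, if $s(c)$ is defined, and otherwise with $A$ if $\lambda(c)=2$ and with $B$ if $\lambda(c)=3$ (all this without crossings, so the stems attached at the same place appear around it, clockwise, in the reverse of the contour order), and by adding an edge $\{A,B\}$ such that the root vertex $v$ (the vertex of $\xi$), $A$ and $B$ bound a face, the root face. The root corner of $G$ is the corner at $v$ in this face; it is formed by the edges $\{v,B\},\{v,A\}$ in this order. Put $Y_T(A)=1$, $Y_T(B)=2$. The corner labelling $\lambda^*$ of $G$: every corner at an inner vertex inherits the label of the corner of $T$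 from which it arises (attaching a stem inside a corner splits the corner into two corners with the same label); the corner of $A$ (respectively $B$) in the root face has label $0$ (respectively $1$), and all other corners of $A$ (respectively $B$) have label $1$ (respectively $2$). **Orientation and leftmost paths.** A *3-orientation* of $G$ is an orientation of its edges in which $A,B,v$ have outdegrees $0,1,2$ and all other vertices have outdegree $3$. It is *minimal* if it has no counterclockwise cycle, where a directed simple cycle is clockwise if the root corner is on its left and counterclockwise otherwise. Given a minimal 3-orientation $\overrightarrow E$ and $e=u_0u_1\in\overrightarrow E$, the *leftmost path* $P(e)=(u_0,u_1,\dots,u_\ell)$ from $e$ to $A$ is the directed path with $u_\ell=A$ such that for $1\le i\le \ell-1$ the edge $u_iu_{i+1}$ is the first outgoing edge at $u_i$ when the edges at $u_i$ are considered in clockwise order starting from $\{u_{i-1},u_i\}$; $|P(e)|=\ell+1$ is its number of vertices. **Statement.** Let $(T,\xi)$ be a balanced blossoming tree and $G$ its closure. Then $G$ has exactly one minimal 3-orientation $\overrightarrow E$. For every oriented edge $e=uw\in\overrightarrow E$ with $u\ne B$, the leftmost path $P(e)$ to $A$ exists and is unique, and $$\lambda^*(\kappa^\ell(u,w))=|P(e)|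 .$$ Moreover $G$ is connected and, for every vertex $u$ of $G$ (including $A$ and $B$), $$d_G(u,A)\le Y_T(u)-1 .$$ -/

import Mathlib

open Classical in
/-- `Nat.count` of a predicate, with classical decidability. -/
noncomputable def countBelow (p : ℕ → Prop) (n : ℕ) : ℕ := Nat.count p n

/-! ### Maps given by rotation systems

A map on an oriented surface, up to isomorphism, is a graph together with the clockwise cyclic
order of the edges around every vertex.  It is encoded here by its *darts* (edges with a direction):
`origin d` is the vertex that `d` leaves, `rev d` is the same edge with the opposite direction, and
`next d` is the dart that follows `d` in clockwise order around its origin. -/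

structure RotationMap (V D : Type*) where
  origin : D → V
  rev : Equiv.Perm D
  next : Equiv.Perm D
  rev_rev : ∀ d, rev (rev d) = d
  rev_ne : ∀ d, rev d ≠ d
  /-- `next` permutes the darts leaving each vertex cyclically. -/
  sameCycle_next : ∀ d d', next.SameCycle d d' ↔ origin d = origin d'

namespace RotationMap

variable {V D : Type*} (M : RotationMap V D)

/-- The endpoint of a dart. -/
def target (d : D) : V := M.origin (M.rev d)

/-- A corner is a pair `(e, e')` of edges at a vertex such that `e'` follows `e` in clockwise order.
It is represented by the dart of `e'` that leaves the vertex: the dart `d` stands for the corner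
`(next⁻¹ d, d)` at `origin d`. -/
abbrev Corner (_M : RotationMap V D) : Type _ := D

/-- The corner `κ^ℓ(u, w)` at `u`, on the left of the edge when it is followed from `u` to `w`: the
edge is the second (clockwise later) edge of this corner. -/
def leftCorner (d : D) : M.Corner := d

/-- The corner after a given one in the walk along a face with the face on the left (for a plane
tree: in the clockwise contour exploration): from the corner `(e, e')` at `u`, follow `e'` to its
other end `w`; the next corner is `(e', e'')` with `e''` the edge after `e'` clockwise
around `w`. -/
def faceNext : Equiv.Perm M.Corner := M.next * M.rev

/-- Two corners are incident to the same face. -/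
def SameFace (c c' : M.Corner) : Prop := M.faceNext.SameCycle c c'

/-- The underlying graph. -/
def toGraph : SimpleGraph V where
  Adj u w := u ≠ w ∧ ∃ d, M.origin d = u ∧ M.target d = w
  symm := ⟨by
    rintro u w ⟨h, d, rfl, rfl⟩
    exact ⟨h.symm, M.rev d, rfl, by simp [target, M.rev_rev]⟩⟩
  loopless := ⟨fun u h => h.1 rfl⟩

/-- A set of darts that contains exactly one of the two directions of every edge. -/
def IsOrientation (O : Set D) : Prop := ∀ d, d ∈ O ↔ M.rev d ∉ O

/-- The outdegree of a vertex with respect to an orientation. -/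
noncomputable def outdegree (O : Set D) (v : V) : ℕ := {d | d ∈ O ∧ M.origin d = v}.ncard

/-- A simple cycle all of whose edges are directed along `O`: a nonempty cyclic sequence of darts,
each ending where the following one (cyclically) begins, with distinct vertices. -/
def IsDirectedCycle (O : Set D) (C : List D) : Prop :=
  C ≠ [] ∧ (∀ d ∈ C, d ∈ O) ∧ C.map M.target = (C.map M.origin).rotate 1 ∧
    (C.map M.origin).Nodup

/-- One step between corners that does not cross the cycle `C`: along a face, or across an
edge that is not an edge of `C`. -/
def StepAvoiding (C : List D) (c c' : M.Corner) : Prop :=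
  c' = M.faceNext c ∨ (c' = M.rev c ∧ c ∉ C ∧ M.rev c ∉ C)

/-- The corner `ξ` is on the left of the directed cycle `C`: it is in the part of the surface that
is connected, without crossing `C`, to the face on the left of some dart of `C`. -/
def OnLeft (C : List D) (ξ : M.Corner) : Prop :=
  ∃ d ∈ C, Relation.EqvGen (M.StepAvoiding C) (M.leftCorner d) ξ

/-- The orientation has no counterclockwise cycle: a directed cycle is clockwise if the root corner
`ξ` is on its left, and counterclockwise otherwise. -/
def IsMinimalOrientation (ξ : M.Corner) (O : Set D) : Prop :=
  ∀ C : List D, M.IsDirectedCycle O C → M.OnLeft C ξ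

/-- If the root corner `ξ` at `v` is incident to a triangle, then the vertices of that face in
clockwise order (when it is drawn as the outer face) are `v`, `rootA ξ`, `rootB ξ`: the corner `ξ`
is formed by the edge from `v` to `rootB ξ` and the edge from `v` to `rootA ξ`, in this order. -/
def rootA (ξ : M.Corner) : V := M.target ξ

/-- The other end of the first edge of the root corner; see `rootA`. -/
def rootB (ξ : M.Corner) : V := M.target (M.next.symm ξ)

/-- A `3`-orientation of a triangulation with root corner `ξ` at `v`: the outdegrees of `A`, `B`,
`v` are `0`, `1`, `2`, and all other outdegrees are `3`. -/
def IsThreeOrientation (ξ : M.Corner) (O : Set D) : Prop :=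
  M.IsOrientation O ∧ M.outdegree O (M.rootA ξ) = 0 ∧ M.outdegree O (M.rootB ξ) = 1 ∧
    M.outdegree O (M.origin ξ) = 2 ∧
    ∀ u, u ≠ M.rootA ξ → u ≠ M.rootB ξ → u ≠ M.origin ξ → M.outdegree O u = 3

/-- A minimal `3`-orientation: one without counterclockwise cycles. -/
def IsMinimalThreeOrientation (ξ : M.Corner) (O : Set D) : Prop :=
  M.IsThreeOrientation ξ O ∧ M.IsMinimalOrientation ξ O

/-- `d'` is the first outgoing dart at the endpoint `w` of `d` when the edges incident to `w` are
considered in clockwise order starting from the edge of `d`. -/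
def IsFirstOutgoingAfter (O : Set D) (d d' : D) : Prop :=
  ∃ k : ℕ, 0 < k ∧ d' = (M.next ^ k) (M.rev d) ∧ d' ∈ O ∧
    ∀ j : ℕ, 0 < j → j < k → (M.next ^ j) (M.rev d) ∉ O

/-- The sequence `p` of darts is a leftmost path from the dart `e` to the vertex `a`. -/
def IsLeftmostPath (O : Set D) (e : D) (a : V) (p : List D) : Prop :=
  p.head? = some e ∧ (∀ d ∈ p, d ∈ O) ∧ List.IsChain (M.IsFirstOutgoingAfter O) p ∧
    p.getLast?.map M.target = some a

/-- The sequence of vertices visited by a path. -/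
def pathVertices : List D → List V
  | [] => []
  | d :: p => M.origin d :: (d :: p).map M.target

end RotationMap

/-! ### Plane trees, contour exploration -/

/-- A plane tree: a tree with, around every vertex, a cyclic (clockwise) order of its edges. -/
structure PlaneTree (V : Type*) where
  graph : SimpleGraph V
  isTree : graph.IsTree
  next : Equiv.Perm graph.Dart
  sameCycle_next : ∀ d d' : graph.Dart, next.SameCycle d d' ↔ d.fst = d'.fst

namespace PlaneTree

variable {V : Type*} (T : PlaneTree V)

/-- The plane tree as a map. -/
def toMap : RotationMap V T.graph.Dart where
  origin d := d.fst
  rev := Function.Involutive.toPerm _ SimpleGraph.Dart.symm_involutive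
  next := T.next
  rev_rev d := d.symm_symm
  rev_ne d := d.symm_ne
  sameCycle_next := T.sameCycle_next

/-- The corner that comes `i` steps after `c` in the clockwise contour exploration. -/
def contour (c : T.toMap.Corner) (i : ℕ) : T.toMap.Corner := T.toMap.faceNext^[i] c

/-- The number of corners of the tree. -/
noncomputable def numCorners : ℕ := Nat.card T.toMap.Corner

/-- The blossoms are the vertices of degree one. -/
def IsBlossom (v : V) : Prop := (T.graph.neighborSet v).ncard = 1

/-- The inner vertices are the other ones. -/
def Inner : Type _ := {v : V // ¬ T.IsBlossom v}

/-- Each vertex of degree greater than one is adjacent to exactly two vertices of degree one. -/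
def IsBlossoming : Prop :=
  ∀ v, 1 < (T.graph.neighborSet v).ncard →
    {w | T.graph.Adj v w ∧ T.IsBlossom w}.ncard = 2

/-- The edge of `d` is a stem, and `d` leaves its inner vertex. -/
def IsStemDart (d : T.graph.Dart) : Prop := ¬ T.IsBlossom d.fst ∧ T.IsBlossom d.snd

/-- The number of corners `k` at a blossom with `c ≼ k ≼ c'` in the cyclic contour order, where `c'`
is the corner that comes `i` steps after `c`. -/
noncomputable def blossomCount (c : T.toMap.Corner) (i : ℕ) : ℕ :=
  countBelow (fun j => T.IsBlossom (T.toMap.origin (T.contour c j))) (i + 1)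

/-- The planted tree `(T, ξ)` is balanced: `ξ = (e, e')` for distinct stems `e, e'` and, for every
corner `c'`, three times the number of blossom corners `k` with `ξ ≼ k ≼ c'`, plus one, is at least
the number of corners `k` with `ξ ≼ k ≼ c'`. -/
def IsBalanced (ξ : T.toMap.Corner) : Prop :=
  T.IsStemDart ξ ∧ T.IsStemDart (T.next.symm ξ) ∧ T.next.symm ξ ≠ ξ ∧
    ∀ i < T.numCorners, i + 1 ≤ 3 * T.blossomCount ξ i + 1

/-! ### The corner labelling `λ` and the vertex labelling `Y` -/

open Classical in
/-- The label of the `i`-th corner of the contour exploration started from `ξ`. -/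
noncomputable def contourLabel (ξ : T.toMap.Corner) : ℕ → ℤ
  | 0 => 2
  | i + 1 =>
    if T.IsBlossom (T.toMap.origin (T.contour ξ i)) then contourLabel ξ i + 1
    else if T.IsBlossom (T.toMap.origin (T.contour ξ (i + 1))) then contourLabel ξ i
    else contourLabel ξ i - 1

/-- The position of the corner `c` in the contour exploration started from `ξ`. -/
noncomputable def contourIndex (ξ c : T.toMap.Corner) : ℕ := sInf {i | T.contour ξ i = c}

/-- The corner labelling `λ` of the planted tree `(T, ξ)`. -/
noncomputable def cornerLabel (ξ c : T.toMap.Corner) : ℤ :=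
  T.contourLabel ξ (T.contourIndex ξ c)

/-- The vertex labelling `Y(v) = min {λ(c) : c a corner at v}`. -/
noncomputable def vertexLabel (ξ : T.toMap.Corner) (v : V) : ℤ :=
  sInf {z | ∃ c : T.toMap.Corner, T.toMap.origin c = v ∧ T.cornerLabel ξ c = z}

/-! ### The successor of a blossom corner -/

/-- The numbers of steps `i` such that the corner `c'` that comes `i` steps after `c` satisfies
`3 |{k : c ≼ k ≼ c', k at a blossom}| < |{k : c ≼ k ≼ c'}|`. -/
def successorSteps (c : T.toMap.Corner) : Set ℕ :=
  {i | i < T.numCorners ∧ 3 * T.blossomCount c i < i + 1}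

/-- The blossom at `c` is closed: it has a successor. -/
def IsClosed (c : T.toMap.Corner) : Prop := (T.successorSteps c).Nonempty

/-- The successor `s(c)` of a corner `c` at a blossom (meaningful if `c` is closed): the first
corner in contour order with the property defining `successorSteps`. -/
noncomputable def successor (c : T.toMap.Corner) : T.toMap.Corner :=
  T.contour c (sInf (T.successorSteps c))

/-- The successor of a closed corner is a corner at an inner vertex. -/
theorem successor_inner (c : T.toMap.Corner) (h : T.IsClosed c) :
    ¬ T.IsBlossom (T.toMap.origin (T.successor c)) := by
  classical
  intro hb
  obtain ⟨h1, h2⟩ := Nat.sInf_mem h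
  set i := sInf (T.successorSteps c) with hi
  have hb' : T.IsBlossom (T.toMap.origin (T.contour c i)) := hb
  have hcount : T.blossomCount c i
      = countBelow (fun j => T.IsBlossom (T.toMap.origin (T.contour c j))) i + 1 := by
    simp only [blossomCount, countBelow]
    rw [Nat.count_succ, if_pos hb']
  rcases Nat.eq_zero_or_pos i with h0 | h0
  · rw [hcount] at h2
    omega
  · have hm : i - 1 ∈ T.successorSteps c := by
      refine ⟨by omega, ?_⟩
      have : T.blossomCount c (i - 1)
          = countBelow (fun j => T.IsBlossom (T.toMap.origin (T.contour c j))) i := by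
        simp only [blossomCount]
        rw [Nat.sub_add_cancel h0]
      rw [this]
      rw [hcount] at h2
      omega
    have := Nat.sInf_le hm
    omega

/-! ### The closure of a balanced blossoming tree -/

/-- The vertices of the closure: the inner vertices of the tree, and two new vertices. -/
inductive ClosureVertex (T : PlaneTree V) : Type _
  | inner (v : T.Inner)
  | A
  | B

/-- The darts of the closure: those of the tree, and those of a new edge between `A` and `B`. -/
abbrev ClosureDart : Type _ := T.graph.Dart ⊕ Bool

/-- The new dart from `A` to `B`. -/
abbrev dartAB : T.ClosureDart := Sum.inr true

/-- The new dart from `B` to `A`. -/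
abbrev dartBA : T.ClosureDart := Sum.inr false

open Classical in
/-- The place where the blossom corner `c` is attached: the tree corner `s(c)` if it is defined; and
otherwise the vertex `A` if `λ(c) = 2` and the vertex `B` if `λ(c) = 3`, next to the edge between
`A` and `B`. -/
noncomputable def anchor (ξ c : T.toMap.Corner) : T.ClosureDart :=
  if T.IsClosed c then Sum.inl (T.successor c)
  else if T.cornerLabel ξ c = 2 then T.dartAB else T.dartBA

open Classical in
/-- The vertex of the closure that a dart leaves: every blossom is identified with the vertex of its
successor, or with `A` or `B`. -/
noncomputable def closureOrigin (ξ : T.toMap.Corner) : T.ClosureDart → ClosureVertex T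
  | Sum.inr true => .A
  | Sum.inr false => .B
  | Sum.inl d =>
    if h : T.IsBlossom d.fst then
      if hc : T.IsClosed d then .inner ⟨_, T.successor_inner d hc⟩
      else if T.cornerLabel ξ d = 2 then .A else .B
    else .inner ⟨d.fst, h⟩

/-- Reversal of the darts of the closure. -/
def closureRev : Equiv.Perm T.ClosureDart := Equiv.sumCongr T.toMap.rev Equiv.boolNot

open Classical in
/-- Starting from a rotation `τ`, close the blossoms of the list, the last one first.  Closing a
blossom `b` (whose dart is a fixed point of the rotation before) inserts its dart in the rotation
immediately before its anchor in clockwise order: the corner `(e, e')` which is the anchor of `b`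
is split into the corners `(e, b)` and `(b, e')`. -/
noncomputable def closeAll {X : Type*} (a : X → X) (τ : Equiv.Perm X) : List X → Equiv.Perm X
  | [] => τ
  | b :: L => Equiv.swap b (a b) * closeAll a τ L

open Classical in
/-- The corners at blossoms, in the contour order of `(T, ξ)`. -/
noncomputable def blossomCorners (ξ : T.toMap.Corner) : List T.toMap.Corner :=
  ((List.range T.numCorners).map (T.contour ξ)).filter
    (fun c => decide (T.IsBlossom (T.toMap.origin c)))

/-- `anchor`, extended to all darts of the closure by the identity on the new edge. -/
noncomputable def closureAnchor (ξ : T.toMap.Corner) : T.ClosureDart → T.ClosureDart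
  | Sum.inl d => T.anchor ξ d
  | Sum.inr b => Sum.inr b

/-- The clockwise rotation of the closure.  The blossoms are closed in the reverse of the contour
order, that is, inner ones before the ones that enclose them, as in the iteration of local
closures; so edges that are attached in the same corner do not cross. -/
noncomputable def closureNext (ξ : T.toMap.Corner) : Equiv.Perm T.ClosureDart :=
  closeAll (T.closureAnchor ξ) (Equiv.sumCongr T.next 1) ((T.blossomCorners ξ).map Sum.inl)

/-! The next lemmas check that the closure is a map. -/

theorem faceNext_ne (d : T.toMap.Corner) : T.toMap.faceNext d ≠ d := by
  intro h
  have h1 : T.toMap.origin (T.toMap.faceNext d) = T.toMap.target d := by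
    have := (T.toMap.sameCycle_next (T.toMap.rev d) (T.toMap.faceNext d)).1 ⟨1, by
      simp [RotationMap.faceNext]⟩
    exact this.symm
  rw [h] at h1
  exact SimpleGraph.Dart.fst_ne_snd d h1

theorem origin_faceNext (d : T.toMap.Corner) :
    T.toMap.origin (T.toMap.faceNext d) = d.snd :=
  ((T.toMap.sameCycle_next (T.toMap.rev d) (T.toMap.faceNext d)).1
    ⟨1, by simp [RotationMap.faceNext]⟩).symm

/-- The contour exploration visits both sides of every edge. -/
theorem sameCycle_rev [Finite V] (d : T.toMap.Corner) :
    T.toMap.faceNext.SameCycle d (T.toMap.rev d) := by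
  have : Finite T.graph.Dart := Finite.of_injective _ SimpleGraph.Dart.toProd_injective
  by_contra hcon
  let H := T.graph.deleteEdges {s(d.fst, d.snd)}
  have hbridge : ¬ H.Reachable d.fst d.snd := by
    have := (SimpleGraph.isAcyclic_iff_forall_isBridge.1 T.isTree.isAcyclic)
      (e := s(d.fst, d.snd)) d.adj
    exact (SimpleGraph.isBridge_iff.1 this)
  have key : ∀ i : ℕ, H.Reachable ((T.toMap.faceNext ^ (i + 1)) d).fst d.snd := by
    intro i
    induction i with
    | zero =>
      have := T.origin_faceNext d
      change (T.toMap.faceNext d).fst = d.snd at this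
      simp [this]
    | succ i ih =>
      set x := (T.toMap.faceNext ^ (i + 1)) d with hx
      have h1 : ((T.toMap.faceNext ^ (i + 1 + 1)) d).fst = x.snd := by
        rw [pow_succ', Equiv.Perm.mul_apply]
        exact T.origin_faceNext x
      rw [h1]
      refine SimpleGraph.Reachable.trans (SimpleGraph.Adj.reachable ?_) ih
      rw [SimpleGraph.deleteEdges_adj]
      refine ⟨x.adj.symm, ?_⟩
      intro hmem
      have hmem' : x.edge = d.edge := by
        have : s(x.snd, x.fst) = s(d.fst, d.snd) := hmem
        rw [Sym2.eq_swap] at this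
        exact this
      rcases SimpleGraph.dart_edge_eq_iff x d |>.1 hmem' with h | h
      · rw [h] at ih
        exact hbridge ih
      · exact hcon ⟨(i + 1 : ℕ), by rw [zpow_natCast, ← hx, h]; rfl⟩
  obtain ⟨m, hm0, hm⟩ := (isOfFinOrder_of_finite T.toMap.faceNext).exists_pow_eq_one
  obtain ⟨k, rfl⟩ := Nat.exists_eq_succ_of_ne_zero hm0.ne'
  have := key k
  rw [hm] at this
  exact hbridge this

/-- A plane tree has one face. -/
theorem sameCycle_faceNext [Finite V] (d d' : T.toMap.Corner) :
    T.toMap.faceNext.SameCycle d d' := by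
  have hnext : ∀ x : T.toMap.Corner, T.toMap.faceNext.SameCycle x (T.next x) := by
    intro x
    refine (T.sameCycle_rev x).trans ⟨1, ?_⟩
    simp only [RotationMap.faceNext, zpow_one, Equiv.Perm.mul_apply]
    rw [T.toMap.rev_rev]
    rfl
  have hvert : ∀ x y : T.toMap.Corner, x.fst = y.fst → T.toMap.faceNext.SameCycle x y := by
    intro x y hxy
    obtain ⟨n, rfl⟩ := (T.sameCycle_next x y).2 hxy
    clear hxy
    induction n with
    | zero => exact Equiv.Perm.SameCycle.refl _ _
    | succ n ih =>
      rw [add_comm, zpow_add, zpow_one, Equiv.Perm.mul_apply]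
      exact ih.trans (hnext _)
    | pred n ih =>
      refine ih.trans ?_
      have := (hnext ((T.next ^ (-(n : ℤ) - 1)) x)).symm
      rwa [← Equiv.Perm.mul_apply, ← zpow_one_add, show (1 + (-(n : ℤ) - 1)) = -n by ring] at this
  have hreach : ∀ v, T.graph.Reachable d.fst v → ∀ y : T.toMap.Corner, y.fst = v →
      T.toMap.faceNext.SameCycle d y := by
    rintro v ⟨p⟩
    have gen : ∀ (u v : V) (_ : T.graph.Walk u v) (x y : T.toMap.Corner), x.fst = u → y.fst = v →
        T.toMap.faceNext.SameCycle x y := by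
      intro u v p
      induction p with
      | nil => intro x y hx hy; exact hvert x y (hx.trans hy.symm)
      | cons h p ih =>
        intro x y hx hy
        let e : T.graph.Dart := ⟨(_, _), h⟩
        exact (hvert x e hx).trans ((T.sameCycle_rev e).trans (ih (T.toMap.rev e) y rfl hy))
    intro y hy
    exact gen _ _ p d y rfl hy
  exact hreach _ (T.isTree.connected.preconnected _ _) d' rfl

theorem contour_eq_pow (ξ : T.toMap.Corner) (i : ℕ) :
    T.contour ξ i = (T.toMap.faceNext ^ i) ξ := by
  rw [contour, Equiv.Perm.iterate_eq_pow]

theorem contour_bijective [Finite V] (ξ : T.toMap.Corner) :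
    Function.Bijective (fun i : Fin T.numCorners => T.contour ξ i) := by
  classical
  have hfin : Finite T.graph.Dart := Finite.of_injective _ SimpleGraph.Dart.toProd_injective
  have : Fintype T.graph.Dart := Fintype.ofFinite _
  refine Function.Surjective.bijective_of_nat_card_le ?_ ?_
  · intro d
    obtain ⟨i, hi, h⟩ := Equiv.Perm.SameCycle.exists_pow_eq_of_mem_support
      (α := T.graph.Dart) (f := T.toMap.faceNext) (T.sameCycle_faceNext ξ d)
      (Equiv.Perm.mem_support.2 (T.faceNext_ne ξ))
    refine ⟨⟨i, hi.trans_le ?_⟩, ?_⟩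
    · rw [numCorners, Nat.card_eq_fintype_card]
      exact Finset.card_le_univ (α := T.graph.Dart) _
    · simpa [contour_eq_pow] using h
  · simp [numCorners]

theorem mem_blossomCorners [Finite V] (ξ c : T.toMap.Corner) :
    c ∈ T.blossomCorners ξ ↔ T.IsBlossom c.fst := by
  simp only [blossomCorners, List.mem_filter, List.mem_map, List.mem_range, decide_eq_true_eq]
  refine ⟨fun h => h.2, fun h => ⟨?_, h⟩⟩
  obtain ⟨i, hi⟩ := (T.contour_bijective ξ).2 c
  exact ⟨i, i.2, hi⟩

theorem nodup_blossomCorners [Finite V] (ξ : T.toMap.Corner) : (T.blossomCorners ξ).Nodup := by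
  apply List.Nodup.filter
  refine List.Nodup.map_on ?_ List.nodup_range
  intro i hi j hj h
  have := (T.contour_bijective ξ).1 (a₁ := ⟨i, List.mem_range.1 hi⟩) (a₂ := ⟨j, List.mem_range.1 hj⟩) h
  simpa using this

open Classical in
theorem closeAll_sameCycle {X W : Type*} (a : X → X) (τ : Equiv.Perm X) (o : X → W)
    (ho : ∀ x y, τ.SameCycle x y ↔ o x = o y) (L : List X) (hL : L.Nodup)
    (hfix : ∀ b ∈ L, τ b = b) (ha : ∀ b ∈ L, a b ∉ L) (x y : X) :
    (closeAll a τ L).SameCycle x y ↔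
      (if x ∈ L then o (a x) else o x) = (if y ∈ L then o (a y) else o y) := by
  have fixL : ∀ (L : List X) (z : X), z ∉ L → (∀ b ∈ L, a b ≠ z) → τ z = z →
      closeAll a τ L z = z := by
    intro L z hz haz hτ
    induction L with
    | nil => exact hτ
    | cons b L ih =>
      simp only [List.mem_cons, not_or] at hz
      simp only [closeAll, Equiv.Perm.mul_apply]
      rw [ih hz.2 (fun b' hb' => haz b' (by simp [hb']))]
      exact Equiv.swap_apply_of_ne_of_ne hz.1 (haz b (by simp)).symm
  induction L generalizing x y with
  | nil => simp [closeAll, ho]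
  | cons b L ih =>
    have hbL : b ∉ L := (List.nodup_cons.1 hL).1
    have ihL := ih (List.nodup_cons.1 hL).2 (fun b' hb' => hfix b' (by simp [hb']))
      (fun b' hb' h => ha b' (by simp [hb']) (by simp [h]))
    set ρ := closeAll a τ L with hρ
    set c := a b with hc
    have hcb : c ≠ b := fun h => ha b (by simp) (by simp [← hc, h])
    have hcL : c ∉ L := fun h => ha b (by simp) (by simp [← hc, h])
    have hρb : ρ b = b := fixL L b hbL
      (fun b' hb' h => ha b' (by simp [hb']) (by simp [h])) (hfix b (by simp))
    set q : X → W := fun x => if x ∈ L then o (a x) else o x with hq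
    have hqc : q c = o c := by simp [hq, hcL]
    set ρ' : Equiv.Perm X := closeAll a τ (b :: L) with hρ'
    have hρ'x : ∀ x, ρ' x = Equiv.swap b c (ρ x) := fun x => rfl
    have hb1 : ρ' b = c := by rw [hρ'x, hρb, Equiv.swap_apply_left]
    have hstep : ∀ x, ρ'.SameCycle x (ρ x) := by
      intro x
      by_cases h1 : ρ x = b
      · have : x = b := ρ.injective (h1.trans hρb.symm)
        rw [this, hρb]
      · by_cases h2 : ρ x = c
        · have : ρ' x = b := by rw [hρ'x, h2, Equiv.swap_apply_right]
          refine ⟨2, ?_⟩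
          rw [h2, zpow_ofNat, pow_two, Equiv.Perm.mul_apply, this, hb1]
        · refine ⟨1, ?_⟩
          rw [zpow_one, hρ'x, Equiv.swap_apply_of_ne_of_ne h1 h2]
    have hmono : ∀ x y, ρ.SameCycle x y → ρ'.SameCycle x y := by
      rintro x y ⟨n, rfl⟩
      induction n with
      | zero => exact Equiv.Perm.SameCycle.refl _ _
      | succ n ih =>
        rw [add_comm, zpow_add, zpow_one, Equiv.Perm.mul_apply]
        exact ih.trans (hstep _)
      | pred n ih =>
        refine ih.trans ?_
        have := (hstep ((ρ ^ (-(n : ℤ) - 1)) x)).symm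
        rwa [← Equiv.Perm.mul_apply, ← zpow_one_add,
          show (1 + (-(n : ℤ) - 1)) = -n by ring] at this
    set q' : X → W := fun x => if x ∈ b :: L then o (a x) else o x with hq'
    have hq'b : q' b = q c := by simp [hq', hqc, ← hc]
    have hq'x : ∀ x, x ≠ b → q' x = q x := by
      intro x hx
      simp [hq', hq, hx]
    have hqρ : ∀ x, q (ρ x) = q x := fun x => ((ihL x (ρ x)).1 ⟨1, by simp⟩).symm
    have hinv : ∀ x, q' (ρ' x) = q' x := by
      intro x
      by_cases hx : x = b
      · rw [hx, hb1, hq'b, hq'x c hcb]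
      · have h1 : ρ x ≠ b := fun h => hx (ρ.injective (h.trans hρb.symm))
        by_cases h2 : ρ x = c
        · rw [hρ'x, h2, Equiv.swap_apply_right, hq'b, hq'x x hx, ← h2, hqρ]
        · rw [hρ'x, Equiv.swap_apply_of_ne_of_ne h1 h2, hq'x _ h1, hq'x x hx, hqρ]
    change ρ'.SameCycle x y ↔ q' x = q' y
    constructor
    · rintro ⟨n, rfl⟩
      induction n with
      | zero => rfl
      | succ n ih =>
        rw [add_comm, zpow_add, zpow_one, Equiv.Perm.mul_apply, hinv]
        exact ih
      | pred n ih =>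
        refine ih.trans ?_
        have := hinv ((ρ' ^ (-(n : ℤ) - 1)) x)
        rwa [← Equiv.Perm.mul_apply, ← zpow_one_add,
          show (1 + (-(n : ℤ) - 1)) = -n by ring] at this
    · intro h
      have hrep : ∀ x, ∃ z, z ≠ b ∧ ρ'.SameCycle x z ∧ q' x = q z := by
        intro x
        by_cases hx : x = b
        · exact ⟨c, hcb, ⟨1, by rw [zpow_one, hx, hb1]⟩, by rw [hx, hq'b]⟩
        · exact ⟨x, hx, Equiv.Perm.SameCycle.refl _ _, hq'x x hx⟩
      obtain ⟨z, _, hz2, hz3⟩ := hrep x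
      obtain ⟨w, _, hw2, hw3⟩ := hrep y
      exact hz2.trans ((hmono z w ((ihL z w).2 (hz3.symm.trans (h.trans hw3)))).trans hw2.symm)

theorem next_eq_self_of_isBlossom (d : T.graph.Dart) (h : T.IsBlossom d.fst) : T.next d = d := by
  have h1 : (T.next d).fst = d.fst := ((T.sameCycle_next d (T.next d)).1 ⟨1, by simp⟩).symm
  obtain ⟨w, hw⟩ := Set.ncard_eq_one.1 h
  have h2 : d.snd = w := by
    have : d.snd ∈ T.graph.neighborSet d.fst := d.adj
    rwa [hw] at this
  have h3 : (T.next d).snd = w := by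
    have : (T.next d).snd ∈ T.graph.neighborSet d.fst := by
      rw [← h1]
      exact (T.next d).adj
    rwa [hw] at this
  apply SimpleGraph.Dart.ext
  exact Prod.ext h1 (h3.trans h2.symm)

/-- The origin of a dart before the blossoms are closed. -/
noncomputable def openOrigin : T.ClosureDart → V ⊕ Bool
  | Sum.inl d => Sum.inl d.fst
  | Sum.inr b => Sum.inr b

theorem openOrigin_sameCycle (x y : T.ClosureDart) :
    Equiv.Perm.SameCycle (Equiv.sumCongr T.next (1 : Equiv.Perm Bool)) x y ↔
      T.openOrigin x = T.openOrigin y := by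
  have hz : ∀ n : ℤ, (Equiv.sumCongr T.next (1 : Equiv.Perm Bool) : Equiv.Perm T.ClosureDart) ^ n
      = Equiv.sumCongr (T.next ^ n) (1 : Equiv.Perm Bool) := by
    intro n
    have := (map_zpow (Equiv.Perm.sumCongrHom T.graph.Dart Bool) (T.next, 1) n)
    simpa using this.symm
  constructor
  · rintro ⟨n, rfl⟩
    rw [hz]
    rcases x with d | b
    · simp only [Equiv.sumCongr_apply, Sum.map_inl, openOrigin, Sum.inl.injEq]
      exact (T.sameCycle_next _ _).1 ⟨n, rfl⟩
    · simp [openOrigin]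
  · intro h
    rcases x with d | b <;> rcases y with d' | b' <;> simp only [openOrigin, Sum.inl.injEq,
      Sum.inr.injEq, reduceCtorEq] at h
    · obtain ⟨n, hn⟩ := (T.sameCycle_next _ _).2 h
      exact ⟨n, by rw [hz]; simp [hn]⟩
    · rw [h]

theorem closureNext_sameCycle [Finite V] (ξ : T.toMap.Corner) (x y : T.ClosureDart) :
    (T.closureNext ξ).SameCycle x y ↔ T.closureOrigin ξ x = T.closureOrigin ξ y := by
  classical
  let emb : ClosureVertex T → V ⊕ Bool := fun v =>
    match v with
    | .inner v => Sum.inl v.1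
    | .A => Sum.inr true
    | .B => Sum.inr false
  have hemb : Function.Injective emb := by
    rintro (⟨u, hu⟩ | _ | _) (⟨v, hv⟩ | _ | _) h <;> simp_all [emb]
  set L : List T.ClosureDart := (T.blossomCorners ξ).map Sum.inl with hLdef
  have hmem : ∀ z : T.ClosureDart, z ∈ L ↔ ∃ d : T.graph.Dart, T.IsBlossom d.fst ∧ z = Sum.inl d := by
    intro z
    simp only [hLdef, List.mem_map]
    constructor
    · rintro ⟨c, hc, rfl⟩
      exact ⟨c, (T.mem_blossomCorners ξ c).1 hc, rfl⟩
    · rintro ⟨c, hc, rfl⟩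
      exact ⟨c, (T.mem_blossomCorners ξ c).2 hc, rfl⟩
  have hval : ∀ (z : T.ClosureDart) [Decidable (z ∈ L)],
      (if z ∈ L then T.openOrigin (T.closureAnchor ξ z) else T.openOrigin z)
        = emb (T.closureOrigin ξ z) := by
    intro z _
    rcases z with d | (_ | _)
    · by_cases hd : T.IsBlossom d.fst
      · rw [if_pos ((hmem _).2 ⟨d, hd, rfl⟩)]
        by_cases hc : T.IsClosed d
        · simp only [closureAnchor, anchor, if_pos hc, closureOrigin, dif_pos hd, dif_pos hc]
          rfl
        · by_cases hl : T.cornerLabel ξ d = 2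
          · simp only [closureAnchor, anchor, if_neg hc, closureOrigin, dif_pos hd, dif_neg hc,
              if_pos hl]
            rfl
          · simp only [closureAnchor, anchor, if_neg hc, closureOrigin, dif_pos hd, dif_neg hc,
              if_neg hl]
            rfl
      · rw [if_neg]
        · simp only [closureOrigin, dif_neg hd]
          rfl
        · rw [hmem]
          rintro ⟨d', hd', h⟩
          rw [Sum.inl.injEq] at h
          exact hd (h ▸ hd')
    · rw [if_neg (by rw [hmem]; rintro ⟨_, _, h⟩; cases h)]
      rfl
    · rw [if_neg (by rw [hmem]; rintro ⟨_, _, h⟩; cases h)]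
      rfl
  rw [closureNext, closeAll_sameCycle _ _ T.openOrigin T.openOrigin_sameCycle, ← hLdef, hval, hval,
    hemb.eq_iff]
  · exact (T.nodup_blossomCorners ξ).map Sum.inl_injective
  · intro b hb
    obtain ⟨d, hd, rfl⟩ := (hmem b).1 hb
    simp [T.next_eq_self_of_isBlossom d hd]
  · intro b hb hab
    obtain ⟨d, hd, rfl⟩ := (hmem b).1 hb
    obtain ⟨d', hd', h⟩ := (hmem _).1 hab
    simp only [closureAnchor, anchor] at h
    split_ifs at h with h1 h2
    · rw [Sum.inl.injEq] at h
      exact T.successor_inner d h1 (h ▸ hd')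

/-- The closure of the planted tree `(T, ξ)`, as a map. -/
noncomputable def closure [Finite V] (ξ : T.toMap.Corner) :
    RotationMap (ClosureVertex T) T.ClosureDart where
  origin := T.closureOrigin ξ
  rev := T.closureRev
  next := T.closureNext ξ
  rev_rev d := by
    rcases d with d | b
    · simp [closureRev, T.toMap.rev_rev]
    · simp [closureRev]
  rev_ne d := by
    rcases d with d | b
    · simpa [closureRev] using T.toMap.rev_ne d
    · simp [closureRev]
  sameCycle_next d d' := by
    exact T.closureNext_sameCycle ξ d d'

/-- The root corner of the closure: for `ξ = (e, e')`, the corner on the left of `e'` at the root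
vertex, where `e'` (attached to `A`) is followed from the root vertex to `A`. -/
def rootCorner (ξ : T.toMap.Corner) : T.ClosureDart := Sum.inl ξ

open Classical in
/-- The corner of the tree from which a corner of the closure at an inner vertex arises: closing a
blossom splits the corner in which it is attached into two corners. -/
noncomputable def cornerOrigin (d : T.toMap.Corner) : T.toMap.Corner :=
  if T.IsBlossom (T.toMap.origin d) then T.successor d else d

open Classical in
/-- The corner labelling `λ*` of the closure.  A corner at an inner vertex inherits the label of the
tree corner from which it arises.  The corner of `A` in the root face has label `0`, and all other
corners of `A` have label `1`; the corner of `B` in the root face has label `1`, and all other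
corners of `B` have label `2`.  (The last case does not occur: the new darts leave `A` or `B`.) -/
noncomputable def closureLabel [Finite V] (ξ : T.toMap.Corner) (c : (T.closure ξ).Corner) : ℤ :=
  match (T.closure ξ).origin c with
  | .A => if (T.closure ξ).SameFace (T.rootCorner ξ) c then 0 else 1
  | .B => if (T.closure ξ).SameFace (T.rootCorner ξ) c then 1 else 2
  | .inner _ =>
    match c with
    | Sum.inl d => T.cornerLabel ξ (T.cornerOrigin d)
    | Sum.inr _ => 0

/-- The vertex labelling `Y`, extended to the closure by `Y(A) = 1` and `Y(B) = 2`. -/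
noncomputable def closureVertexLabel (ξ : T.toMap.Corner) : ClosureVertex T → ℤ
  | .inner v => T.vertexLabel ξ v.1
  | .A => 1
  | .B => 2

end PlaneTree

/-! The contour walk is recorded by `height`, which rises by 2 after a blossom corner and drops by 1
after an inner corner. Labels are heights shifted by 2 or 3 (`contourLabel_eq`), balance says that
the height never falls below -1, and the successor of a blossom is where the walk first falls below
its level at that blossom (`successor_spec`). Hence the arcs from blossoms to successors are nested
(`successor_le`), and unclosed blossoms lie at level -1 or 0, the levels that lead to `A` and `B`.

Existence: orient inner edges towards the root, stems towards their blossoms and the new edge from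
`B` to `A`. Two stems and a parent edge give outdegree 3; the root lacks the parent edge. The same
count, applied to height increments regrouped by vertices, shows that the walk returns to its level
after exploring the subtree of a child (`height_child`). So turning past an incoming edge keeps the
label and following an outgoing edge lowers it by one; the leftmost path uses up the label until it
ends with label 2 (an edge to `A`) or 3 (an edge to `B`, then the new edge), see
`exists_leftmostPath`. Starting from a corner of minimal label gives the distance bound.

Minimality (`isMinimalOrientation_canonicalOrientation`): each edge of a directed cycle leads to a
later corner (`exists_arrival`). Consider the cycle vertex that the contour visits first. Since the
corners of two vertices cannot interleave (`not_crossing`), the cycle comes back to this vertex at a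
corner after its outgoing edge. Turning further around the vertex, on the left of the cycle, one
meets the parent edge or the root corner itself, and so the region of the root.

Uniqueness (`eq_canonicalOrientation`): orientations with equal outdegrees that differ do so along a
directed cycle `C` of the first, whose reverse is directed in the second. If both are minimal, the
root corner is on the left of `C` and of its reverse. Planarity, which is not built into a rotation
system, has to exclude this: the unit flow along `C` is the boundary of a function on the faces
(`facePotential_next`, `facePotential_symm`), constant on each side of `C` and jumping by one across
it. At an inner corner of the tree, its value is minus the flow through the arcs that enclose the
corner. -/

namespace PlaneTree

variable {V : Type*} (T : PlaneTree V)

/-! ### Positions in the contour exploration -/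

theorem toMap_rev (d : T.graph.Dart) : T.toMap.rev d = d.symm := rfl

theorem faceNext_eq (d : T.graph.Dart) : T.toMap.faceNext d = T.next d.symm := rfl

theorem next_eq_faceNext_symm (d : T.graph.Dart) : T.next d = T.toMap.faceNext d.symm := by
  rw [faceNext_eq, SimpleGraph.Dart.symm_symm]

theorem next_fst (d : T.graph.Dart) : (T.next d).fst = d.fst :=
  ((T.sameCycle_next d (T.next d)).1 ⟨1, by simp⟩).symm

theorem faceNext_fst (d : T.graph.Dart) : (T.toMap.faceNext d).fst = d.snd :=
  T.origin_faceNext d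

theorem contour_zero (ξ : T.graph.Dart) : T.contour ξ 0 = ξ := rfl

theorem contour_succ (ξ : T.graph.Dart) (i : ℕ) :
    T.contour ξ (i + 1) = T.toMap.faceNext (T.contour ξ i) :=
  Function.iterate_succ_apply' _ _ _

theorem contour_contour (ξ : T.graph.Dart) (p j : ℕ) :
    T.contour (T.contour ξ p) j = T.contour ξ (p + j) := by
  simp only [contour]
  rw [add_comm, Function.iterate_add_apply]

theorem contourIndex_self (ξ : T.graph.Dart) : T.contourIndex ξ ξ = 0 :=
  Nat.sInf_eq_zero.2 (Or.inl rfl)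

/-- The vertices that can be reached from the endpoint of `d` without using the edge of `d`. -/
def Side (d : T.graph.Dart) (v : V) : Prop :=
  (T.graph.deleteEdges {s(d.fst, d.snd)}).Reachable v d.snd

theorem not_side_fst (d : T.graph.Dart) : ¬ T.Side d d.fst :=
  SimpleGraph.isBridge_iff.1
    ((SimpleGraph.isAcyclic_iff_forall_isBridge.1 T.isTree.isAcyclic) (e := s(d.fst, d.snd)) d.adj)

theorem side_fst_iff_snd {d x : T.graph.Dart} (h1 : x ≠ d) (h2 : x ≠ d.symm) :
    T.Side d x.fst ↔ T.Side d x.snd := by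
  have h : (T.graph.deleteEdges {s(d.fst, d.snd)}).Adj x.fst x.snd := by
    rw [SimpleGraph.deleteEdges_adj]
    refine ⟨x.adj, fun hmem => ?_⟩
    rcases (SimpleGraph.dart_edge_eq_iff x d).1 hmem with h | h
    · exact h1 h
    · exact h2 h
  exact ⟨h.symm.reachable.trans, h.reachable.trans⟩

section Finite

variable [Finite V]

theorem exists_contour_eq (ξ d : T.graph.Dart) : ∃ i < T.numCorners, T.contour ξ i = d := by
  obtain ⟨i, hi⟩ := (T.contour_bijective ξ).2 d
  exact ⟨i, i.2, hi⟩

theorem contour_contourIndex (ξ d : T.graph.Dart) : T.contour ξ (T.contourIndex ξ d) = d := by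
  obtain ⟨i, _, hi⟩ := T.exists_contour_eq ξ d
  exact Nat.sInf_mem (s := {i | T.contour ξ i = d}) ⟨i, hi⟩

theorem contourIndex_lt (ξ d : T.graph.Dart) : T.contourIndex ξ d < T.numCorners := by
  obtain ⟨i, h, hi⟩ := T.exists_contour_eq ξ d
  exact (Nat.sInf_le (s := {i | T.contour ξ i = d}) hi).trans_lt h

theorem contour_inj {ξ : T.graph.Dart} {i j : ℕ} (hi : i < T.numCorners) (hj : j < T.numCorners)
    (h : T.contour ξ i = T.contour ξ j) : i = j := by
  have := (T.contour_bijective ξ).1 (a₁ := ⟨i, hi⟩) (a₂ := ⟨j, hj⟩) h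
  simpa using this

theorem contourIndex_contour (ξ : T.graph.Dart) {i : ℕ} (hi : i < T.numCorners) :
    T.contourIndex ξ (T.contour ξ i) = i :=
  T.contour_inj (T.contourIndex_lt _ _) hi (T.contour_contourIndex _ _)

theorem contourIndex_inj {ξ d d' : T.graph.Dart}
    (h : T.contourIndex ξ d = T.contourIndex ξ d') : d = d' := by
  rw [← T.contour_contourIndex ξ d, h, contour_contourIndex]

theorem contourIndex_eq_zero {ξ d : T.graph.Dart} (h : T.contourIndex ξ d = 0) : d = ξ :=
  T.contourIndex_inj (h.trans (T.contourIndex_self ξ).symm)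

/-- The first repetition of an injective iteration can only be at its starting point. -/
theorem contour_numCorners (ξ : T.graph.Dart) : T.contour ξ T.numCorners = ξ := by
  have h0 := T.contourIndex_lt ξ ξ
  obtain ⟨j, hj, h⟩ := T.exists_contour_eq ξ (T.contour ξ T.numCorners)
  obtain ⟨n, hn⟩ := Nat.exists_eq_add_of_lt h0
  rcases j with _ | j
  · exact h.symm
  · rw [hn, contour_succ, contour_succ] at h
    have := T.contour_inj (by omega) (by omega) (T.toMap.faceNext.injective h)
    omega

theorem contourIndex_faceNext {ξ d : T.graph.Dart} (h : T.contourIndex ξ d + 1 < T.numCorners) :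
    T.contourIndex ξ (T.toMap.faceNext d) = T.contourIndex ξ d + 1 := by
  conv_lhs => rw [← T.contour_contourIndex ξ d, ← contour_succ]
  exact T.contourIndex_contour ξ h

theorem faceNext_eq_root {ξ d : T.graph.Dart} (h : T.contourIndex ξ d + 1 = T.numCorners) :
    T.toMap.faceNext d = ξ := by
  conv_lhs => rw [← T.contour_contourIndex ξ d, ← contour_succ, h]
  exact T.contour_numCorners ξ

theorem contourIndex_pred {ξ d : T.graph.Dart} (h : T.contourIndex ξ (T.toMap.faceNext d) ≠ 0) :
    T.contourIndex ξ (T.toMap.faceNext d) = T.contourIndex ξ d + 1 := by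
  rcases (Nat.succ_le_of_lt (T.contourIndex_lt ξ d)).lt_or_eq with h1 | h1
  · exact T.contourIndex_faceNext h1
  · rw [T.faceNext_eq_root h1, contourIndex_self] at h
    exact absurd rfl h

theorem contourIndex_symm_ne (ξ d : T.graph.Dart) :
    T.contourIndex ξ d.symm ≠ T.contourIndex ξ d :=
  fun h => d.symm_ne (T.contourIndex_inj h)

/-- Along the contour, the side changes only when the edge of `d` itself is traversed, that is,
right after the positions of `d` and of `d.symm`. -/
theorem side_iff {ξ d : T.graph.Dart} (hd : T.contourIndex ξ d < T.contourIndex ξ d.symm)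
    (x : T.graph.Dart) :
    T.Side d x.fst ↔
      T.contourIndex ξ d < T.contourIndex ξ x ∧ T.contourIndex ξ x ≤ T.contourIndex ξ d.symm := by
  set i := T.contourIndex ξ d with hi
  set j := T.contourIndex ξ d.symm with hj
  have hjN : j < T.numCorners := T.contourIndex_lt ξ _
  have hci : T.contour ξ i = d := T.contour_contourIndex ξ d
  have hcj : T.contour ξ j = d.symm := T.contour_contourIndex ξ _
  have hstep : ∀ k, k < T.numCorners → k ≠ i → k ≠ j →
      (T.Side d (T.contour ξ k).fst ↔ T.Side d (T.contour ξ (k + 1)).fst) := by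
    intro k hk hki hkj
    rw [contour_succ, faceNext_fst]
    refine T.side_fst_iff_snd (fun h => hki ?_) (fun h => hkj ?_)
    · rw [hi, ← h, T.contourIndex_contour ξ hk]
    · rw [hj, ← h, T.contourIndex_contour ξ hk]
  have hin : ∀ k, i + 1 ≤ k → k ≤ j → T.Side d (T.contour ξ k).fst := by
    intro k hk
    induction k, hk using Nat.le_induction with
    | base =>
      intro _
      rw [contour_succ, faceNext_fst, hci]
      exact SimpleGraph.Reachable.refl _
    | succ k hk ih =>
      intro hkj
      exact (hstep k (by omega) (by omega) (by omega)).1 (ih (by omega))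
  have hout : ∀ k, j + 1 ≤ k → k < T.numCorners → ¬ T.Side d (T.contour ξ k).fst := by
    intro k hk
    induction k, hk using Nat.le_induction with
    | base =>
      intro _
      rw [contour_succ, faceNext_fst, hcj]
      exact T.not_side_fst d
    | succ k hk ih =>
      intro hkj
      rw [← hstep k (by omega) (by omega) (by omega)]
      exact ih (by omega)
  have hout' : ∀ k, k ≤ i → ¬ T.Side d (T.contour ξ (i - k)).fst := by
    intro k
    induction k with
    | zero =>
      intro _
      rw [Nat.sub_zero, hci]
      exact T.not_side_fst d
    | succ k ih =>
      intro hk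
      rw [hstep _ (by omega) (by omega) (by omega), show i - (k + 1) + 1 = i - k by omega]
      exact ih (by omega)
  have hx := T.contour_contourIndex ξ x
  have hxN := T.contourIndex_lt ξ x
  set k := T.contourIndex ξ x
  rw [← hx]
  constructor
  · intro h
    by_contra hk
    rcases le_or_gt k i with h1 | h1
    · apply hout' (i - k) (by omega)
      rwa [show i - (i - k) = k by omega]
    · exact hout k (by omega) hxN h
  · rintro ⟨h1, h2⟩
    exact hin k h1 h2

/-- The corners on one side of an edge form an interval, which consists of all corners at certain
vertices. -/
theorem interval_iff {ξ d x y : T.graph.Dart}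
    (hd : T.contourIndex ξ d < T.contourIndex ξ d.symm) (hxy : x.fst = y.fst) :
    (T.contourIndex ξ d < T.contourIndex ξ x ∧ T.contourIndex ξ x ≤ T.contourIndex ξ d.symm) ↔
      T.contourIndex ξ d < T.contourIndex ξ y ∧ T.contourIndex ξ y ≤ T.contourIndex ξ d.symm := by
  rw [← T.side_iff hd, ← T.side_iff hd, hxy]

theorem interval_symm_iff {ξ d x : T.graph.Dart}
    (hd : T.contourIndex ξ d < T.contourIndex ξ d.symm) (h1 : x ≠ d) (h2 : x ≠ d.symm) :
    (T.contourIndex ξ d < T.contourIndex ξ x ∧ T.contourIndex ξ x ≤ T.contourIndex ξ d.symm) ↔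
      T.contourIndex ξ d < T.contourIndex ξ x.symm ∧
        T.contourIndex ξ x.symm ≤ T.contourIndex ξ d.symm := by
  rw [← T.side_iff hd, ← T.side_iff hd, T.side_fst_iff_snd h1 h2]
  rfl

/-- The corners at two distinct vertices do not cross. -/
theorem not_crossing {ξ a b c d : T.graph.Dart} (hac : a.fst = c.fst) (hbd : b.fst = d.fst)
    (hne : a.fst ≠ b.fst) (h1 : T.contourIndex ξ a < T.contourIndex ξ b)
    (h2 : T.contourIndex ξ b < T.contourIndex ξ c)
    (h3 : T.contourIndex ξ c < T.contourIndex ξ d) : False := by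
  classical
  have hfin : Finite T.graph.Dart := Finite.of_injective _ SimpleGraph.Dart.toProd_injective
  -- `y` is the last corner before `b` at the vertex of `a`. If its edge leads towards the root, `y`
  -- is the last corner at that vertex altogether, against `c`.
  obtain ⟨y, ⟨hy1, hy2⟩, hmax⟩ := Set.exists_max_image
    {y : T.graph.Dart | y.fst = a.fst ∧ T.contourIndex ξ y < T.contourIndex ξ b}
    (T.contourIndex ξ) (Set.toFinite _) ⟨a, rfl, h1⟩
  rcases lt_or_gt_of_ne (T.contourIndex_symm_ne ξ y) with h | h
  · have hy : y.symm.symm = y := y.symm_symm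
    have := T.interval_iff (d := y.symm) (ξ := ξ) (x := y) (y := c) (by rwa [hy])
      (hy1.trans hac)
    rw [hy] at this
    have := this.1 ⟨h, le_rfl⟩
    omega
  -- Otherwise the contour enters a subtree after `y` and returns to the vertex of `a` before or at
  -- `c`. By the choice of `y`, the corner `b` is in this subtree, hence so is `d`.
  · have hc := T.interval_iff (ξ := ξ) (x := y) (y := c) h (hy1.trans hac)
    have hcy : T.contourIndex ξ y.symm < T.contourIndex ξ c := by
      by_contra hcon
      have := hc.2 ⟨by omega, by omega⟩
      omega
    have hN := T.contourIndex_lt ξ c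
    have hz := T.contourIndex_faceNext (ξ := ξ) (d := y.symm) (by omega)
    rw [← next_eq_faceNext_symm] at hz
    have hz1 : (T.next y).fst = a.fst := (T.next_fst y).trans hy1
    have hzb : T.contourIndex ξ (T.next y) ≠ T.contourIndex ξ b := by
      intro h
      apply hne
      rw [← hz1, T.contourIndex_inj h]
    have hzb' : ¬ T.contourIndex ξ (T.next y) < T.contourIndex ξ b := by
      intro h
      have := hmax _ ⟨hz1, h⟩
      omega
    have := (T.interval_iff (ξ := ξ) h hbd).1 ⟨hy2, by omega⟩
    omega

end Finite

end PlaneTree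

namespace PlaneTree

variable {V : Type*} (T : PlaneTree V)

/-! ### Stems, parents, children -/

/-- A dart between inner vertices that leads towards the root corner `ξ`. -/
def IsParentDart (ξ d : T.graph.Dart) : Prop :=
  ¬ T.IsBlossom d.fst ∧ ¬ T.IsBlossom d.snd ∧ T.contourIndex ξ d.symm < T.contourIndex ξ d

theorem faceNext_stem {d : T.graph.Dart} (h : T.IsBlossom d.snd) : T.toMap.faceNext d = d.symm :=
  T.next_eq_self_of_isBlossom d.symm h

section Finite

variable [Finite V]

theorem finite_dart : Finite T.graph.Dart :=
  Finite.of_injective _ SimpleGraph.Dart.toProd_injective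

/-- Two adjacent blossoms would trap the contour on a single edge, so it would never reach `ξ`. -/
theorem not_isBlossom_snd {ξ : T.graph.Dart} (hξ : ¬ T.IsBlossom ξ.fst) {d : T.graph.Dart}
    (hd : T.IsBlossom d.fst) : ¬ T.IsBlossom d.snd := by
  intro hd'
  have h1 : T.toMap.faceNext d = d.symm := T.faceNext_stem hd'
  have h2 : T.toMap.faceNext d.symm = d := by
    have := T.faceNext_stem (d := d.symm) hd
    rwa [SimpleGraph.Dart.symm_symm] at this
  have key : ∀ i, T.contour d i = d ∨ T.contour d i = d.symm := by
    intro i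
    induction i with
    | zero => exact Or.inl rfl
    | succ i ih =>
      rw [contour_succ]
      rcases ih with h | h <;> rw [h]
      · exact Or.inr h1
      · exact Or.inl h2
  obtain ⟨i, _, rfl⟩ := T.exists_contour_eq d ξ
  rcases key i with h | h <;> rw [h] at hξ
  · exact hξ hd
  · exact hξ hd'

/-- The contour turns back at a blossom at once; it does not pass the root corner there, since `ξ`
is not at a blossom. -/
theorem contourIndex_stem {ξ : T.graph.Dart} (hξ : ¬ T.IsBlossom ξ.fst) {d : T.graph.Dart}
    (hd : T.IsBlossom d.snd) : T.contourIndex ξ d.symm = T.contourIndex ξ d + 1 := by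
  have h := T.faceNext_stem hd
  rw [← h]
  apply T.contourIndex_pred
  rw [h]
  intro h0
  rw [← T.contourIndex_eq_zero h0] at hξ
  exact hξ hd

theorem one_lt_ncard_neighborSet {d : T.graph.Dart} (hd : ¬ T.IsBlossom d.fst) :
    1 < (T.graph.neighborSet d.fst).ncard := by
  have h0 : 0 < (T.graph.neighborSet d.fst).ncard :=
    (Set.ncard_pos (Set.toFinite _)).2 ⟨d.snd, d.adj⟩
  have h1 : (T.graph.neighborSet d.fst).ncard ≠ 1 := hd
  omega

theorem ncard_stems (hT : T.IsBlossoming) {u : V} (hu : ¬ T.IsBlossom u)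
    (hd : ∃ d : T.graph.Dart, d.fst = u) :
    {d : T.graph.Dart | d.fst = u ∧ T.IsBlossom d.snd}.ncard = 2 := by
  obtain ⟨d, rfl⟩ := hd
  rw [← hT _ (T.one_lt_ncard_neighborSet hu)]
  refine Set.ncard_congr (fun x _ => x.snd) ?_ ?_ ?_
  · rintro x ⟨h1, h2⟩
    exact ⟨h1 ▸ x.adj, h2⟩
  · rintro x y ⟨h1, _⟩ ⟨h2, _⟩ h
    exact SimpleGraph.Dart.ext _ _ (Prod.ext (h1.trans h2.symm) h)
  · rintro w ⟨h1, h2⟩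
    exact ⟨⟨(_, w), h1⟩, ⟨rfl, h2⟩, rfl⟩

/-- The subtree below the edge of `x` is the contour interval that ends at `x`. In particular a
parent dart is the last corner at its vertex, which makes it unique. -/
theorem parentDart_le {ξ x y : T.graph.Dart} (hx : T.IsParentDart ξ x) (hxy : x.fst = y.fst) :
    T.contourIndex ξ x.symm < T.contourIndex ξ y ∧ T.contourIndex ξ y ≤ T.contourIndex ξ x := by
  have := T.interval_iff (ξ := ξ) (d := x.symm) (x := x) (y := y) (by simpa using hx.2.2) hxy
  rw [SimpleGraph.Dart.symm_symm] at this
  exact this.1 ⟨hx.2.2, le_rfl⟩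

theorem ncard_parents_root {ξ : T.graph.Dart} :
    {d : T.graph.Dart | d.fst = ξ.fst ∧ T.IsParentDart ξ d}.ncard = 0 := by
  have := T.finite_dart
  rw [Set.ncard_eq_zero (Set.toFinite _), Set.eq_empty_iff_forall_notMem]
  rintro d ⟨h1, h2⟩
  have := (T.parentDart_le h2 h1).1
  rw [contourIndex_self] at this
  omega

/-- The contour first enters `u` from its parent: the edge just before the first corner at `u` in
clockwise order is the one sought. -/
theorem exists_parentDart {ξ : T.graph.Dart} (hξ : ¬ T.IsBlossom ξ.fst) {u : V}
    (hu : ¬ T.IsBlossom u) (hd : ∃ d : T.graph.Dart, d.fst = u) (hne : u ≠ ξ.fst) :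
    ∃ x : T.graph.Dart, x.fst = u ∧ T.IsParentDart ξ x := by
  have := T.finite_dart
  obtain ⟨d, hd⟩ := hd
  obtain ⟨y, hy, hmin⟩ := Set.exists_min_image {y : T.graph.Dart | y.fst = u} (T.contourIndex ξ)
    (Set.toFinite _) ⟨d, hd⟩
  have hy1 : y.fst = u := hy
  have hx : T.next (T.next.symm y) = y := T.next.apply_symm_apply y
  set x := T.next.symm y
  have hxu : x.fst = u := by rw [← hy1, ← hx, next_fst]
  have hy0 : T.contourIndex ξ y ≠ 0 := fun h => hne (by rw [← hy1, T.contourIndex_eq_zero h])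
  have hidx : T.contourIndex ξ y = T.contourIndex ξ x.symm + 1 := by
    rw [← hx, next_eq_faceNext_symm] at hy0 ⊢
    exact T.contourIndex_pred hy0
  have hle := hmin x hxu
  have hlt : T.contourIndex ξ x.symm < T.contourIndex ξ x := by omega
  refine ⟨x, hxu, hxu ▸ hu, fun hb => ?_, hlt⟩
  have := T.contourIndex_stem hξ hb
  omega

theorem ncard_parents {ξ : T.graph.Dart} (hξ : ¬ T.IsBlossom ξ.fst) {u : V}
    (hu : ¬ T.IsBlossom u) (hd : ∃ d : T.graph.Dart, d.fst = u) (hne : u ≠ ξ.fst) :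
    {d : T.graph.Dart | d.fst = u ∧ T.IsParentDart ξ d}.ncard = 1 := by
  obtain ⟨x, hxu, hx⟩ := T.exists_parentDart hξ hu hd hne
  rw [Set.ncard_eq_one]
  refine ⟨x, Set.eq_singleton_iff_unique_mem.2 ⟨⟨hxu, hx⟩, ?_⟩⟩
  rintro z ⟨hz1, hz2⟩
  apply T.contourIndex_inj (ξ := ξ)
  have h1 := (T.parentDart_le hx (hxu.trans hz1.symm)).2
  have h2 := (T.parentDart_le hz2 (hz1.trans hxu.symm)).2
  omega

end Finite

/-! ### The height of the contour walk -/

/-- The walk that increases by `2` after a corner at a blossom and decreases by `1` after a corner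
at an inner vertex. -/
noncomputable def height (ξ : T.graph.Dart) (i : ℕ) : ℤ :=
  3 * (countBelow (fun j => T.IsBlossom (T.contour ξ j).fst) i : ℤ) - i

theorem height_zero (ξ : T.graph.Dart) : T.height ξ 0 = 0 := by
  simp [height, countBelow]

theorem height_succ_blossom {ξ : T.graph.Dart} {i : ℕ} (h : T.IsBlossom (T.contour ξ i).fst) :
    T.height ξ (i + 1) = T.height ξ i + 2 := by
  simp only [height, countBelow, Nat.count_succ, if_pos h]
  push_cast
  ring

theorem height_succ_inner {ξ : T.graph.Dart} {i : ℕ} (h : ¬ T.IsBlossom (T.contour ξ i).fst) :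
    T.height ξ (i + 1) = T.height ξ i - 1 := by
  simp only [height, countBelow, Nat.count_succ, if_neg h]
  push_cast
  ring

theorem height_add (ξ : T.graph.Dart) (p k : ℕ) :
    T.height ξ (p + k) = T.height ξ p + T.height (T.contour ξ p) k := by
  have h : (fun j => T.IsBlossom (T.contour (T.contour ξ p) j).fst)
      = fun j => T.IsBlossom (T.contour ξ (p + j)).fst := by
    funext j
    rw [contour_contour]
  rw [height, height, height, h]
  simp only [countBelow, Nat.count_add]
  push_cast
  ring

/-- This turns the counting condition for successors into a passage of the walk below its starting
level. -/
theorem blossomCount_lt_iff (ξ : T.graph.Dart) (p k : ℕ) :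
    3 * T.blossomCount (T.contour ξ p) k < k + 1 ↔ T.height ξ (p + k + 1) < T.height ξ p := by
  rw [add_assoc, height_add]
  have : T.height (T.contour ξ p) (k + 1) = 3 * (T.blossomCount (T.contour ξ p) k : ℤ) - (k + 1) := by
    simp only [height, blossomCount]
    push_cast
    rfl
  rw [this]
  omega

theorem height_of_isBalanced {ξ : T.graph.Dart} (hξ : T.IsBalanced ξ) {i : ℕ}
    (hi : i < T.numCorners) : -1 ≤ T.height ξ (i + 1) := by
  have := hξ.2.2.2 i hi
  have h : T.height ξ (i + 1) = 3 * (T.blossomCount ξ i : ℤ) - (i + 1) := by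
    simp only [height, blossomCount]
    push_cast
    rfl
  rw [h]
  omega

open Classical in
-- Into and out of a blossom the label changes by 0 and 1, the height by -1 and 2. Raising the
-- offset by one at blossoms reconciles them.
theorem contourLabel_eq [Finite V] {ξ : T.graph.Dart} (hξ : ¬ T.IsBlossom ξ.fst) (i : ℕ) :
    T.contourLabel ξ i =
      T.height ξ i + if T.IsBlossom (T.contour ξ i).fst then 3 else 2 := by
  induction i with
  | zero => simp [contourLabel, height_zero, contour_zero, hξ]
  | succ i ih =>
    have key : T.IsBlossom (T.contour ξ i).fst → ¬ T.IsBlossom (T.contour ξ (i + 1)).fst := by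
      rw [contour_succ, faceNext_fst]
      exact T.not_isBlossom_snd hξ
    have hdef : T.contourLabel ξ (i + 1) =
        if T.IsBlossom (T.contour ξ i).fst then T.contourLabel ξ i + 1
        else if T.IsBlossom (T.contour ξ (i + 1)).fst then T.contourLabel ξ i
        else T.contourLabel ξ i - 1 := rfl
    rw [hdef, ih]
    by_cases h : T.IsBlossom (T.contour ξ i).fst
    · rw [T.height_succ_blossom h]
      simp only [if_pos h, if_neg (key h)]
      ring
    · rw [T.height_succ_inner h]
      by_cases h' : T.IsBlossom (T.contour ξ (i + 1)).fst
      · simp only [if_neg h, if_pos h']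
        ring
      · simp only [if_neg h, if_neg h']
        ring

end PlaneTree

/-! ### Height increments regrouped by edges and vertices -/

namespace PlaneTree

variable {V : Type*} (T : PlaneTree V)

open Classical in
/-- The increment of the height after the corner `d`. -/
noncomputable def heightStep (d : T.graph.Dart) : ℤ := if T.IsBlossom d.fst then 2 else -1

open Classical in
/-- The increments of the height, where the total increment along both sides of an edge is attributed
to the endpoint of the edge away from the root for edges between inner vertices, and to the inner
vertex for stems. -/
noncomputable def edgeWeight (ξ d : T.graph.Dart) : ℤ :=
  (if ¬ T.IsBlossom d.fst ∧ T.IsBlossom d.snd then 1 else 0)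
    - 2 * if T.IsParentDart ξ d then 1 else 0

section Finite

variable [Finite V]

theorem height_sub [Fintype T.graph.Dart] (ξ : T.graph.Dart) {i j : ℕ} (hij : i ≤ j)
    (hj : j ≤ T.numCorners) :
    T.height ξ j - T.height ξ i =
      ∑ d with i ≤ T.contourIndex ξ d ∧ T.contourIndex ξ d < j, T.heightStep d := by
  classical
  induction j, hij using Nat.le_induction with
  | base =>
    rw [sub_self, Finset.filter_eq_empty_iff.2, Finset.sum_empty]
    intro d _
    omega
  | succ j hij ih =>
    have hset : (Finset.univ.filter fun d => i ≤ T.contourIndex ξ d ∧ T.contourIndex ξ d < j + 1)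
        = insert (T.contour ξ j)
          (Finset.univ.filter fun d => i ≤ T.contourIndex ξ d ∧ T.contourIndex ξ d < j) := by
      ext d
      simp only [Finset.mem_filter, Finset.mem_univ, true_and, Finset.mem_insert]
      constructor
      · rintro ⟨h1, h2⟩
        rcases (Nat.lt_succ_iff.1 h2).lt_or_eq with h | h
        · exact Or.inr ⟨h1, h⟩
        · left
          rw [← h, contour_contourIndex]
      · rintro (rfl | ⟨h1, h2⟩)
        · rw [T.contourIndex_contour ξ (by omega)]
          omega
        · omega
    rw [hset, Finset.sum_insert, ← ih (by omega)]
    · by_cases h : T.IsBlossom (T.contour ξ j).fst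
      · rw [T.height_succ_blossom h, heightStep, if_pos h]
        ring
      · rw [T.height_succ_inner h, heightStep, if_neg h]
        ring
    · simp only [Finset.mem_filter, Finset.mem_univ, true_and, not_and, not_lt]
      rw [T.contourIndex_contour ξ (by omega)]
      omega

/-- Both sides are 1 for a stem and -2 for an edge between inner vertices. -/
theorem heightStep_add_symm {ξ : T.graph.Dart} (hξ : ¬ T.IsBlossom ξ.fst) (d : T.graph.Dart) :
    T.heightStep d + T.heightStep d.symm = T.edgeWeight ξ d + T.edgeWeight ξ d.symm := by
  have h1 := T.not_isBlossom_snd hξ (d := d)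
  have h2 := T.contourIndex_symm_ne ξ d
  have h3 : T.IsBlossom d.symm.fst ↔ T.IsBlossom d.snd := Iff.rfl
  have h4 : T.IsBlossom d.symm.snd ↔ T.IsBlossom d.fst := Iff.rfl
  have h6 : T.IsParentDart ξ d.symm ↔ ¬ T.IsBlossom d.snd ∧ ¬ T.IsBlossom d.fst ∧
      T.contourIndex ξ d < T.contourIndex ξ d.symm := by
    rw [IsParentDart, SimpleGraph.Dart.symm_symm]
    exact Iff.rfl
  simp only [heightStep, edgeWeight, h3, h4]
  by_cases ha : T.IsBlossom d.fst <;> by_cases hb : T.IsBlossom d.snd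
  · exact absurd hb (h1 ha)
  · have p : ¬ T.IsParentDart ξ d := fun p => p.1 ha
    have p' : ¬ T.IsParentDart ξ d.symm := fun p => p.2.1 ha
    simp [ha, hb, p, p']
  · have p : ¬ T.IsParentDart ξ d := fun p => p.2.1 hb
    have p' : ¬ T.IsParentDart ξ d.symm := fun p => p.1 hb
    simp [ha, hb, p, p']
  · rcases lt_or_gt_of_ne h2 with h | h
    · have p : T.IsParentDart ξ d := ⟨ha, hb, h⟩
      have p' : ¬ T.IsParentDart ξ d.symm := fun p => h.not_gt (h6.1 p).2.2
      simp [ha, hb, p, p']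
    · have p : ¬ T.IsParentDart ξ d := fun p => h.not_gt p.2.2
      have p' : T.IsParentDart ξ d.symm := h6.2 ⟨hb, ha, h⟩
      simp [ha, hb, p, p']

theorem sum_heightStep [Fintype T.graph.Dart] {ξ : T.graph.Dart} (hξ : ¬ T.IsBlossom ξ.fst)
    (S : Finset T.graph.Dart) (hS : ∀ d ∈ S, d.symm ∈ S) :
    ∑ d ∈ S, T.heightStep d = ∑ d ∈ S, T.edgeWeight ξ d := by
  have hsymm : ∀ g : T.graph.Dart → ℤ, ∑ d ∈ S, g d.symm = ∑ d ∈ S, g d := by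
    intro g
    exact Finset.sum_nbij' (fun d => d.symm) (fun d => d.symm) hS hS
      (fun d _ => d.symm_symm) (fun d _ => d.symm_symm) (fun d _ => rfl)
  have h := Finset.sum_congr (rfl : S = S) fun d _ => T.heightStep_add_symm hξ d
  rw [Finset.sum_add_distrib, Finset.sum_add_distrib, hsymm, hsymm (T.edgeWeight ξ)] at h
  omega

open Classical in
-- An inner vertex has two stems of weight 1, and a parent edge of weight -2 unless it is the root
-- vertex.
theorem sum_edgeWeight_vertex [Fintype T.graph.Dart] (hT : T.IsBlossoming) {ξ : T.graph.Dart}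
    (hξ : ¬ T.IsBlossom ξ.fst) (u : V) (hu : ∃ d : T.graph.Dart, d.fst = u) :
    ∑ d with d.fst = u, T.edgeWeight ξ d = if u = ξ.fst then 2 else 0 := by
  by_cases hb : T.IsBlossom u
  · rw [if_neg (fun h : u = ξ.fst => hξ (h ▸ hb))]
    apply Finset.sum_eq_zero
    intro d hd
    rw [Finset.mem_filter] at hd
    have : T.IsBlossom d.fst := hd.2 ▸ hb
    simp [edgeWeight, IsParentDart, this]
  · have h1 := T.ncard_stems hT hb hu
    have h2 : {d : T.graph.Dart | d.fst = u ∧ T.IsParentDart ξ d}.ncard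
        = if u = ξ.fst then 0 else 1 := by
      split_ifs with h
      · rw [h]
        exact T.ncard_parents_root
      · exact T.ncard_parents hξ hb hu h
    rw [Set.ncard_eq_toFinset_card'] at h1 h2
    simp only [edgeWeight, Finset.sum_sub_distrib, ← Finset.mul_sum, Finset.sum_boole,
      Finset.filter_filter]
    have e1 : (Finset.univ.filter fun d : T.graph.Dart =>
        d.fst = u ∧ ¬ T.IsBlossom d.fst ∧ T.IsBlossom d.snd)
        = {d : T.graph.Dart | d.fst = u ∧ T.IsBlossom d.snd}.toFinset := by
      ext d
      simp only [Finset.mem_filter, Finset.mem_univ, true_and, Set.mem_toFinset, Set.mem_ofPred_eq]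
      constructor
      · rintro ⟨h, _, h'⟩
        exact ⟨h, h'⟩
      · rintro ⟨h, h'⟩
        exact ⟨h, h ▸ hb, h'⟩
    have e2 : (Finset.univ.filter fun d : T.graph.Dart => d.fst = u ∧ T.IsParentDart ξ d)
        = {d : T.graph.Dart | d.fst = u ∧ T.IsParentDart ξ d}.toFinset := by
      ext d
      simp
    rw [e1, e2, h1, h2]
    split_ifs <;> norm_num

theorem height_numCorners (hT : T.IsBlossoming) {ξ : T.graph.Dart} (hξ : ¬ T.IsBlossom ξ.fst) :
    T.height ξ T.numCorners = 2 := by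
  classical
  have := T.finite_dart
  have := Fintype.ofFinite T.graph.Dart
  have := Fintype.ofFinite V
  have h := T.height_sub ξ (Nat.zero_le _) le_rfl
  rw [height_zero, sub_zero] at h
  rw [h, T.sum_heightStep hξ, Finset.filter_true_of_mem, ← Finset.sum_fiberwise _ (fun d => d.fst)]
  · rw [Finset.sum_eq_single ξ.fst]
    · rw [T.sum_edgeWeight_vertex hT hξ _ ⟨ξ, rfl⟩, if_pos rfl]
    · intro u _ hu
      by_cases hd : ∃ d : T.graph.Dart, d.fst = u
      · rw [T.sum_edgeWeight_vertex hT hξ _ hd, if_neg hu]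
      · push Not at hd
        exact Finset.sum_eq_zero fun d h' => absurd (Finset.mem_filter.1 h').2 (hd d)
    · simp
  · intro d _
    exact ⟨Nat.zero_le _, T.contourIndex_lt ξ d⟩
  · intro d _
    simp [T.contourIndex_lt ξ d.symm]

/-- The height returns to its value after the exploration of the subtree of a child. -/
theorem height_child (hT : T.IsBlossoming) {ξ d : T.graph.Dart} (hξ : ¬ T.IsBlossom ξ.fst)
    (h1 : ¬ T.IsBlossom d.snd)
    (h3 : T.contourIndex ξ d < T.contourIndex ξ d.symm) :
    T.height ξ (T.contourIndex ξ d.symm + 1) = T.height ξ (T.contourIndex ξ d) := by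
  classical
  have := T.finite_dart
  have := Fintype.ofFinite T.graph.Dart
  have := Fintype.ofFinite V
  have h := T.height_sub ξ (i := T.contourIndex ξ d) (j := T.contourIndex ξ d.symm + 1)
    (by omega) (T.contourIndex_lt ξ _)
  rw [T.sum_heightStep hξ] at h
  · rw [← sub_eq_zero, h]
    -- Including `d` makes the index set closed under reversal, and `d` has weight 0. What remains
    -- consists of all corners at the vertices of the subtree, so it splits into vertex sums, none
    -- of them at the root.
    have hset : (Finset.univ.filter fun x => T.contourIndex ξ d ≤ T.contourIndex ξ x ∧
        T.contourIndex ξ x < T.contourIndex ξ d.symm + 1)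
        = insert d (Finset.univ.filter fun x => T.contourIndex ξ d < T.contourIndex ξ x ∧
          T.contourIndex ξ x ≤ T.contourIndex ξ d.symm) := by
      ext x
      simp only [Finset.mem_filter, Finset.mem_univ, true_and, Finset.mem_insert]
      constructor
      · rintro ⟨h4, h5⟩
        rcases h4.lt_or_eq with h | h
        · exact Or.inr ⟨h, by omega⟩
        · exact Or.inl (T.contourIndex_inj h.symm)
      · rintro (rfl | h)
        · omega
        · omega
    rw [hset, Finset.sum_insert (by simp), ← Finset.sum_fiberwise _ (fun d => d.fst)]
    have hd0 : T.edgeWeight ξ d = 0 := by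
      simp [edgeWeight, IsParentDart, h1, h3.not_gt]
    rw [hd0, zero_add]
    apply Finset.sum_eq_zero
    intro u _
    by_cases hd : ∃ x : T.graph.Dart, x.fst = u ∧
      T.contourIndex ξ d < T.contourIndex ξ x ∧ T.contourIndex ξ x ≤ T.contourIndex ξ d.symm
    · obtain ⟨x, hxu, hx⟩ := hd
      have hu : u ≠ ξ.fst := by
        intro hu
        have := (T.interval_iff h3 (hxu.trans hu)).1 hx
        rw [contourIndex_self] at this
        omega
      have hS := T.sum_edgeWeight_vertex hT hξ u ⟨x, hxu⟩
      rw [if_neg hu] at hS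
      rw [← hS, Finset.filter_filter]
      apply Finset.sum_congr _ fun _ _ => rfl
      ext y
      simp only [Finset.mem_filter, Finset.mem_univ, true_and, and_iff_right_iff_imp]
      intro hy
      exact (T.interval_iff h3 (hxu.trans hy.symm)).1 hx
    · push Not at hd
      apply Finset.sum_eq_zero
      intro x hx
      simp only [Finset.mem_filter, Finset.mem_univ, true_and] at hx
      have := hd x hx.2 hx.1.1
      omega
  · intro x
    simp only [Finset.mem_filter, Finset.mem_univ, true_and]
    rintro ⟨h4, h5⟩
    by_cases hxd : x = d
    · rw [hxd]
      omega
    · by_cases hxd' : x = d.symm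
      · rw [hxd', SimpleGraph.Dart.symm_symm]
        omega
      · have hne : T.contourIndex ξ d ≠ T.contourIndex ξ x := fun h => hxd (T.contourIndex_inj h.symm)
        have := (T.interval_symm_iff h3 hxd hxd').1 ⟨by omega, by omega⟩
        omega

end Finite

end PlaneTree

namespace PlaneTree

variable {V : Type*} (T : PlaneTree V)

/-! ### Successors -/

theorem mem_successorSteps_iff [Finite V] {ξ c : T.graph.Dart} (i : ℕ) :
    i ∈ T.successorSteps c ↔ i < T.numCorners ∧
      T.height ξ (T.contourIndex ξ c + i + 1) < T.height ξ (T.contourIndex ξ c) := by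
  rw [← blossomCount_lt_iff, contour_contourIndex]
  rfl

section Balanced

theorem last_stem_index [Finite V] (ξ : T.graph.Dart) :
    T.contourIndex ξ (T.next.symm ξ).symm + 1 = T.numCorners := by
  have h : T.toMap.faceNext (T.next.symm ξ).symm = ξ := by
    rw [← next_eq_faceNext_symm, Equiv.apply_symm_apply]
  rcases (Nat.succ_le_of_lt (T.contourIndex_lt ξ (T.next.symm ξ).symm)).lt_or_eq with h1 | h1
  · have := T.contourIndex_faceNext h1
    rw [h, contourIndex_self] at this
    omega
  · exact h1

/-- The last corner is at the blossom of the stem that precedes `ξ`, so the final increment is 2,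
which is also the total. -/
theorem height_last [Finite V] (hT : T.IsBlossoming) {ξ : T.graph.Dart} (hξ : T.IsBalanced ξ) {i : ℕ}
    (hi : i + 1 = T.numCorners) : T.height ξ i = 0 := by
  have h := T.last_stem_index ξ
  have h1 : i = T.contourIndex ξ (T.next.symm ξ).symm := by omega
  have h2 : T.IsBlossom (T.contour ξ i).fst := by
    rw [h1, contour_contourIndex]
    exact hξ.2.1.2
  have h3 := T.height_succ_blossom h2
  rw [hi, T.height_numCorners hT hξ.1.1] at h3
  omega

theorem height_add_numCorners [Finite V] (hT : T.IsBlossoming) {ξ : T.graph.Dart}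
    (hξ : T.IsBalanced ξ) (j : ℕ) : T.height ξ (T.numCorners + j) = T.height ξ j + 2 := by
  rw [height_add, T.height_numCorners hT hξ.1.1, contour_numCorners]
  ring

/-- In a balanced tree, the successor of a closed blossom corner comes later in the contour
exploration from the root corner. -/
theorem successor_spec [Finite V] (hT : T.IsBlossoming) {ξ : T.graph.Dart} (hξ : T.IsBalanced ξ)
    {c : T.graph.Dart} (hb : T.IsBlossom c.fst) (hc : T.IsClosed c) :
    T.contourIndex ξ c < T.contourIndex ξ (T.successor c) ∧
      T.height ξ (T.contourIndex ξ (T.successor c) + 1) < T.height ξ (T.contourIndex ξ c) ∧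
      ∀ t, T.contourIndex ξ c ≤ t → t < T.contourIndex ξ (T.successor c) →
        T.height ξ (T.contourIndex ξ c) ≤ T.height ξ (t + 1) := by
  set p := T.contourIndex ξ c with hp
  have hpN : p < T.numCorners := T.contourIndex_lt ξ c
  set k := sInf (T.successorSteps c) with hk
  obtain ⟨hkN, hlt⟩ := (T.mem_successorSteps_iff (ξ := ξ) k).1 (Nat.sInf_mem hc)
  rw [← hp] at hlt
  have hmin : ∀ t, p ≤ t → t < p + k → T.height ξ p ≤ T.height ξ (t + 1) := by
    intro t h1 h2
    by_contra h3
    have : t - p ∈ T.successorSteps c := by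
      rw [T.mem_successorSteps_iff (ξ := ξ), ← hp]
      refine ⟨by omega, ?_⟩
      rw [show p + (t - p) + 1 = t + 1 by omega]
      omega
    have := Nat.sInf_le this
    omega
  have hpb : T.IsBlossom (T.contour ξ p).fst := by
    rw [hp, contour_contourIndex]
    exact hb
  have hp1 := T.height_succ_blossom hpb
  have hk0 : k ≠ 0 := by
    intro h0
    rw [h0, add_zero, hp1] at hlt
    omega
  -- If the arc wrapped around, it would pass the last corner, so its starting level would be at
  -- most 0. But after one full turn heights are raised by 2 and hence at least 1.
  have hsN : p + k < T.numCorners := by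
    by_contra hcon
    have hw : T.height ξ p ≤ 0 := by
      rcases (Nat.succ_le_of_lt hpN).lt_or_eq with h | h
      · have h1 := hmin (T.numCorners - 2) (by omega) (by omega)
        rwa [T.height_last hT hξ (i := T.numCorners - 2 + 1) (by omega)] at h1
      · exact (T.height_last hT hξ h).le
    have h1 := T.height_add_numCorners hT hξ (p + k - T.numCorners + 1)
    rw [show T.numCorners + (p + k - T.numCorners + 1) = p + k + 1 by omega] at h1
    have h2 := T.height_of_isBalanced hξ (i := p + k - T.numCorners) (by omega)
    omega
  have hs : T.contourIndex ξ (T.successor c) = p + k := by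
    have : T.successor c = T.contour ξ (p + k) := by
      rw [← contour_contour, hp, contour_contourIndex]
      rfl
    rw [this, T.contourIndex_contour ξ hsN]
  rw [hs]
  exact ⟨by omega, hlt, hmin⟩

theorem height_le_of_not_isClosed [Finite V] {ξ : T.graph.Dart} {c : T.graph.Dart}
    (hc : ¬ T.IsClosed c) {t : ℕ} (h1 : T.contourIndex ξ c ≤ t) (h2 : t < T.numCorners) :
    T.height ξ (T.contourIndex ξ c) ≤ T.height ξ (t + 1) := by
  by_contra h
  refine hc ⟨t - T.contourIndex ξ c, (T.mem_successorSteps_iff (ξ := ξ) _).2 ⟨by omega, ?_⟩⟩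
  rw [show T.contourIndex ξ c + (t - T.contourIndex ξ c) + 1 = t + 1 by omega]
  omega

variable [Finite V] (hT : T.IsBlossoming) {ξ : T.graph.Dart} (hξ : T.IsBalanced ξ)
  {c c' : T.graph.Dart}

include hT hξ

/-- The walk goes down by unit steps, so it leaves the level of `c` from exactly that level. -/
theorem height_successor (hb : T.IsBlossom c.fst) (hc : T.IsClosed c) :
    T.height ξ (T.contourIndex ξ (T.successor c)) = T.height ξ (T.contourIndex ξ c) := by
  obtain ⟨h1, h2, h3⟩ := T.successor_spec hT hξ hb hc
  have h4 : ¬ T.IsBlossom (T.contour ξ (T.contourIndex ξ (T.successor c))).fst := by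
    rw [contour_contourIndex]
    exact T.successor_inner c hc
  have h5 := T.height_succ_inner h4
  have h6 := h3 (T.contourIndex ξ (T.successor c) - 1) (by omega) (by omega)
  rw [Nat.sub_add_cancel (by omega)] at h6
  omega

/-- The level at `c'` is at least the level at `c`, and the walk falls below the latter right after
the successor of `c`. -/
theorem isClosed_of_lt_successor (hb : T.IsBlossom c.fst) (hc : T.IsClosed c)
    (h1 : T.contourIndex ξ c < T.contourIndex ξ c')
    (h2 : T.contourIndex ξ c' ≤ T.contourIndex ξ (T.successor c)) : T.IsClosed c' := by
  by_contra hc'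
  obtain ⟨h3, h4, h5⟩ := T.successor_spec hT hξ hb hc
  have h6 := T.height_le_of_not_isClosed (ξ := ξ) hc' h2 (T.contourIndex_lt ξ _)
  have h7 := h5 (T.contourIndex ξ c' - 1) (by omega) (by omega)
  rw [Nat.sub_add_cancel (by omega)] at h7
  omega

/-- The arcs from blossom corners to their successors do not cross. -/
theorem successor_le (hb : T.IsBlossom c.fst) (hc : T.IsClosed c) (hb' : T.IsBlossom c'.fst)
    (hc' : T.IsClosed c') (h1 : T.contourIndex ξ c < T.contourIndex ξ c')
    (h2 : T.contourIndex ξ c' ≤ T.contourIndex ξ (T.successor c)) :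
    T.contourIndex ξ (T.successor c') ≤ T.contourIndex ξ (T.successor c) := by
  by_contra hcon
  obtain ⟨h3, h4, h5⟩ := T.successor_spec hT hξ hb hc
  obtain ⟨h3', h4', h5'⟩ := T.successor_spec hT hξ hb' hc'
  have h6 := h5' _ h2 (by omega)
  have h7 := h5 (T.contourIndex ξ c' - 1) (by omega) (by omega)
  rw [Nat.sub_add_cancel (by omega)] at h7
  omega

/-- The lower bound is balance. The upper bound holds because the walk, which has level 0 at the
last corner, never falls below the level of an unclosed blossom. -/
theorem height_of_not_isClosed (hb : T.IsBlossom c.fst) (hc : ¬ T.IsClosed c) :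
    T.height ξ (T.contourIndex ξ c) = -1 ∨ T.height ξ (T.contourIndex ξ c) = 0 := by
  have hpN : T.contourIndex ξ c < T.numCorners := T.contourIndex_lt ξ c
  have h0 : T.contourIndex ξ c ≠ 0 := fun h => hξ.1.1 (by
    rw [← T.contourIndex_eq_zero h]
    exact hb)
  have h1 := T.height_of_isBalanced hξ (i := T.contourIndex ξ c - 1) (by omega)
  rw [Nat.sub_add_cancel (by omega)] at h1
  have h2 : T.height ξ (T.contourIndex ξ c) ≤ 0 := by
    rcases (Nat.succ_le_of_lt hpN).lt_or_eq with h | h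
    · have h1 := T.height_le_of_not_isClosed (ξ := ξ) hc (t := T.numCorners - 2) (by omega)
        (by omega)
      rwa [T.height_last hT hξ (i := T.numCorners - 2 + 1) (by omega)] at h1
    · exact (T.height_last hT hξ h).le
  omega

omit hT in
theorem cornerLabel_inner (hc : ¬ T.IsBlossom c.fst) :
    T.cornerLabel ξ c = T.height ξ (T.contourIndex ξ c) + 2 := by
  rw [cornerLabel, T.contourLabel_eq hξ.1.1, contour_contourIndex, if_neg hc]

omit hT in
theorem cornerLabel_blossom (hc : T.IsBlossom c.fst) :
    T.cornerLabel ξ c = T.height ξ (T.contourIndex ξ c) + 3 := by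
  rw [cornerLabel, T.contourLabel_eq hξ.1.1, contour_contourIndex, if_pos hc]

end Balanced

end PlaneTree

namespace PlaneTree

/-! ### The rotation of the closure -/

section CloseAll

variable {X : Type*} (a : X → X) (τ : Equiv.Perm X) (key : X → ℕ)

open Classical in
-- Elements with a common anchor are inserted in decreasing order of keys, each immediately before
-- the anchor. The one with the largest key is pushed farthest away and met first.
theorem closeAll_apply_of_notMem (L : List X) (hL : L.Pairwise (fun x y => key x < key y))
    (ha : ∀ b ∈ L, a b ∉ L) (x : X) (hx : τ x ∉ L) :
    (closeAll a τ L x = τ x ∧ ∀ b ∈ L, a b ≠ τ x) ∨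
      ∃ b ∈ L, a b = τ x ∧ closeAll a τ L x = b ∧ ∀ b' ∈ L, a b' = τ x → key b' ≤ key b := by
  induction L with
  | nil => exact Or.inl ⟨rfl, by simp⟩
  | cons b L ih =>
    rw [List.pairwise_cons] at hL
    simp only [List.mem_cons, not_or] at hx
    have hdef : closeAll a τ (b :: L) x = Equiv.swap b (a b) (closeAll a τ L x) := rfl
    rw [hdef]
    rcases ih hL.2 (fun b' hb' h => ha b' (by simp [hb']) (by simp [h])) hx.2 with
      ⟨h1, h2⟩ | ⟨b1, h1, h2, h3, h4⟩
    · rw [h1]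
      by_cases hab : a b = τ x
      · right
        refine ⟨b, by simp, hab, by rw [hab, Equiv.swap_apply_right], ?_⟩
        intro b' hb' hab'
        rcases List.mem_cons.1 hb' with rfl | hb'
        · exact le_rfl
        · exact absurd hab' (h2 b' hb')
      · left
        refine ⟨Equiv.swap_apply_of_ne_of_ne hx.1 (Ne.symm hab), ?_⟩
        intro b' hb'
        rcases List.mem_cons.1 hb' with rfl | hb'
        · exact hab
        · exact h2 b' hb'
    · right
      have hb1 : key b < key b1 := hL.1 b1 h1
      refine ⟨b1, by simp [h1], h2, ?_, ?_⟩
      · rw [h3]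
        refine Equiv.swap_apply_of_ne_of_ne ?_ ?_
        · rintro rfl
          exact lt_irrefl _ hb1
        · rintro rfl
          exact ha b (by simp) (by simp [h1])
      · intro b' hb' hab'
        rcases List.mem_cons.1 hb' with rfl | hb'
        · exact hb1.le
        · exact h4 b' hb' hab'

open Classical in
-- Within the stack in front of a common anchor, the keys decrease until the anchor is reached.
theorem closeAll_apply_of_mem (L : List X) (hL : L.Pairwise (fun x y => key x < key y))
    (ha : ∀ b ∈ L, a b ∉ L) (b : X) (hb : b ∈ L) (hτ : τ b = b) :
    (closeAll a τ L b = a b ∧ ∀ b' ∈ L, a b' = a b → key b ≤ key b') ∨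
      ∃ b' ∈ L, a b' = a b ∧ key b' < key b ∧ closeAll a τ L b = b' ∧
        ∀ b'' ∈ L, a b'' = a b → key b'' < key b → key b'' ≤ key b' := by
  induction L with
  | nil => simp at hb
  | cons b0 L ih =>
    rw [List.pairwise_cons] at hL
    have ha' : ∀ b ∈ L, a b ∉ L := fun b' hb' h => ha b' (by simp [hb']) (by simp [h])
    have hdef : closeAll a τ (b0 :: L) b = Equiv.swap b0 (a b0) (closeAll a τ L b) := rfl
    rw [hdef]
    by_cases hbL : b ∈ L
    · have hb0 : key b0 < key b := hL.1 b hbL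
      rcases ih hL.2 ha' hbL with ⟨h1, h2⟩ | ⟨b1, h1, h2, h3, h4, h5⟩
      · rw [h1]
        by_cases hab : a b0 = a b
        · right
          refine ⟨b0, by simp, hab, hb0, by rw [hab, Equiv.swap_apply_right], ?_⟩
          intro b'' hb'' hab'' hlt
          rcases List.mem_cons.1 hb'' with rfl | hb''
          · exact le_rfl
          · exact absurd (h2 b'' hb'' hab'') hlt.not_ge
        · left
          refine ⟨Equiv.swap_apply_of_ne_of_ne ?_ (Ne.symm hab), ?_⟩
          · intro h
            exact ha b hb (by simp [h])
          · intro b' hb' hab'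
            rcases List.mem_cons.1 hb' with rfl | hb'
            · exact absurd hab' hab
            · exact h2 b' hb' hab'
      · right
        have hb1 : key b0 < key b1 := hL.1 b1 h1
        refine ⟨b1, by simp [h1], h2, h3, ?_, ?_⟩
        · rw [h4]
          refine Equiv.swap_apply_of_ne_of_ne ?_ ?_
          · rintro rfl
            exact lt_irrefl _ hb1
          · rintro rfl
            exact ha b0 (by simp) (by simp [h1])
        · intro b'' hb'' hab'' hlt
          rcases List.mem_cons.1 hb'' with rfl | hb''
          · exact hb1.le
          · exact h5 b'' hb'' hab'' hlt
    -- The head has the smallest key and is inserted last, so it lands next to its anchor; the tail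
    -- leaves it fixed.
    · obtain rfl : b = b0 := (List.mem_cons.1 hb).resolve_right hbL
      left
      have hfix : closeAll a τ L b = b := by
        rcases closeAll_apply_of_notMem a τ key L hL.2 ha' b (by rwa [hτ]) with
          ⟨h, _⟩ | ⟨b1, h1, h2, _, _⟩
        · rw [h, hτ]
        · exact absurd (by simp [h2, hτ]) (ha b1 (by simp [h1]))
      rw [hfix, Equiv.swap_apply_left]
      refine ⟨rfl, ?_⟩
      intro b' hb' _
      rcases List.mem_cons.1 hb' with rfl | hb'
      · exact le_rfl
      · exact (hL.1 b' hb').le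

end CloseAll

variable {V : Type*} (T : PlaneTree V)

theorem anchor_eq_inl_iff (ξ b c : T.graph.Dart) :
    T.anchor ξ b = Sum.inl c ↔ T.IsClosed b ∧ T.successor b = c := by
  simp only [anchor]
  split_ifs with h1 h2 <;> simp [h1]

theorem cornerOrigin_inner {x : T.graph.Dart} (hx : ¬ T.IsBlossom x.fst) : T.cornerOrigin x = x :=
  if_neg hx

theorem cornerOrigin_blossom {x : T.graph.Dart} (hx : T.IsBlossom x.fst) :
    T.cornerOrigin x = T.successor x :=
  if_pos hx

/-- A dart that leaves an inner vertex of the closure. -/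
def IsAttached (x : T.graph.Dart) : Prop := T.IsBlossom x.fst → T.IsClosed x

variable [Finite V]

theorem pairwise_blossomCorners (ξ : T.graph.Dart) : (T.blossomCorners ξ).Pairwise
    (fun x y => T.contourIndex ξ x < T.contourIndex ξ y) := by
  apply List.Pairwise.filter
  rw [List.pairwise_map]
  refine List.Pairwise.imp_of_mem ?_ (List.pairwise_lt_range (n := T.numCorners))
  intro i j hi hj hij
  rwa [T.contourIndex_contour ξ (List.mem_range.1 hi), T.contourIndex_contour ξ (List.mem_range.1 hj)]

theorem map_blossomCorners_mem (ξ : T.graph.Dart) (x : T.ClosureDart) :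
    x ∈ (T.blossomCorners ξ).map Sum.inl ↔
      ∃ b : T.graph.Dart, T.IsBlossom b.fst ∧ x = Sum.inl b := by
  rw [List.mem_map]
  constructor
  · rintro ⟨b, hb, rfl⟩
    exact ⟨b, (T.mem_blossomCorners ξ b).1 hb, rfl⟩
  · rintro ⟨b, hb, rfl⟩
    exact ⟨b, (T.mem_blossomCorners ξ b).2 hb, rfl⟩

theorem closureAnchor_notMem (ξ : T.graph.Dart) (x : T.ClosureDart)
    (hx : x ∈ (T.blossomCorners ξ).map Sum.inl) :
    T.closureAnchor ξ x ∉ (T.blossomCorners ξ).map Sum.inl := by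
  obtain ⟨b, hb, rfl⟩ := (T.map_blossomCorners_mem ξ x).1 hx
  rw [map_blossomCorners_mem]
  rintro ⟨b', hb', h⟩
  obtain ⟨h1, rfl⟩ := (T.anchor_eq_inl_iff ξ b b').1 h
  exact T.successor_inner b h1 hb'

/-- The key 0 of the new darts is a placeholder, as the list contains none of them. -/
theorem pairwise_map_blossomCorners (ξ : T.graph.Dart) :
    ((T.blossomCorners ξ).map (Sum.inl : _ → T.ClosureDart)).Pairwise (fun x y =>
      Sum.elim (T.contourIndex ξ) (fun _ => 0) x < Sum.elim (T.contourIndex ξ) (fun _ => 0) y) := by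
  rw [List.pairwise_map]
  exact T.pairwise_blossomCorners ξ

/-- The dart that follows a dart of the tree at an inner vertex in the closure is the last blossom
attached in the next corner, if there is one. -/
theorem closureNext_inner (ξ : T.graph.Dart) {x : T.graph.Dart} (hx : ¬ T.IsBlossom x.fst) :
    (T.closureNext ξ (Sum.inl x) = Sum.inl (T.next x) ∧
      ∀ b : T.graph.Dart, T.IsBlossom b.fst → T.IsClosed b → T.successor b ≠ T.next x) ∨
    ∃ b : T.graph.Dart, T.IsBlossom b.fst ∧ T.IsClosed b ∧ T.successor b = T.next x ∧
      T.closureNext ξ (Sum.inl x) = Sum.inl b ∧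
      ∀ b' : T.graph.Dart, T.IsBlossom b'.fst → T.IsClosed b' → T.successor b' = T.next x →
        T.contourIndex ξ b' ≤ T.contourIndex ξ b := by
  have hτ : (Equiv.sumCongr T.next (1 : Equiv.Perm Bool)) (Sum.inl x) = Sum.inl (T.next x) := rfl
  rcases closeAll_apply_of_notMem (T.closureAnchor ξ) (Equiv.sumCongr T.next (1 : Equiv.Perm Bool))
    (Sum.elim (T.contourIndex ξ) (fun _ => 0)) _ (T.pairwise_map_blossomCorners ξ)
    (T.closureAnchor_notMem ξ) (Sum.inl x) (by
      rw [hτ, map_blossomCorners_mem]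
      rintro ⟨b, hb, h⟩
      rw [Sum.inl.injEq] at h
      rw [← h, next_fst] at hb
      exact hx hb) with ⟨h1, h2⟩ | ⟨b0, h1, h2, h3, h4⟩
  · refine Or.inl ⟨h1, fun b hb hc hs => h2 (Sum.inl b) ?_ ?_⟩
    · exact (T.map_blossomCorners_mem ξ _).2 ⟨b, hb, rfl⟩
    · exact (T.anchor_eq_inl_iff ξ b _).2 ⟨hc, hs⟩
  · right
    obtain ⟨b, hb, rfl⟩ := (T.map_blossomCorners_mem ξ _).1 h1
    obtain ⟨hc, hs⟩ := (T.anchor_eq_inl_iff ξ b _).1 h2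
    refine ⟨b, hb, hc, hs, h3, fun b' hb' hc' hs' => h4 (Sum.inl b') ?_ ?_⟩
    · exact (T.map_blossomCorners_mem ξ _).2 ⟨b', hb', rfl⟩
    · exact (T.anchor_eq_inl_iff ξ b' _).2 ⟨hc', hs'⟩

/-- The dart that follows a closed blossom in the closure is the previous blossom attached in the
same corner, if there is one. -/
theorem closureNext_blossom (ξ : T.graph.Dart) {b : T.graph.Dart} (hb : T.IsBlossom b.fst)
    (hc : T.IsClosed b) :
    (T.closureNext ξ (Sum.inl b) = Sum.inl (T.successor b) ∧
      ∀ b' : T.graph.Dart, T.IsBlossom b'.fst → T.IsClosed b' → T.successor b' = T.successor b →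
        T.contourIndex ξ b ≤ T.contourIndex ξ b') ∨
    ∃ b' : T.graph.Dart, T.IsBlossom b'.fst ∧ T.IsClosed b' ∧ T.successor b' = T.successor b ∧
      T.contourIndex ξ b' < T.contourIndex ξ b ∧ T.closureNext ξ (Sum.inl b) = Sum.inl b' ∧
      ∀ b'' : T.graph.Dart, T.IsBlossom b''.fst → T.IsClosed b'' →
        T.successor b'' = T.successor b → T.contourIndex ξ b'' < T.contourIndex ξ b →
          T.contourIndex ξ b'' ≤ T.contourIndex ξ b' := by
  have hanc : T.closureAnchor ξ (Sum.inl b) = Sum.inl (T.successor b) :=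
    (T.anchor_eq_inl_iff ξ b _).2 ⟨hc, rfl⟩
  rcases closeAll_apply_of_mem (T.closureAnchor ξ) (Equiv.sumCongr T.next (1 : Equiv.Perm Bool))
    (Sum.elim (T.contourIndex ξ) (fun _ => 0)) _ (T.pairwise_map_blossomCorners ξ)
    (T.closureAnchor_notMem ξ) (Sum.inl b) ((T.map_blossomCorners_mem ξ _).2 ⟨b, hb, rfl⟩)
    (congrArg Sum.inl (T.next_eq_self_of_isBlossom b hb)) with
    ⟨h1, h2⟩ | ⟨b0, h1, h2, h3, h4, h5⟩
  · rw [hanc] at h1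
    refine Or.inl ⟨h1, fun b' hb' hc' hs' => h2 (Sum.inl b') ?_ ?_⟩
    · exact (T.map_blossomCorners_mem ξ _).2 ⟨b', hb', rfl⟩
    · rw [hanc]
      exact (T.anchor_eq_inl_iff ξ b' _).2 ⟨hc', hs'⟩
  · right
    obtain ⟨b', hb', rfl⟩ := (T.map_blossomCorners_mem ξ _).1 h1
    rw [hanc] at h2 h5
    obtain ⟨hc', hs'⟩ := (T.anchor_eq_inl_iff ξ b' _).1 h2
    refine ⟨b', hb', hc', hs', h3, h4, fun b'' hb'' hc'' hs'' => h5 (Sum.inl b'') ?_ ?_⟩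
    · exact (T.map_blossomCorners_mem ξ _).2 ⟨b'', hb'', rfl⟩
    · exact (T.anchor_eq_inl_iff ξ b'' _).2 ⟨hc'', hs''⟩

/-- For labels it does not matter which dart comes next, only from which tree corner the new corner
arises. -/
theorem exists_closureNext_inner (ξ : T.graph.Dart) {x : T.graph.Dart} (hx : ¬ T.IsBlossom x.fst) :
    ∃ e : T.graph.Dart, T.closureNext ξ (Sum.inl x) = Sum.inl e ∧ T.IsAttached e ∧
      T.cornerOrigin e = T.next x := by
  rcases T.closureNext_inner ξ hx with ⟨h, _⟩ | ⟨b, hb, hc, hs, h, _⟩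
  · have h1 : ¬ T.IsBlossom (T.next x).fst := by rwa [next_fst]
    exact ⟨_, h, fun h2 => absurd h2 h1, T.cornerOrigin_inner h1⟩
  · exact ⟨b, h, fun _ => hc, (T.cornerOrigin_blossom hb).trans hs⟩

theorem exists_closureNext_blossom (ξ : T.graph.Dart) {b : T.graph.Dart} (hb : T.IsBlossom b.fst)
    (hc : T.IsClosed b) :
    ∃ e : T.graph.Dart, T.closureNext ξ (Sum.inl b) = Sum.inl e ∧ T.IsAttached e ∧
      T.cornerOrigin e = T.successor b := by
  rcases T.closureNext_blossom ξ hb hc with ⟨h, _⟩ | ⟨b', hb', hc', hs, _, h, _⟩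
  · have h1 := T.successor_inner b hc
    exact ⟨_, h, fun h2 => absurd h2 h1, T.cornerOrigin_inner h1⟩
  · exact ⟨b', h, fun _ => hc', (T.cornerOrigin_blossom hb').trans hs⟩

/-- Rotating from a closed blossom one reaches the corner in which it is attached. -/
theorem rotate_to_successor (ξ : T.graph.Dart) (S : T.ClosureDart → Prop) {c : T.graph.Dart}
    (hS : ∀ b : T.graph.Dart, T.IsBlossom b.fst → T.IsClosed b → T.successor b = c →
      S (Sum.inl b) → S (T.closureNext ξ (Sum.inl b)))
    {b : T.graph.Dart} (hb : T.IsBlossom b.fst) (hc : T.IsClosed b) (hs : T.successor b = c)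
    (h : S (Sum.inl b)) : S (Sum.inl c) := by
  induction hn : T.contourIndex ξ b using Nat.strong_induction_on generalizing b with
  | _ n ih =>
    subst hn
    have h1 := hS b hb hc hs h
    rcases T.closureNext_blossom ξ hb hc with ⟨h2, _⟩ | ⟨b', hb', hc', hs', hlt, h2, _⟩
    · rwa [h2, hs] at h1
    · rw [h2] at h1
      exact ih _ hlt hb' hc' (hs'.trans hs) h1 rfl

/-- Rotating in the closure one reaches the next dart of the tree. -/
theorem rotate_to_next (ξ : T.graph.Dart) (S : T.ClosureDart → Prop) {x : T.graph.Dart}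
    (hx : ¬ T.IsBlossom x.fst)
    (hS : ∀ b : T.graph.Dart, T.IsBlossom b.fst → T.IsClosed b → T.successor b = T.next x →
      S (Sum.inl b) → S (T.closureNext ξ (Sum.inl b)))
    (h : S (T.closureNext ξ (Sum.inl x))) : S (Sum.inl (T.next x)) := by
  rcases T.closureNext_inner ξ hx with ⟨h1, _⟩ | ⟨b, hb, hc, hs, h1, _⟩
  · rwa [h1] at h
  · rw [h1] at h
    exact T.rotate_to_successor ξ S hS hb hc hs h

end PlaneTree

namespace RotationMap

variable {V D : Type*} (M : RotationMap V D)

/-! ### Leftmost paths -/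

theorem origin_next (d : D) : M.origin (M.next d) = M.origin d :=
  ((M.sameCycle_next d (M.next d)).1 ⟨1, by simp⟩).symm

theorem origin_next_pow (k : ℕ) (d : D) : M.origin ((M.next ^ k) d) = M.origin d :=
  ((M.sameCycle_next d _).1 ⟨k, by simp⟩).symm

theorem target_rev (d : D) : M.target (M.rev d) = M.origin d := by
  rw [target, M.rev_rev]

variable {M}

theorem IsFirstOutgoingAfter.origin_eq {O : Set D} {d d' : D} (h : M.IsFirstOutgoingAfter O d d') :
    M.origin d' = M.target d := by
  obtain ⟨k, _, rfl, _⟩ := h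
  rw [origin_next_pow]
  rfl

theorem IsFirstOutgoingAfter.unique {O : Set D} {d d₁ d₂ : D}
    (h₁ : M.IsFirstOutgoingAfter O d d₁) (h₂ : M.IsFirstOutgoingAfter O d d₂) : d₁ = d₂ := by
  obtain ⟨k₁, hk₁, rfl, ho₁, hm₁⟩ := h₁
  obtain ⟨k₂, hk₂, rfl, ho₂, hm₂⟩ := h₂
  rcases lt_trichotomy k₁ k₂ with h | rfl | h
  · exact absurd ho₁ (hm₂ _ hk₁ h)
  · rfl
  · exact absurd ho₂ (hm₁ _ hk₂ h)

/-- The rotation at the endpoint of `d` is a single cycle, so it meets `d'`. The first hit is not at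
step 0, because the reverse of `d` is not outgoing. -/
theorem exists_isFirstOutgoingAfter [Finite D] {O : Set D} (hO : M.IsOrientation O) {d d' : D}
    (hd : d ∈ O) (hd' : d' ∈ O) (h : M.origin d' = M.target d) :
    ∃ k, 0 < k ∧ (M.next ^ k) (M.rev d) ∈ O ∧ ∀ j, 0 < j → j < k → (M.next ^ j) (M.rev d) ∉ O := by
  classical
  have hex : ∃ k, (M.next ^ k) (M.rev d) ∈ O := by
    obtain ⟨k, hk⟩ := ((M.sameCycle_next (M.rev d) d').2 h.symm).exists_nat_pow_eq
    exact ⟨k, hk ▸ hd'⟩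
  refine ⟨Nat.find hex, ?_, Nat.find_spec hex, fun j _ hj => Nat.find_min hex hj⟩
  rw [Nat.find_pos]
  exact (hO d).1 hd

/-- Each dart determines the following one, and neither path can continue beyond `a`, which has no
outgoing darts. -/
theorem IsLeftmostPath.unique {O : Set D} {a : V} (ha : ∀ d ∈ O, M.origin d ≠ a) {P Q : List D} :
    ∀ {e : D}, M.IsLeftmostPath O e a P → M.IsLeftmostPath O e a Q → Q = P := by
  induction P generalizing Q with
  | nil =>
    rintro e ⟨h, _⟩
    simp at h
  | cons d P ih =>
    rintro e ⟨hP1, hP2, hP3, hP4⟩ ⟨hQ1, hQ2, hQ3, hQ4⟩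
    obtain rfl : d = e := by simpa using hP1
    rcases Q with _ | ⟨q, Q⟩
    · simp at hQ1
    obtain rfl : q = d := by simpa using hQ1
    congr 1
    rcases P with _ | ⟨d', P⟩ <;> rcases Q with _ | ⟨q', Q⟩
    · rfl
    · exfalso
      have h1 : M.target q = a := by simpa using hP4
      exact ha q' (hQ2 q' (by simp)) ((List.isChain_cons_cons.1 hQ3).1.origin_eq.trans h1)
    · exfalso
      have h1 : M.target q = a := by simpa using hQ4
      exact ha d' (hP2 d' (by simp)) ((List.isChain_cons_cons.1 hP3).1.origin_eq.trans h1)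
    · obtain ⟨h1, h2⟩ := List.isChain_cons_cons.1 hP3
      obtain ⟨h3, h4⟩ := List.isChain_cons_cons.1 hQ3
      obtain rfl := h1.unique h3
      exact ih (e := d') ⟨rfl, fun x hx => hP2 x (by simp [List.mem_cons.1 hx]), h2, by simpa using hP4⟩
        ⟨rfl, fun x hx => hQ2 x (by simp [List.mem_cons.1 hx]), h4, by simpa using hQ4⟩

/-- The bound is an inequality because a dart could be a loop, which `toGraph` omits. -/
theorem exists_walk_of_dart (d : D) :
    ∃ p : M.toGraph.Walk (M.origin d) (M.target d), p.length ≤ 1 := by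
  by_cases h : M.origin d = M.target d
  · rw [← h]
    exact ⟨.nil, by simp⟩
  · exact ⟨(show M.toGraph.Adj _ _ from ⟨h, d, rfl, rfl⟩).toWalk, by simp⟩

theorem IsLeftmostPath.exists_walk {O : Set D} {a : V} {P : List D} :
    ∀ {e : D}, M.IsLeftmostPath O e a P →
      ∃ p : M.toGraph.Walk (M.origin e) a, p.length ≤ P.length := by
  induction P with
  | nil =>
    rintro e ⟨h, _⟩
    simp at h
  | cons d P ih =>
    rintro e ⟨hP1, hP2, hP3, hP4⟩
    obtain rfl : d = e := by simpa using hP1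
    obtain ⟨p, hp⟩ := M.exists_walk_of_dart d
    rcases P with _ | ⟨d', P⟩
    · obtain rfl : M.target d = a := by simpa using hP4
      exact ⟨p, hp⟩
    · obtain ⟨h1, h2⟩ := List.isChain_cons_cons.1 hP3
      obtain ⟨q, hq⟩ := ih (e := d')
        ⟨rfl, fun x hx => hP2 x (by simp [List.mem_cons.1 hx]), h2, by simpa using hP4⟩
      refine ⟨p.append (q.copy h1.origin_eq rfl), ?_⟩
      simp only [SimpleGraph.Walk.length_append, SimpleGraph.Walk.length_copy, List.length_cons]
        at hq ⊢
      omega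

theorem IsLeftmostPath.cons {O : Set D} {a : V} {P : List D} {e e' : D} (he : e ∈ O)
    (h : M.IsFirstOutgoingAfter O e e') (hP : M.IsLeftmostPath O e' a P) :
    M.IsLeftmostPath O e a (e :: P) := by
  obtain ⟨hP1, hP2, hP3, hP4⟩ := hP
  rcases P with _ | ⟨d, P⟩
  · simp at hP1
  · obtain rfl : d = e' := by simpa using hP1
    refine ⟨rfl, ?_, List.isChain_cons_cons.2 ⟨h, hP3⟩, by simpa using hP4⟩
    intro x hx
    rcases List.mem_cons.1 hx with rfl | hx
    · exact he
    · exact hP2 x hx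

theorem isLeftmostPath_singleton {O : Set D} {e : D} (he : e ∈ O) :
    M.IsLeftmostPath O e (M.target e) [e] :=
  ⟨rfl, by simpa using he, List.isChain_singleton _, rfl⟩

theorem length_pathVertices {P : List D} (hP : P ≠ []) :
    (M.pathVertices P).length = P.length + 1 := by
  rcases P with _ | ⟨d, P⟩
  · exact absurd rfl hP
  · simp [pathVertices]

end RotationMap

namespace PlaneTree

variable {V : Type*} (T : PlaneTree V)

/-! ### The canonical orientation of the closure -/

/-- The orientation of the closure in which the edges between inner vertices lead towards the root,
the stems lead away from their inner vertex, and the new edge leads from `B` to `A`. -/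
def canonicalOrientation (ξ : T.graph.Dart) : Set T.ClosureDart :=
  {x | Sum.elim (fun d => T.IsStemDart d ∨ T.IsParentDart ξ d) (fun b => b = false) x}

theorem inl_mem_canonicalOrientation (ξ d : T.graph.Dart) :
    Sum.inl d ∈ T.canonicalOrientation ξ ↔ T.IsStemDart d ∨ T.IsParentDart ξ d :=
  Iff.rfl

theorem inr_mem_canonicalOrientation (ξ : T.graph.Dart) (b : Bool) :
    Sum.inr b ∈ T.canonicalOrientation ξ ↔ b = false :=
  Iff.rfl

theorem not_isBlossom_of_mem {ξ d : T.graph.Dart} (h : Sum.inl d ∈ T.canonicalOrientation ξ) :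
    ¬ T.IsBlossom d.fst := by
  rcases h with h | h <;> exact h.1

/-- An inner vertex, given as a vertex that is not a blossom. -/
def toInner (v : V) (h : ¬ T.IsBlossom v) : T.Inner := ⟨v, h⟩

theorem inner_toInner_eq_iff {v : V} (h : ¬ T.IsBlossom v) (u : T.Inner) :
    ClosureVertex.inner (T.toInner v h) = ClosureVertex.inner u ↔ v = u.1 := by
  rw [ClosureVertex.inner.injEq]
  exact Subtype.ext_iff

variable {T} in
theorem IsBalanced.not_isBlossom {ξ : T.graph.Dart} (hξ : T.IsBalanced ξ) :
    ¬ T.IsBlossom ξ.fst :=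
  hξ.1.1

theorem closureOrigin_inner (ξ : T.graph.Dart) {d : T.graph.Dart} (hd : ¬ T.IsBlossom d.fst) :
    T.closureOrigin ξ (Sum.inl d) = .inner (T.toInner d.fst hd) :=
  dif_neg hd

theorem closureOrigin_closed (ξ : T.graph.Dart) {d : T.graph.Dart} (hd : T.IsBlossom d.fst)
    (hc : T.IsClosed d) :
    T.closureOrigin ξ (Sum.inl d) = .inner (T.toInner _ (T.successor_inner d hc)) := by
  rw [closureOrigin, dif_pos hd, dif_pos hc]
  rfl

open Classical in
theorem closureOrigin_open (ξ : T.graph.Dart) {d : T.graph.Dart} (hd : T.IsBlossom d.fst)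
    (hc : ¬ T.IsClosed d) :
    T.closureOrigin ξ (Sum.inl d) = if T.cornerLabel ξ d = 2 then .A else .B := by
  rw [closureOrigin, dif_pos hd, dif_neg hc]

theorem closureOrigin_attached (ξ : T.graph.Dart) {d : T.graph.Dart} (hd : T.IsAttached d) :
    T.closureOrigin ξ (Sum.inl d) = T.closureOrigin ξ (Sum.inl (T.cornerOrigin d)) := by
  by_cases h : T.IsBlossom d.fst
  · rw [T.closureOrigin_closed ξ h (hd h), T.cornerOrigin_blossom h,
      T.closureOrigin_inner ξ (T.successor_inner d (hd h))]
    rfl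
  · rw [T.cornerOrigin_inner h]

theorem not_isBlossom_cornerOrigin {d : T.graph.Dart} (hd : T.IsAttached d) :
    ¬ T.IsBlossom (T.cornerOrigin d).fst := by
  by_cases h : T.IsBlossom d.fst
  · rw [T.cornerOrigin_blossom h]
    exact T.successor_inner d (hd h)
  · rwa [T.cornerOrigin_inner h]

theorem closureOrigin_eq_inner_iff (ξ d : T.graph.Dart) (u : T.Inner) :
    T.closureOrigin ξ (Sum.inl d) = .inner u ↔
      T.IsAttached d ∧ (T.cornerOrigin d).fst = u.1 := by
  classical
  by_cases h : T.IsAttached d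
  · rw [T.closureOrigin_attached ξ h,
      T.closureOrigin_inner ξ (T.not_isBlossom_cornerOrigin h), inner_toInner_eq_iff]
    exact ⟨fun h' => ⟨h, h'⟩, fun h' => h'.2⟩
  · simp only [IsAttached, Classical.not_imp] at h
    rw [T.closureOrigin_open ξ h.1 h.2]
    constructor
    · split_ifs <;> simp
    · intro h'
      exact absurd (h'.1 h.1) h.2

theorem exists_dart_fst (ξ : T.graph.Dart) (u : V) : ∃ d : T.graph.Dart, d.fst = u := by
  by_cases hu : u = ξ.fst
  · exact ⟨ξ, hu.symm⟩
  · obtain ⟨p⟩ := T.isTree.connected.preconnected u ξ.fst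
    rcases p with _ | ⟨h, _⟩
    · exact absurd rfl hu
    · exact ⟨⟨(u, _), h⟩, rfl⟩

section Finite

variable [Finite V] {ξ : T.graph.Dart}

theorem closure_origin_apply (x : T.ClosureDart) :
    (T.closure ξ).origin x = T.closureOrigin ξ x := rfl

theorem closure_rev_inl (d : T.graph.Dart) : (T.closure ξ).rev (Sum.inl d) = Sum.inl d.symm := rfl

theorem closure_rev_inr (b : Bool) : (T.closure ξ).rev (Sum.inr b) = Sum.inr !b := rfl

theorem closure_target_inl (d : T.graph.Dart) :
    (T.closure ξ).target (Sum.inl d) = T.closureOrigin ξ (Sum.inl d.symm) := rfl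

theorem closure_next_apply (x : T.ClosureDart) :
    (T.closure ξ).next x = T.closureNext ξ x := rfl

theorem canonicalOrientation_inl_symm (hξ : ¬ T.IsBlossom ξ.fst) (d : T.graph.Dart) :
    Sum.inl d ∈ T.canonicalOrientation ξ ↔ Sum.inl d.symm ∉ T.canonicalOrientation ξ := by
  have h1 := T.not_isBlossom_snd hξ (d := d)
  have h2 := T.contourIndex_symm_ne ξ d
  have h3 : T.IsStemDart d.symm ↔ ¬ T.IsBlossom d.snd ∧ T.IsBlossom d.fst := Iff.rfl
  have h4 : T.IsParentDart ξ d.symm ↔ ¬ T.IsBlossom d.snd ∧ ¬ T.IsBlossom d.fst ∧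
      T.contourIndex ξ d < T.contourIndex ξ d.symm := by
    rw [IsParentDart, SimpleGraph.Dart.symm_symm]
    exact Iff.rfl
  rw [inl_mem_canonicalOrientation, inl_mem_canonicalOrientation, h3, h4, IsStemDart, IsParentDart]
  by_cases ha : T.IsBlossom d.fst <;> by_cases hb : T.IsBlossom d.snd
  · exact absurd hb (h1 ha)
  · tauto
  · tauto
  · rcases lt_or_gt_of_ne h2 with h | h
    · have := h.not_gt
      tauto
    · have := h.not_gt
      tauto

theorem isOrientation_canonicalOrientation (hξ : ¬ T.IsBlossom ξ.fst) :
    (T.closure ξ).IsOrientation (T.canonicalOrientation ξ) := by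
  rintro (d | b)
  · exact T.canonicalOrientation_inl_symm hξ d
  · rw [closure_rev_inr, inr_mem_canonicalOrientation, inr_mem_canonicalOrientation]
    cases b <;> simp

theorem origin_ne_A_of_mem {x : T.ClosureDart} (hx : x ∈ T.canonicalOrientation ξ) :
    (T.closure ξ).origin x ≠ .A := by
  rcases x with d | b
  · rw [closure_origin_apply, T.closureOrigin_inner ξ (T.not_isBlossom_of_mem hx)]
    simp
  · rw [inr_mem_canonicalOrientation] at hx
    subst hx
    simp [closure_origin_apply, closureOrigin]

theorem outdegree_A : (T.closure ξ).outdegree (T.canonicalOrientation ξ) .A = 0 := by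
  have : {x | x ∈ T.canonicalOrientation ξ ∧ (T.closure ξ).origin x = .A} = ∅ := by
    rw [Set.eq_empty_iff_forall_notMem]
    rintro x ⟨h1, h2⟩
    exact T.origin_ne_A_of_mem h1 h2
  rw [RotationMap.outdegree, this, Set.ncard_empty]

theorem outdegree_B : (T.closure ξ).outdegree (T.canonicalOrientation ξ) .B = 1 := by
  have : {x | x ∈ T.canonicalOrientation ξ ∧ (T.closure ξ).origin x = .B} = {T.dartBA} := by
    ext x
    rcases x with d | b
    · simp only [Set.mem_ofPred_eq, Set.mem_singleton_iff, reduceCtorEq, iff_false, not_and]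
      intro h
      rw [closure_origin_apply, T.closureOrigin_inner ξ (T.not_isBlossom_of_mem h)]
      simp
    · simp only [Set.mem_ofPred_eq, Set.mem_singleton_iff, inr_mem_canonicalOrientation,
        Sum.inr.injEq, and_iff_left_iff_imp]
      rintro rfl
      rfl
  rw [RotationMap.outdegree, this, Set.ncard_singleton]

open Classical in
-- The outgoing darts are the two stems of `u` itself and, away from the root vertex, the parent
-- dart; stems attached by the closure are incoming.
theorem outdegree_inner (hT : T.IsBlossoming) (hξ : ¬ T.IsBlossom ξ.fst) (u : T.Inner) :
    (T.closure ξ).outdegree (T.canonicalOrientation ξ) (.inner u) =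
      if u.1 = ξ.fst then 2 else 3 := by
  have hfin := T.finite_dart
  have hset : {x | x ∈ T.canonicalOrientation ξ ∧ (T.closure ξ).origin x = .inner u} =
      Sum.inl '' ({d : T.graph.Dart | d.fst = u.1 ∧ T.IsBlossom d.snd} ∪
        {d : T.graph.Dart | d.fst = u.1 ∧ T.IsParentDart ξ d}) := by
    ext x
    rcases x with d | b
    · simp only [Set.mem_ofPred_eq, Set.mem_image, Sum.inl.injEq, exists_eq_right, Set.mem_union]
      constructor
      · rintro ⟨h1, h2⟩
        rw [closure_origin_apply, T.closureOrigin_inner ξ (T.not_isBlossom_of_mem h1),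
          inner_toInner_eq_iff] at h2
        have h3 : d.fst = u.1 := h2
        rcases h1 with h1 | h1
        · exact Or.inl ⟨h3, h1.2⟩
        · exact Or.inr ⟨h3, h1⟩
      · intro h
        have h3 : d.fst = u.1 := by rcases h with h | h <;> exact h.1
        have h4 : ¬ T.IsBlossom d.fst := h3 ▸ u.2
        refine ⟨?_, ?_⟩
        · rcases h with h | h
          · exact Or.inl ⟨h4, h.2⟩
          · exact Or.inr h.2
        · rwa [closure_origin_apply, T.closureOrigin_inner ξ h4, inner_toInner_eq_iff]
    · simp only [Set.mem_ofPred_eq, Set.mem_image, reduceCtorEq, and_false, exists_false, iff_false,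
        not_and]
      intro _
      rw [closure_origin_apply]
      cases b <;> simp [closureOrigin]
  have hdisj : Disjoint {d : T.graph.Dart | d.fst = u.1 ∧ T.IsBlossom d.snd}
      {d : T.graph.Dart | d.fst = u.1 ∧ T.IsParentDart ξ d} := by
    rw [Set.disjoint_left]
    rintro d ⟨_, h1⟩ ⟨_, h2⟩
    exact h2.2.1 h1
  have hd := T.exists_dart_fst ξ u.1
  rw [RotationMap.outdegree, hset, Set.ncard_image_of_injective _ Sum.inl_injective,
    Set.ncard_union_eq hdisj (Set.toFinite _) (Set.toFinite _), T.ncard_stems hT u.2 hd]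
  split_ifs with h
  · rw [h, T.ncard_parents_root]
  · rw [T.ncard_parents hξ u.2 hd h]

section Balanced

variable (hT : T.IsBlossoming) (hξ : T.IsBalanced ξ)

include hT hξ

/-- The first blossom is at height -1, the lowest level that balance allows, so it has no successor
and its label is 2. -/
theorem target_root : (T.closure ξ).target (Sum.inl ξ) = .A := by
  have hidx : T.contourIndex ξ ξ.symm = 1 := by
    rw [T.contourIndex_stem hξ.1.1 hξ.1.2, contourIndex_self]
  have hh : T.height ξ 1 = -1 := by
    rw [T.height_succ_inner (by rw [contour_zero]; exact hξ.1.1), height_zero]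
    rfl
  have hb : T.IsBlossom ξ.symm.fst := hξ.1.2
  have hc : ¬ T.IsClosed ξ.symm := by
    intro hc
    obtain ⟨_, h, _⟩ := T.successor_spec hT hξ hb hc
    have := T.height_of_isBalanced hξ (T.contourIndex_lt ξ (T.successor ξ.symm))
    rw [hidx, hh] at h
    omega
  rw [closure_target_inl, T.closureOrigin_open ξ hb hc, if_pos]
  rw [T.cornerLabel_blossom hξ hb, hidx, hh]
  rfl

theorem successor_ne_root {b : T.graph.Dart} (hb : T.IsBlossom b.fst) (hc : T.IsClosed b) :
    T.successor b ≠ ξ := by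
  intro h
  have := (T.successor_spec hT hξ hb hc).1
  rw [h, contourIndex_self] at this
  omega

theorem last_not_isClosed {b : T.graph.Dart} (hb : T.IsBlossom b.fst)
    (h : T.contourIndex ξ b + 1 = T.numCorners) : ¬ T.IsClosed b := by
  intro hc
  have h1 := (T.successor_spec hT hξ hb hc).1
  have h2 := T.contourIndex_lt ξ (T.successor b)
  omega

/-- Successors come strictly after their blossoms, so no stem is attached in the corner at position
0 and the two root stems stay consecutive. -/
theorem closure_next_symm_root :
    (T.closure ξ).next.symm (Sum.inl ξ) = Sum.inl (T.next.symm ξ) := by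
  rw [Equiv.symm_apply_eq, closure_next_apply]
  have h : T.next (T.next.symm ξ) = ξ := Equiv.apply_symm_apply _ _
  rcases T.closureNext_inner ξ (x := T.next.symm ξ) hξ.2.1.1 with ⟨h1, _⟩ | ⟨b, hb, hc, hs, _⟩
  · rw [h1, h]
  · rw [h] at hs
    exact absurd hs (T.successor_ne_root hT hξ hb hc)

theorem target_last : (T.closure ξ).target (Sum.inl (T.next.symm ξ)) = .B := by
  have hidx := T.last_stem_index ξ
  have hb : T.IsBlossom (T.next.symm ξ).symm.fst := hξ.2.1.2
  rw [closure_target_inl, T.closureOrigin_open ξ hb (T.last_not_isClosed hT hξ hb hidx), if_neg]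
  rw [T.cornerLabel_blossom hξ hb, T.height_last hT hξ hidx]
  norm_num

theorem rootA_eq : (T.closure ξ).rootA (T.rootCorner ξ) = .A := T.target_root hT hξ

theorem rootB_eq : (T.closure ξ).rootB (T.rootCorner ξ) = .B := by
  rw [RotationMap.rootB, rootCorner, T.closure_next_symm_root hT hξ, T.target_last hT hξ]

omit hT in
theorem origin_root :
    (T.closure ξ).origin (T.rootCorner ξ) = .inner (T.toInner ξ.fst hξ.not_isBlossom) :=
  T.closureOrigin_inner ξ hξ.1.1

theorem isThreeOrientation_canonicalOrientation :
    (T.closure ξ).IsThreeOrientation (T.rootCorner ξ) (T.canonicalOrientation ξ) := by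
  refine ⟨T.isOrientation_canonicalOrientation hξ.1.1, ?_, ?_, ?_, ?_⟩
  · rw [T.rootA_eq hT hξ, outdegree_A]
  · rw [T.rootB_eq hT hξ, outdegree_B]
  · rw [T.origin_root hξ, T.outdegree_inner hT hξ.not_isBlossom]
    exact if_pos rfl
  · rw [T.rootA_eq hT hξ, T.rootB_eq hT hξ, T.origin_root hξ]
    rintro (u | _ | _) h1 h2 h3
    · rw [T.outdegree_inner hT hξ.1.1, if_neg]
      exact fun h => h3 ((T.inner_toInner_eq_iff _ u).2 h.symm).symm
    · exact absurd rfl h1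
    · exact absurd rfl h2

end Balanced

end Finite

end PlaneTree

namespace PlaneTree

variable {V : Type*} (T : PlaneTree V)

/-! ### Labels along leftmost paths -/

variable [Finite V] {ξ : T.graph.Dart} (hT : T.IsBlossoming) (hξ : T.IsBalanced ξ)

include hT hξ

omit hT in
theorem contourIndex_succ_lt_of_inner {d : T.graph.Dart} (hd : ¬ T.IsBlossom d.fst) :
    T.contourIndex ξ d + 1 < T.numCorners := by
  rcases (Nat.succ_le_of_lt (T.contourIndex_lt ξ d)).lt_or_eq with h | h
  · exact h
  · have h1 := T.last_stem_index ξ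
    have h2 : d = (T.next.symm ξ).symm := T.contourIndex_inj (ξ := ξ) (by omega)
    rw [h2] at hd
    exact absurd hξ.2.1.2 hd

omit hT in
theorem one_le_cornerLabel {d : T.graph.Dart} (hd : ¬ T.IsBlossom d.fst) :
    1 ≤ T.cornerLabel ξ d := by
  rw [T.cornerLabel_inner hξ hd]
  rcases h : T.contourIndex ξ d with _ | i
  · rw [height_zero]
    norm_num
  · have := T.contourIndex_lt ξ d
    have := T.height_of_isBalanced hξ (i := i) (by omega)
    omega

omit hT hξ in
theorem lt_symm_of_notMem {d : T.graph.Dart} (hd : ¬ T.IsBlossom d.fst)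
    (h : Sum.inl d ∉ T.canonicalOrientation ξ) :
    ¬ T.IsBlossom d.snd ∧ T.contourIndex ξ d < T.contourIndex ξ d.symm := by
  rw [inl_mem_canonicalOrientation, not_or] at h
  have h1 : ¬ T.IsBlossom d.snd := fun h2 => h.1 ⟨hd, h2⟩
  refine ⟨h1, lt_of_le_of_ne ?_ (T.contourIndex_symm_ne ξ d).symm⟩
  by_contra h2
  exact h.2 ⟨hd, h1, by omega⟩

omit hT in
theorem contourIndex_next_of_notMem {d : T.graph.Dart} (hd : ¬ T.IsBlossom d.fst)
    (h : Sum.inl d ∉ T.canonicalOrientation ξ) :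
    T.contourIndex ξ (T.next d) = T.contourIndex ξ d.symm + 1 := by
  rw [next_eq_faceNext_symm]
  exact T.contourIndex_faceNext
    (T.contourIndex_succ_lt_of_inner hξ (d := d.symm) (T.lt_symm_of_notMem hd h).1)

/-- The edge leads to a child, and the contour explores its subtree between the two corners;
`height_child` applies. -/
theorem cornerLabel_next_of_notMem {d : T.graph.Dart} (hd : ¬ T.IsBlossom d.fst)
    (h : Sum.inl d ∉ T.canonicalOrientation ξ) :
    T.cornerLabel ξ (T.next d) = T.cornerLabel ξ d := by
  obtain ⟨h1, h2⟩ := T.lt_symm_of_notMem hd h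
  rw [T.cornerLabel_inner hξ hd, T.cornerLabel_inner hξ (by rwa [next_fst]),
    T.contourIndex_next_of_notMem hξ hd h, T.height_child hT hξ.not_isBlossom h1 h2]

/-- An incoming edge is either an attached stem, past which the tree corner is still the same, or an
edge to a child. -/
theorem exists_closureNext_of_notMem {d : T.graph.Dart} (hd : T.IsAttached d)
    (h : Sum.inl d ∉ T.canonicalOrientation ξ) :
    ∃ e : T.graph.Dart, T.closureNext ξ (Sum.inl d) = Sum.inl e ∧ T.IsAttached e ∧
      T.cornerLabel ξ (T.cornerOrigin e) = T.cornerLabel ξ (T.cornerOrigin d) := by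
  by_cases hb : T.IsBlossom d.fst
  · obtain ⟨e, h1, h2, h3⟩ := T.exists_closureNext_blossom ξ hb (hd hb)
    exact ⟨e, h1, h2, by rw [h3, T.cornerOrigin_blossom hb]⟩
  · obtain ⟨e, h1, h2, h3⟩ := T.exists_closureNext_inner ξ hb
    exact ⟨e, h1, h2, by
      rw [h3, T.cornerOrigin_inner hb, T.cornerLabel_next_of_notMem hT hξ hb h]⟩

/-- The label decreases by one when an oriented edge is followed to an inner vertex. -/
theorem exists_closureNext_symm {d : T.graph.Dart} (hd : Sum.inl d ∈ T.canonicalOrientation ξ)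
    (hc : T.IsAttached d.symm) :
    ∃ e : T.graph.Dart, T.closureNext ξ (Sum.inl d.symm) = Sum.inl e ∧ T.IsAttached e ∧
      T.cornerLabel ξ (T.cornerOrigin e) = T.cornerLabel ξ d - 1 := by
  have hd1 := T.not_isBlossom_of_mem hd
  have hN := T.contourIndex_succ_lt_of_inner hξ hd1
  have hstep : T.height ξ (T.contourIndex ξ d + 1) = T.height ξ (T.contourIndex ξ d) - 1 :=
    T.height_succ_inner (by rwa [contour_contourIndex])
  rw [T.cornerLabel_inner hξ hd1]
  by_cases hb : T.IsBlossom d.snd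
  · have hb' : T.IsBlossom d.symm.fst := hb
    obtain ⟨e, h1, h2, h3⟩ := T.exists_closureNext_blossom ξ hb' (hc hb')
    refine ⟨e, h1, h2, ?_⟩
    rw [h3, T.cornerLabel_inner hξ (T.successor_inner d.symm (hc hb')),
      T.height_successor hT hξ hb' (hc hb'), T.contourIndex_stem hξ.not_isBlossom hb, hstep]
    ring
  · have hb' : ¬ T.IsBlossom d.symm.fst := hb
    obtain ⟨e, h1, h2, h3⟩ := T.exists_closureNext_inner ξ hb'
    refine ⟨e, h1, h2, ?_⟩
    rw [h3, T.cornerLabel_inner hξ (by rwa [next_fst]), next_eq_faceNext_symm,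
      SimpleGraph.Dart.symm_symm, T.contourIndex_faceNext hN, hstep]
    ring

/-- The two possible levels of an unclosed blossom, -1 and 0, give the two cases; the corner before
the blossom is one level higher. -/
theorem cornerLabel_of_target_open {d : T.graph.Dart} (hd : Sum.inl d ∈ T.canonicalOrientation ξ)
    (hc : ¬ T.IsAttached d.symm) :
    T.cornerLabel ξ d = 2 ∧ (T.closure ξ).target (Sum.inl d) = .A ∨
      T.cornerLabel ξ d = 3 ∧ (T.closure ξ).target (Sum.inl d) = .B := by
  have hd1 := T.not_isBlossom_of_mem hd
  simp only [IsAttached, Classical.not_imp] at hc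
  obtain ⟨hb, hc⟩ := hc
  have hstep : T.height ξ (T.contourIndex ξ d + 1) = T.height ξ (T.contourIndex ξ d) - 1 :=
    T.height_succ_inner (by rwa [contour_contourIndex])
  have hl := T.height_of_not_isClosed hT hξ hb hc
  rw [T.contourIndex_stem hξ.not_isBlossom hb, hstep] at hl
  rw [closure_target_inl, T.closureOrigin_open ξ hb hc, T.cornerLabel_blossom hξ hb,
    T.contourIndex_stem hξ.not_isBlossom hb, hstep, T.cornerLabel_inner hξ hd1]
  rcases hl with hl | hl
  · left
    exact ⟨by omega, if_pos (by omega)⟩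
  · right
    exact ⟨by omega, if_neg (by omega)⟩

/-- The leftmost path from an oriented edge has as many vertices as the label indicates. -/
theorem exists_leftmostPath {d : T.graph.Dart} (hd : Sum.inl d ∈ T.canonicalOrientation ξ) :
    ∃ P, (T.closure ξ).IsLeftmostPath (T.canonicalOrientation ξ) (Sum.inl d) .A P ∧
      T.cornerLabel ξ d = P.length + 1 := by
  have hfin := T.finite_dart
  have hO := T.isOrientation_canonicalOrientation hξ.not_isBlossom
  -- Truncation to natural numbers is harmless, since labels of inner corners are at least 1.
  induction hn : (T.cornerLabel ξ d).toNat using Nat.strong_induction_on generalizing d with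
  | _ n ih =>
    subst hn
    by_cases hc : T.IsAttached d.symm
    · obtain ⟨k, hk, hkO, hmin⟩ : ∃ k, 0 < k ∧
          ((T.closure ξ).next ^ k) ((T.closure ξ).rev (Sum.inl d)) ∈ T.canonicalOrientation ξ ∧
          ∀ j, 0 < j → j < k → ((T.closure ξ).next ^ j) ((T.closure ξ).rev (Sum.inl d)) ∉
            T.canonicalOrientation ξ := by
        have htarget : (T.closure ξ).target (Sum.inl d)
            = .inner (T.toInner _ (T.not_isBlossom_cornerOrigin hc)) :=
          (T.closureOrigin_eq_inner_iff ξ d.symm _).2 ⟨hc, rfl⟩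
        have hpos : 0 < (T.closure ξ).outdegree (T.canonicalOrientation ξ)
            (.inner (T.toInner _ (T.not_isBlossom_cornerOrigin hc))) := by
          rw [T.outdegree_inner hT hξ.not_isBlossom]
          split_ifs <;> norm_num
        obtain ⟨x, hx1, hx2⟩ := Set.nonempty_of_ncard_ne_zero hpos.ne'
        exact RotationMap.exists_isFirstOutgoingAfter hO hd hx1 (hx2.trans htarget.symm)
      -- Arrival lowers the label by one; the turn up to the first outgoing edge passes only
      -- incoming edges and preserves it.
      have key : ∀ j, 0 < j → j ≤ k → ∃ e : T.graph.Dart,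
          ((T.closure ξ).next ^ j) ((T.closure ξ).rev (Sum.inl d)) = Sum.inl e ∧ T.IsAttached e ∧
            T.cornerLabel ξ (T.cornerOrigin e) = T.cornerLabel ξ d - 1 := by
        intro j hj
        induction j, hj using Nat.le_induction with
        | base =>
          intro _
          exact T.exists_closureNext_symm hT hξ hd hc
        | succ j hj ih =>
          intro hjk
          obtain ⟨e, h1, h2, h3⟩ := ih (by omega)
          have h4 := hmin j (by omega) (by omega)
          rw [h1] at h4
          obtain ⟨e', h5, h6, h7⟩ := T.exists_closureNext_of_notMem hT hξ h2 h4
          refine ⟨e', ?_, h6, h7.trans h3⟩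
          rw [pow_succ', Equiv.Perm.mul_apply, h1]
          exact h5
      obtain ⟨e, h1, h2, h3⟩ := key k hk le_rfl
      have h4 : Sum.inl e ∈ T.canonicalOrientation ξ := h1 ▸ hkO
      rw [T.cornerOrigin_inner (T.not_isBlossom_of_mem h4)] at h3
      have h5 := T.one_le_cornerLabel hξ (T.not_isBlossom_of_mem h4)
      obtain ⟨P, hP, hlen⟩ := ih _ (by omega) h4 rfl
      refine ⟨Sum.inl d :: P, hP.cons hd ⟨k, hk, h1.symm, h4, hmin⟩, ?_⟩
      rw [List.length_cons]
      push_cast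
      omega
    · rcases T.cornerLabel_of_target_open hT hξ hd hc with ⟨h1, h2⟩ | ⟨h1, h2⟩
      · refine ⟨[Sum.inl d], ?_, by rw [h1]; norm_num⟩
        rw [← h2]
        exact RotationMap.isLeftmostPath_singleton hd
      · have hBA : T.dartBA ∈ T.canonicalOrientation ξ := rfl
        obtain ⟨k, hk, hkO, hmin⟩ := RotationMap.exists_isFirstOutgoingAfter hO hd hBA h2.symm
        -- `B` has only one outgoing dart, so the path has two edges and three vertices, in
        -- accordance with label 3.
        have hBk : ((T.closure ξ).next ^ k) ((T.closure ξ).rev (Sum.inl d)) = T.dartBA := by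
          have horig : (T.closure ξ).origin
              (((T.closure ξ).next ^ k) ((T.closure ξ).rev (Sum.inl d))) = .B := by
            rw [RotationMap.origin_next_pow]
            exact h2
          rcases hx : ((T.closure ξ).next ^ k) ((T.closure ξ).rev (Sum.inl d)) with e | b
          · rw [hx] at hkO horig
            rw [closure_origin_apply, T.closureOrigin_inner ξ (T.not_isBlossom_of_mem hkO)] at horig
            cases horig
          · rw [hx, inr_mem_canonicalOrientation] at hkO
            rw [hkO]
        exact ⟨[Sum.inl d, T.dartBA],
          (RotationMap.isLeftmostPath_singleton hBA).cons hd ⟨k, hk, hBk.symm, hBA, hmin⟩,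
          by rw [h1]; norm_num⟩

/-- Turning past edges to children keeps the label and advances in the contour, so it must stop at
an outgoing edge. Thus the minimal label at a vertex is the length of a leftmost path. -/
theorem exists_mem_canonicalOrientation {c : T.graph.Dart} (hc : ¬ T.IsBlossom c.fst) :
    ∃ d : T.graph.Dart, d.fst = c.fst ∧ Sum.inl d ∈ T.canonicalOrientation ξ ∧
      T.cornerLabel ξ d = T.cornerLabel ξ c := by
  induction hn : T.numCorners - T.contourIndex ξ c using Nat.strong_induction_on
    generalizing c with
  | _ n ih =>
    subst hn
    by_cases h : Sum.inl c ∈ T.canonicalOrientation ξ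
    · exact ⟨c, rfl, h, rfl⟩
    · have h1 := T.contourIndex_next_of_notMem hξ hc h
      have h2 := (T.lt_symm_of_notMem hc h).2
      have h3 := T.contourIndex_lt ξ (T.next c)
      obtain ⟨d, hd1, hd2, hd3⟩ := ih _ (by omega) (c := T.next c) (by rwa [next_fst]) rfl
      exact ⟨d, hd1.trans (T.next_fst c), hd2,
        hd3.trans (T.cornerLabel_next_of_notMem hT hξ hc h)⟩

theorem exists_walk_A (u : T.ClosureVertex) :
    ∃ p : (T.closure ξ).toGraph.Walk u .A, (p.length : ℤ) ≤ T.closureVertexLabel ξ u - 1 := by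
  rcases u with u | _ | _
  · have hne : {z | ∃ c : T.toMap.Corner, T.toMap.origin c = u.1 ∧ T.cornerLabel ξ c = z}.Nonempty := by
      obtain ⟨d, hd⟩ := T.exists_dart_fst ξ u.1
      exact ⟨_, d, hd, rfl⟩
    have hbdd : BddBelow
        {z | ∃ c : T.toMap.Corner, T.toMap.origin c = u.1 ∧ T.cornerLabel ξ c = z} := by
      refine ⟨1, ?_⟩
      rintro z ⟨c, hc, rfl⟩
      have hc' : c.fst = u.1 := hc
      exact T.one_le_cornerLabel hξ (hc' ▸ u.2)
    obtain ⟨c, hc, hlab⟩ := Int.csInf_mem hne hbdd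
    have hc' : c.fst = u.1 := hc
    obtain ⟨d, hd1, hd2, hd3⟩ := T.exists_mem_canonicalOrientation hT hξ (c := c) (hc' ▸ u.2)
    obtain ⟨P, hP, hlen⟩ := T.exists_leftmostPath hT hξ hd2
    obtain ⟨p, hp⟩ := hP.exists_walk
    have horig : (T.closure ξ).origin (Sum.inl d) = .inner u := by
      rw [closure_origin_apply, T.closureOrigin_inner ξ (T.not_isBlossom_of_mem hd2),
        inner_toInner_eq_iff]
      exact hd1.trans hc'
    refine ⟨p.copy horig rfl, ?_⟩
    rw [SimpleGraph.Walk.length_copy]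
    have hY : T.closureVertexLabel ξ (.inner u) = T.cornerLabel ξ c := hlab.symm
    rw [hY, ← hd3, hlen]
    omega
  · exact ⟨.nil, by simp [closureVertexLabel]⟩
  · obtain ⟨p, hp⟩ := (T.closure ξ).exists_walk_of_dart T.dartBA
    refine ⟨p, ?_⟩
    have : T.closureVertexLabel ξ (.B : T.ClosureVertex) = 2 := rfl
    rw [this]
    have h : (p.length : ℤ) ≤ 1 := by exact_mod_cast hp
    exact h.trans (by norm_num)

omit hT hξ in
theorem closureLabel_inner {d : T.graph.Dart} (hd : ¬ T.IsBlossom d.fst) :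
    T.closureLabel ξ (Sum.inl d) = T.cornerLabel ξ d := by
  have h : (T.closure ξ).origin (Sum.inl d) = .inner (T.toInner d.fst hd) :=
    T.closureOrigin_inner ξ hd
  rw [closureLabel, h]
  simp only [T.cornerOrigin_inner hd]

end PlaneTree

namespace RotationMap

variable {V D : Type*} {M : RotationMap V D}

/-! ### Directed cycles -/

/-- Unrolling the cycle into a periodic sequence allows induction along it from any starting point.
-/
theorem IsDirectedCycle.exists_sequence {O : Set D} {C : List D} (hC : M.IsDirectedCycle O C) :
    ∃ (n : ℕ) (c : ℕ → D), 0 < n ∧ (∀ i, c i ∈ C) ∧ (∀ d ∈ C, ∃ i, c i = d) ∧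
      (∀ i, c (i + n) = c i) ∧ ∀ i, M.target (c i) = M.origin (c (i + 1)) := by
  obtain ⟨h1, _, h3, _⟩ := hC
  have hn : 0 < C.length := List.length_pos_iff.2 h1
  refine ⟨C.length, fun i => C[i % C.length]'(Nat.mod_lt _ hn), hn, fun i => List.getElem_mem _,
    ?_, ?_, ?_⟩
  · intro d hd
    obtain ⟨i, hi, rfl⟩ := List.getElem_of_mem hd
    refine ⟨i, ?_⟩
    simp only [Nat.mod_eq_of_lt hi]
  · intro i
    simp only [Nat.add_mod_right]
  · intro i
    have h5 : (C.map M.target)[i % C.length]'(by simpa using Nat.mod_lt _ hn)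
        = ((C.map M.origin).rotate 1)[i % C.length]'(by simpa using Nat.mod_lt _ hn) := by
      simp only [h3]
    rw [List.getElem_rotate] at h5
    simpa using h5

theorem IsDirectedCycle.eq_of_origin_eq {O : Set D} {C : List D} (hC : M.IsDirectedCycle O C)
    {d d' : D} (hd : d ∈ C) (hd' : d' ∈ C) (h : M.origin d = M.origin d') : d = d' :=
  List.inj_on_of_nodup_map hC.2.2.2 hd hd' h

theorem IsDirectedCycle.eq_of_target_eq {O : Set D} {C : List D} (hC : M.IsDirectedCycle O C)
    {d d' : D} (hd : d ∈ C) (hd' : d' ∈ C) (h : M.target d = M.target d') : d = d' := by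
  refine List.inj_on_of_nodup_map ?_ hd hd' h
  rw [hC.2.2.1]
  exact List.nodup_rotate.2 hC.2.2.2

theorem IsDirectedCycle.rev_notMem {O : Set D} (hO : M.IsOrientation O) {C : List D}
    (hC : M.IsDirectedCycle O C) {d : D} (hd : d ∈ C) : M.rev d ∉ C :=
  fun h => (hO d).1 (hC.2.1 d hd) (hC.2.1 _ h)

theorem eqvGen_faceNext (C : List D) (d : D) :
    Relation.EqvGen (M.StepAvoiding C) d (M.next (M.rev d)) :=
  .rel _ _ (Or.inl rfl)

theorem eqvGen_next {C : List D} {d : D} (h1 : d ∉ C) (h2 : M.rev d ∉ C) :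
    Relation.EqvGen (M.StepAvoiding C) d (M.next d) := by
  have h := M.eqvGen_faceNext C (M.rev d)
  rw [M.rev_rev] at h
  exact .trans _ _ _ (.rel _ _ (Or.inr ⟨rfl, h1, h2⟩)) h

/-- All corners at a vertex that is not on the cycle are on the same side. -/
theorem IsDirectedCycle.eqvGen_of_origin_eq [Finite D] {O : Set D} {C : List D}
    (hC : M.IsDirectedCycle O C) {y y' : D} (hy : ∀ d ∈ C, M.origin d ≠ M.origin y)
    (h : M.origin y = M.origin y') : Relation.EqvGen (M.StepAvoiding C) y y' := by
  obtain ⟨k, rfl⟩ := ((M.sameCycle_next y y').2 h).exists_nat_pow_eq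
  clear h
  induction k with
  | zero => exact .refl _
  | succ k ih =>
    rw [pow_succ', Equiv.Perm.mul_apply]
    refine .trans _ _ _ ih (M.eqvGen_next ?_ ?_)
    · intro h
      exact hy _ h (M.origin_next_pow k y)
    · intro h
      obtain ⟨n, c, _, hc1, hc2, _, hc4⟩ := hC.exists_sequence
      obtain ⟨i, hi⟩ := hc2 _ h
      apply hy _ (hc1 (i + 1))
      rw [← hc4, hi, target_rev, origin_next_pow]

/-- Rotating around the endpoint of an edge of the cycle, starting from this edge, one stays on the
left of the cycle until one reaches the next edge of the cycle. -/
theorem IsDirectedCycle.eqvGen_next_of_ne {O : Set D} {C : List D} (hC : M.IsDirectedCycle O C)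
    {d d' y : D} (hd : d ∈ C) (hd' : d' ∈ C) (hdd' : M.target d = M.origin d')
    (hy : M.origin y = M.target d) (hne : y ≠ d')
    (h : Relation.EqvGen (M.StepAvoiding C) d y ∨ y = M.rev d) :
    Relation.EqvGen (M.StepAvoiding C) d (M.next y) := by
  by_cases hyd : y = M.rev d
  · rw [hyd]
    exact M.eqvGen_faceNext C d
  · refine .trans _ _ _ (h.resolve_right hyd) (M.eqvGen_next ?_ ?_)
    · intro hyC
      exact hne (hC.eq_of_origin_eq hyC hd' (hy.trans hdd'))
    · intro hyC
      apply hyd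
      rw [← hC.eq_of_target_eq hyC hd ((M.target_rev y).trans hy), M.rev_rev]

/-- Turn around the common vertex from the reverse of `d` to the first occurrence of `d'`; no edge
of the cycle is crossed on the way. -/
theorem IsDirectedCycle.eqvGen_consecutive [Finite D] {O : Set D} (hO : M.IsOrientation O)
    {C : List D} (hC : M.IsDirectedCycle O C) {d d' : D} (hd : d ∈ C) (hd' : d' ∈ C)
    (hdd' : M.target d = M.origin d') : Relation.EqvGen (M.StepAvoiding C) d d' := by
  classical
  have hex : ∃ k, (M.next ^ k) (M.rev d) = d' :=
    ((M.sameCycle_next (M.rev d) d').2 hdd').exists_nat_pow_eq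
  have key : ∀ j ≤ Nat.find hex,
      Relation.EqvGen (M.StepAvoiding C) d ((M.next ^ j) (M.rev d)) ∨
        (M.next ^ j) (M.rev d) = M.rev d := by
    intro j
    induction j with
    | zero => exact fun _ => Or.inr rfl
    | succ j ih =>
      intro hj
      left
      rw [pow_succ', Equiv.Perm.mul_apply]
      refine hC.eqvGen_next_of_ne hd hd' hdd' ?_ (Nat.find_min hex hj) (ih (by omega))
      rw [origin_next_pow]
      rfl
  rcases key _ le_rfl with h | h
  · rwa [Nat.find_spec hex] at h
  · rw [Nat.find_spec hex] at h
    exact absurd hd' (h ▸ hC.rev_notMem hO hd)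

/-- The left of a cycle is one region, so the choice of the dart in `OnLeft` is immaterial. -/
theorem IsDirectedCycle.eqvGen_of_mem [Finite D] {O : Set D} (hO : M.IsOrientation O)
    {C : List D} (hC : M.IsDirectedCycle O C) {d d' : D} (hd : d ∈ C) (hd' : d' ∈ C) :
    Relation.EqvGen (M.StepAvoiding C) d d' := by
  obtain ⟨n, c, _, hc1, hc2, _, hc4⟩ := hC.exists_sequence
  have key : ∀ i, Relation.EqvGen (M.StepAvoiding C) (c 0) (c i) := by
    intro i
    induction i with
    | zero => exact .refl _
    | succ i ih => exact .trans _ _ _ ih (hC.eqvGen_consecutive hO (hc1 i) (hc1 _) (hc4 i))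
  obtain ⟨i, rfl⟩ := hc2 d hd
  obtain ⟨j, rfl⟩ := hc2 d' hd'
  exact .trans _ _ _ (.symm _ _ (key i)) (key j)

end RotationMap

namespace PlaneTree

variable {V : Type*} (T : PlaneTree V) [Finite V] {ξ : T.graph.Dart} (hT : T.IsBlossoming)
  (hξ : T.IsBalanced ξ)

/-! ### The canonical orientation is minimal -/

theorem finite_closureDart : Finite T.ClosureDart :=
  have := T.finite_dart
  inferInstance

theorem closure_origin_eq_iff {d d' : T.graph.Dart} (hd : ¬ T.IsBlossom d.fst)
    (hd' : ¬ T.IsBlossom d'.fst) :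
    (T.closure ξ).origin (Sum.inl d) = (T.closure ξ).origin (Sum.inl d') ↔ d.fst = d'.fst := by
  rw [closure_origin_apply, closure_origin_apply, T.closureOrigin_inner ξ hd,
    T.closureOrigin_inner ξ hd', inner_toInner_eq_iff]
  rfl

/-- A directed cycle cannot use the new edge, which leads to the sink `A`. -/
theorem exists_tree_sequence {C : List T.ClosureDart}
    (hC : (T.closure ξ).IsDirectedCycle (T.canonicalOrientation ξ) C) :
    ∃ (n : ℕ) (e : ℕ → T.graph.Dart), 0 < n ∧ (∀ i, Sum.inl (e i) ∈ C) ∧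
      (∀ d ∈ C, ∃ i, Sum.inl (e i) = d) ∧ (∀ i, e (i + n) = e i) ∧
      ∀ i, (T.closure ξ).target (Sum.inl (e i)) = (T.closure ξ).origin (Sum.inl (e (i + 1))) := by
  obtain ⟨n, c, hn, hc1, hc2, hc3, hc4⟩ := hC.exists_sequence
  have h : ∀ i, ∃ d : T.graph.Dart, c i = Sum.inl d := by
    intro i
    rcases hx : c i with d | b
    · exact ⟨d, rfl⟩
    · exfalso
      have h1 := hC.2.1 _ (hc1 i)
      have h2 := hc4 i
      rw [hx, inr_mem_canonicalOrientation] at h1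
      rw [hx, h1] at h2
      exact T.origin_ne_A_of_mem (hC.2.1 _ (hc1 (i + 1))) h2.symm
  choose e he using h
  simp only [he] at hc1 hc2 hc3 hc4
  exact ⟨n, e, hn, hc1, hc2, fun i => Sum.inl_injective (hc3 i), hc4⟩

/-- The corners at vertices that are visited before those of the cycle are on the same side of the
cycle as the root corner. -/
theorem eqvGen_root (hξ' : ¬ T.IsBlossom ξ.fst) {C : List T.ClosureDart}
    (hC : (T.closure ξ).IsDirectedCycle (T.canonicalOrientation ξ) C)
    (n : ℕ) (hnN : n < T.numCorners)
    (hn : ∀ e : T.graph.Dart, Sum.inl e ∈ C → ∀ i ≤ n, (T.contour ξ i).fst ≠ e.fst)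
    (hb : ¬ T.IsBlossom (T.contour ξ n).fst) :
    Relation.EqvGen ((T.closure ξ).StepAvoiding C) (Sum.inl (T.contour ξ n)) (Sum.inl ξ) := by
  have hfin := T.finite_closureDart
  induction n using Nat.strong_induction_on with
  | _ n ih =>
    rcases n with _ | n
    · exact .refl _
    · have hz : ∀ d ∈ C, (T.closure ξ).origin d ≠
          (T.closure ξ).origin (Sum.inl (T.contour ξ (n + 1))) := by
        obtain ⟨_, e, _, he1, he2, _, _⟩ := T.exists_tree_sequence hC
        intro d hd
        obtain ⟨i, rfl⟩ := he2 d hd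
        rw [Ne, T.closure_origin_eq_iff (T.not_isBlossom_of_mem (hC.2.1 _ hd)) hb]
        exact (hn _ hd _ le_rfl).symm
      have hsnd : (T.contour ξ (n + 1)).fst = (T.contour ξ n).snd := by
        rw [contour_succ, faceNext_fst]
      -- If the contour has just come back from a blossom, the corner two steps earlier is at the
      -- same vertex, off the cycle. Otherwise, the edge just followed is crossed by turning around
      -- its endpoint, which is off the cycle.
      by_cases hb' : T.IsBlossom (T.contour ξ n).fst
      · have hst : T.IsBlossom (T.contour ξ n).symm.snd := hb'
        have hidx := T.contourIndex_stem hξ' hst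
        rw [SimpleGraph.Dart.symm_symm, T.contourIndex_contour ξ (by omega)] at hidx
        have hpred : T.contour ξ (n - 1) = (T.contour ξ n).symm := by
          rw [hidx, Nat.add_sub_cancel, contour_contourIndex, ← hidx]
        have hfst : (T.contour ξ (n + 1)).fst = (T.contour ξ (n - 1)).fst := by
          rw [hpred, hsnd]
          rfl
        have hb2 : ¬ T.IsBlossom (T.contour ξ (n - 1)).fst := hfst ▸ hb
        refine .trans _ _ _ (hC.eqvGen_of_origin_eq hz ((T.closure_origin_eq_iff hb hb2).2 hfst))
          (ih (n - 1) (by omega) (by omega) (fun e he i hi => hn e he i (by omega)) hb2)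
      · refine .trans _ (Sum.inl (T.contour ξ n)) _ (.symm _ _ (.trans _ _ _
          ((T.closure ξ).eqvGen_faceNext C _) (.symm _ _ (hC.eqvGen_of_origin_eq hz ?_))))
          (ih n (by omega) (by omega) (fun e he i hi => hn e he i (by omega)) hb')
        rw [RotationMap.origin_next, closure_rev_inl]
        exact (T.closure_origin_eq_iff hb (d' := (T.contour ξ n).symm)
          (by rw [hsnd] at hb; exact hb)).2 hsnd

include hT hξ

/-- When a dart of the cycle is followed, one arrives in a corner of the tree on the left of the cycle,
which comes later in the contour exploration. -/
theorem exists_arrival {C : List T.ClosureDart}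
    (hC : (T.closure ξ).IsDirectedCycle (T.canonicalOrientation ξ) C) {e e' : T.graph.Dart}
    (he : Sum.inl e ∈ C) (he' : Sum.inl e' ∈ C)
    (hee' : (T.closure ξ).target (Sum.inl e) = (T.closure ξ).origin (Sum.inl e')) :
    ∃ q : T.graph.Dart, q.fst = e'.fst ∧ T.contourIndex ξ e < T.contourIndex ξ q ∧
      Relation.EqvGen ((T.closure ξ).StepAvoiding C) (Sum.inl e) (Sum.inl q) := by
  have h1 := T.not_isBlossom_of_mem (hC.2.1 _ he)
  have h1' := T.not_isBlossom_of_mem (hC.2.1 _ he')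
  have h2 : (T.closure ξ).origin (Sum.inl e') = .inner (T.toInner _ h1') :=
    T.closureOrigin_inner ξ h1'
  obtain ⟨h3, h4⟩ := (T.closureOrigin_eq_inner_iff ξ e.symm _).1 (hee'.trans h2)
  have h4' : (T.cornerOrigin e.symm).fst = e'.fst := h4
  have hstep : ∀ b : T.graph.Dart, T.IsBlossom b.fst → T.IsClosed b →
      (T.successor b).fst = e'.fst →
      (Relation.EqvGen ((T.closure ξ).StepAvoiding C) (Sum.inl e) (Sum.inl b) ∨
        Sum.inl b = (T.closure ξ).rev (Sum.inl e)) →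
      (Relation.EqvGen ((T.closure ξ).StepAvoiding C) (Sum.inl e) (T.closureNext ξ (Sum.inl b)) ∨
        T.closureNext ξ (Sum.inl b) = (T.closure ξ).rev (Sum.inl e)) := by
    intro b hb hc hs hS
    left
    refine hC.eqvGen_next_of_ne he he' hee' ?_ ?_ hS
    · rw [hee', h2]
      refine (T.closureOrigin_eq_inner_iff ξ b _).2 ⟨fun _ => hc, ?_⟩
      rw [T.cornerOrigin_blossom hb]
      exact hs
    · intro h
      exact h1' (Sum.inl_injective h ▸ hb)
  have hN := T.contourIndex_succ_lt_of_inner hξ h1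
  by_cases hb : T.IsBlossom e.snd
  · have hb' : T.IsBlossom e.symm.fst := hb
    rw [T.cornerOrigin_blossom hb'] at h4'
    have hlt := (T.successor_spec hT hξ hb' (h3 hb')).1
    have hidx := T.contourIndex_stem hξ.not_isBlossom hb
    refine ⟨_, h4', by omega, ?_⟩
    refine (T.rotate_to_successor ξ (fun y => Relation.EqvGen ((T.closure ξ).StepAvoiding C)
      (Sum.inl e) y ∨ y = (T.closure ξ).rev (Sum.inl e)) ?_ hb' (h3 hb') rfl
      (Or.inr rfl)).resolve_right ?_
    · intro b hb hc hs
      exact hstep b hb hc (hs ▸ h4')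
    · intro h
      have h5 := T.successor_inner e.symm (h3 hb')
      rw [Sum.inl_injective h] at h5
      exact h5 hb'
  · have hb' : ¬ T.IsBlossom e.symm.fst := hb
    rw [T.cornerOrigin_inner hb'] at h4'
    have hnext : T.next e.symm = T.toMap.faceNext e := rfl
    refine ⟨T.next e.symm, (T.next_fst _).trans h4', ?_, ?_⟩
    · rw [hnext, T.contourIndex_faceNext hN]
      omega
    · refine (T.rotate_to_next ξ (fun y => Relation.EqvGen ((T.closure ξ).StepAvoiding C)
        (Sum.inl e) y ∨ y = (T.closure ξ).rev (Sum.inl e)) hb' ?_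
        (Or.inl ((T.closure ξ).eqvGen_faceNext C _))).resolve_right ?_
      · intro b hb hc hs
        exact hstep b hb hc (by rw [hs, next_fst, h4'])
      · intro h
        have h5 : T.contourIndex ξ (T.next e.symm) = T.contourIndex ξ e.symm := by
          rw [Sum.inl_injective h, toMap_rev]
        have h6 : T.contourIndex ξ (T.next e.symm) = T.contourIndex ξ e + 1 := by
          rw [hnext, T.contourIndex_faceNext hN]
        rcases hC.2.1 _ he with h7 | h7
        · exact hb h7.2
        · have := h7.2.2
          omega

omit hT hξ in
theorem eqvGen_next_tree {C : List T.ClosureDart}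
    (hC : (T.closure ξ).IsDirectedCycle (T.canonicalOrientation ξ) C) {e e' y : T.graph.Dart}
    (he : Sum.inl e ∈ C) (he' : Sum.inl e' ∈ C)
    (hee' : (T.closure ξ).target (Sum.inl e) = (T.closure ξ).origin (Sum.inl e'))
    (hy : y.fst = e'.fst) (hne : y ≠ e')
    (h : Relation.EqvGen ((T.closure ξ).StepAvoiding C) (Sum.inl e) (Sum.inl y)) :
    Relation.EqvGen ((T.closure ξ).StepAvoiding C) (Sum.inl e) (Sum.inl (T.next y)) := by
  have h1' := T.not_isBlossom_of_mem (hC.2.1 _ he')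
  have hyb : ¬ T.IsBlossom y.fst := hy ▸ h1'
  refine T.rotate_to_next ξ (fun y => Relation.EqvGen ((T.closure ξ).StepAvoiding C)
        (Sum.inl e) y) hyb ?_ ?_
  · intro b hb hc hs hS
    refine hC.eqvGen_next_of_ne he he' hee' ?_ ?_ (Or.inl hS)
    · rw [hee', closure_origin_apply, closure_origin_apply, T.closureOrigin_inner ξ h1',
        closureOrigin_eq_inner_iff]
      refine ⟨fun _ => hc, ?_⟩
      rw [T.cornerOrigin_blossom hb, hs, next_fst, hy]
      rfl
    · intro h
      exact h1' (Sum.inl_injective h ▸ hb)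
  · refine hC.eqvGen_next_of_ne he he' hee' ?_ ?_ (Or.inl h)
    · rw [hee']
      exact (T.closure_origin_eq_iff hyb h1').2 hy
    · exact fun h => hne (Sum.inl_injective h)

theorem isMinimalOrientation_canonicalOrientation :
    (T.closure ξ).IsMinimalOrientation (T.rootCorner ξ) (T.canonicalOrientation ξ) := by
  have hfin := T.finite_closureDart
  have hfin' := T.finite_dart
  have hO := T.isOrientation_canonicalOrientation hξ.not_isBlossom
  intro C hC
  obtain ⟨n, e, hn, he1, he2, he3, he4⟩ := T.exists_tree_sequence hC
  have hein : ∀ i, ¬ T.IsBlossom (e i).fst := fun i => T.not_isBlossom_of_mem (hC.2.1 _ (he1 i))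
  choose q hq1 hq2 hq3 using fun i => T.exists_arrival hT hξ hC (he1 i) (he1 (i + 1)) (he4 i)
  -- `y₀` is the earliest corner at any vertex of the cycle, and `e i₀` leaves its vertex.
  obtain ⟨y₀, ⟨i₀, hy₀⟩, hmin⟩ := Set.exists_min_image
    {y : T.graph.Dart | ∃ i, y.fst = (e i).fst} (T.contourIndex ξ) (Set.toFinite _) ⟨e 0, 0, rfl⟩
  -- As long as it has not returned, the cycle stays at corners after `e i₀`: a departure before `e
  -- i₀` following an arrival after it would interleave with `y₀` and `e i₀`. After `n` steps it has
  -- returned.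
  obtain ⟨k, hk1, hk2⟩ : ∃ k, (e (i₀ + k + 1)).fst = (e i₀).fst ∧
      T.contourIndex ξ (e i₀) < T.contourIndex ξ (q (i₀ + k)) := by
    by_contra hcon
    push Not at hcon
    have key : ∀ k, T.contourIndex ξ (e i₀) < T.contourIndex ξ (q (i₀ + k)) := by
      intro k
      induction k with
      | zero => exact hq2 i₀
      | succ k ih =>
        have hne : (e (i₀ + k + 1)).fst ≠ (e i₀).fst := fun h => (hcon k h).not_gt ih
        refine lt_trans ?_ (hq2 (i₀ + (k + 1)))
        by_contra hle
        have hne1 : T.contourIndex ξ (e (i₀ + k + 1)) ≠ T.contourIndex ξ (e i₀) :=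
          fun h => hne (by rw [T.contourIndex_inj h])
        have hne2 : T.contourIndex ξ y₀ ≠ T.contourIndex ξ (e (i₀ + k + 1)) :=
          fun h => hne (by rw [← T.contourIndex_inj h, hy₀])
        have hle2 := hmin _ ⟨i₀ + k + 1, rfl⟩
        rw [← add_assoc] at hle
        exact T.not_crossing hy₀ (hq1 (i₀ + k)).symm (by rw [hy₀]; exact hne.symm)
          (lt_of_le_of_ne hle2 hne2) (lt_of_le_of_ne (not_lt.1 hle) hne1) ih
    have h1 := hcon (n - 1) (by rw [add_assoc, Nat.sub_add_cancel hn, he3])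
    exact h1.not_gt (key _)
  have hreturn : e (i₀ + k + 1) = e i₀ := Sum.inl_injective
    (hC.eq_of_origin_eq (he1 _) (he1 _) ((T.closure_origin_eq_iff (hein _) (hein _)).2 hk1))
  -- `y` is the last corner, from the arrival corner on, that is at this vertex and on the left of
  -- the cycle. It comes after `e i₀`, so turning past it does not cross the cycle there.
  obtain ⟨y, ⟨hy1, hy2, hy3⟩, hmax⟩ := Set.exists_max_image
    {y : T.graph.Dart | y.fst = (e i₀).fst ∧
      T.contourIndex ξ (q (i₀ + k)) ≤ T.contourIndex ξ y ∧
      Relation.EqvGen ((T.closure ξ).StepAvoiding C) (Sum.inl (e (i₀ + k))) (Sum.inl y)}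
    (T.contourIndex ξ) (Set.toFinite _) ⟨q (i₀ + k), (hq1 _).trans hk1, le_rfl, hq3 _⟩
  have hynext := T.eqvGen_next_tree hC (he1 (i₀ + k)) (he1 (i₀ + k + 1)) (he4 _)
    (y := y) (by rw [hreturn, hy1]) (by
      rw [hreturn]
      rintro rfl
      omega) hy3
  refine ⟨Sum.inl (e (i₀ + k)), he1 _, ?_⟩
  change Relation.EqvGen ((T.closure ξ).StepAvoiding C) (Sum.inl (e (i₀ + k))) (Sum.inl ξ)
  have hyb : ¬ T.IsBlossom y.fst := hy1 ▸ hein i₀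
  -- If the edge of `y` leads to the parent, following the face arrives at a vertex seen before all
  -- vertices of the cycle, hence on the side of the root.
  rcases lt_or_gt_of_ne (T.contourIndex_symm_ne ξ y) with h | h
  · have hsnd : ¬ T.IsBlossom y.snd := by
      intro hb
      have := T.contourIndex_stem hξ.not_isBlossom hb
      omega
    have hlt := (T.parentDart_le ⟨hyb, hsnd, h⟩ (hy1.trans hy₀.symm)).1
    have hsymm := T.contour_contourIndex ξ y.symm
    have hvert : ∀ i, ∀ j ≤ T.contourIndex ξ y.symm, (T.contour ξ j).fst ≠ (e i).fst := by
      intro i j hj hji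
      have h1 := hmin _ ⟨i, hji⟩
      have h2 := T.contourIndex_lt ξ y.symm
      rw [T.contourIndex_contour ξ (by omega)] at h1
      omega
    have hroot := T.eqvGen_root hξ.not_isBlossom hC (T.contourIndex ξ y.symm)
      (T.contourIndex_lt ξ _) (by
        intro e' he' j hj
        obtain ⟨i, hi⟩ := he2 _ he'
        rw [← Sum.inl_injective hi]
        exact hvert i j hj) (by rw [hsymm]; exact hsnd)
    rw [hsymm] at hroot
    refine .trans _ _ _ (.trans _ _ _ hy3 ((T.closure ξ).eqvGen_faceNext C _)) (.trans _ _ _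
      (.symm _ _ (hC.eqvGen_of_origin_eq (y := Sum.inl y.symm) ?_ ?_)) hroot)
    · intro d hd
      obtain ⟨i, rfl⟩ := he2 d hd
      rw [Ne, T.closure_origin_eq_iff (hein i) hsnd]
      have := hvert i _ le_rfl
      rw [hsymm] at this
      exact this.symm
    · rw [RotationMap.origin_next, closure_rev_inl]
  -- If the edge leads away from the root, the next corner at the vertex is also on the left. It
  -- would be later, against the choice of `y`, unless the contour ends and this corner is `ξ`.
  · rcases (Nat.succ_le_of_lt (T.contourIndex_lt ξ y.symm)).lt_or_eq with h1 | h1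
    · have h2 := T.contourIndex_faceNext h1
      rw [← next_eq_faceNext_symm] at h2
      have h3 := hmax _ ⟨(T.next_fst y).trans hy1, by omega, hynext⟩
      omega
    · have h2 := T.faceNext_eq_root h1
      rw [← next_eq_faceNext_symm] at h2
      rwa [h2] at hynext

end PlaneTree

namespace PlaneTree

variable {V : Type*} (T : PlaneTree V)

/-! ### Circulations on the closure are boundaries -/

open Classical in
/-- The sum of `φ` over the closed blossoms whose arc to the successor encloses the position `j`. -/
noncomputable def arcSum [Fintype T.graph.Dart] (ξ : T.graph.Dart) (φ : T.graph.Dart → ℤ) (j : ℕ) : ℤ :=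
  ∑ b : T.graph.Dart, if T.IsBlossom b.fst ∧ T.IsClosed b ∧ T.contourIndex ξ b < j ∧
    j < T.contourIndex ξ (T.successor b) then φ b else 0

open Classical in
/-- A function on the corners of the closure whose increments across edges are given by the circulation
`φ`. -/
noncomputable def facePotential [Fintype T.graph.Dart] (ξ : T.graph.Dart) (φ : T.graph.Dart → ℤ) :
    T.ClosureDart → ℤ
  | Sum.inl d => if T.IsBlossom d.fst then -T.arcSum ξ φ (T.contourIndex ξ d.symm) - φ d
      else -T.arcSum ξ φ (T.contourIndex ξ d)
  | Sum.inr _ => 0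

theorem facePotential_inner [Fintype T.graph.Dart] (ξ : T.graph.Dart) (φ : T.graph.Dart → ℤ)
    {d : T.graph.Dart} (hd : ¬ T.IsBlossom d.fst) :
    T.facePotential ξ φ (Sum.inl d) = -T.arcSum ξ φ (T.contourIndex ξ d) :=
  if_neg hd

theorem facePotential_blossom [Fintype T.graph.Dart] (ξ : T.graph.Dart) (φ : T.graph.Dart → ℤ)
    {d : T.graph.Dart} (hd : T.IsBlossom d.fst) :
    T.facePotential ξ φ (Sum.inl d) = -T.arcSum ξ φ (T.contourIndex ξ d.symm) - φ d :=
  if_pos hd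

/-- Used to compare the arcs over two positions that differ by one arc. Conditions are only needed
where `φ` does not vanish, which disposes of unclosed blossoms. -/
theorem sum_ite_eq_add [Fintype T.graph.Dart] (φ : T.graph.Dart → ℤ) (P Q : T.graph.Dart → Prop)
    [DecidablePred P] [DecidablePred Q] (b₀ : T.graph.Dart) (h : ∀ b, b ≠ b₀ → φ b ≠ 0 → (P b ↔ Q b)) (hP : φ b₀ ≠ 0 → P b₀)
    (hQ : ¬ Q b₀) :
    ∑ b, (if P b then φ b else 0) = ∑ b, (if Q b then φ b else 0) + φ b₀ := by
  classical
  have key : ∀ b, (if P b then φ b else 0)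
      = (if Q b then φ b else 0) + if b = b₀ then φ b else 0 := by
    intro b
    by_cases hb : b = b₀
    · subst hb
      by_cases h0 : φ b = 0
      · simp [h0]
      · simp [hP h0, hQ]
    · by_cases h0 : φ b = 0
      · simp [h0]
      · simp [hb, h b hb h0]
  rw [Finset.sum_congr rfl fun b _ => key b, Finset.sum_add_distrib, Finset.sum_ite_eq',
    if_pos (Finset.mem_univ _)]

variable [Finite V] {ξ : T.graph.Dart}

theorem contourIndex_blossom_symm (hξ : ¬ T.IsBlossom ξ.fst) {b : T.graph.Dart}
    (hb : T.IsBlossom b.fst) : T.contourIndex ξ b = T.contourIndex ξ b.symm + 1 := by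
  have := T.contourIndex_stem hξ (d := b.symm) hb
  rwa [SimpleGraph.Dart.symm_symm] at this

theorem contourIndex_ne_of_isBlossom {b d : T.graph.Dart}
    (hb : T.IsBlossom b.fst) (hd : ¬ T.IsBlossom d.fst) :
    T.contourIndex ξ b ≠ T.contourIndex ξ d := by
  intro h
  rw [T.contourIndex_inj h] at hb
  exact hd hb

section Potential

variable [Fintype T.graph.Dart] (hT : T.IsBlossoming) (hξ : T.IsBalanced ξ)
  {φ : T.graph.Dart → ℤ} (hanti : ∀ d, φ d.symm = -φ d)
  (hopen : ∀ b, T.IsBlossom b.fst → ¬ T.IsClosed b → φ b = 0)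

open Classical in
-- By nesting, turning past `b₀` leads just outside its arc: either to the tree corner of its
-- successor, under the same arcs as the base of `b₀`, or to the next larger arc with the same end,
-- which then is the only additional arc over that base.
theorem facePotential_closureNext_blossom (hT : T.IsBlossoming) (hξ : T.IsBalanced ξ)
    {b₀ : T.graph.Dart} (hb₀ : T.IsBlossom b₀.fst) (hc₀ : T.IsClosed b₀) :
    T.facePotential ξ φ (T.closureNext ξ (Sum.inl b₀)) =
      -T.arcSum ξ φ (T.contourIndex ξ b₀.symm) := by
  have hi₀ := T.contourIndex_blossom_symm hξ.not_isBlossom hb₀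
  have hs₀ := (T.successor_spec hT hξ hb₀ hc₀).1
  have hinner : ¬ T.IsBlossom b₀.symm.fst := T.not_isBlossom_snd hξ.not_isBlossom hb₀
  rcases T.closureNext_blossom ξ hb₀ hc₀ with ⟨h1, h2⟩ | ⟨b', hb', hc', hs', hlt, h1, h2⟩
  · rw [h1, T.facePotential_inner ξ φ (T.successor_inner b₀ hc₀)]
    congr 1
    apply Finset.sum_congr rfl
    intro b _
    congr 1
    rw [eq_iff_iff]
    refine and_congr_right fun hb => and_congr_right fun hc => ?_
    have e1 := T.contourIndex_ne_of_isBlossom (ξ := ξ) hb hinner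
    have e2 := T.contourIndex_ne_of_isBlossom (ξ := ξ) hb₀ (T.successor_inner b hc)
    have e3 := (T.successor_spec hT hξ hb hc).1
    constructor
    · rintro ⟨h3, h4⟩
      rcases lt_trichotomy (T.contourIndex ξ b) (T.contourIndex ξ b₀) with h5 | h5 | h5
      · omega
      · rw [T.contourIndex_inj h5] at h4
        omega
      · have := T.successor_le hT hξ hb₀ hc₀ hb hc h5 h3.le
        omega
    · rintro ⟨h3, h4⟩
      have h5 := T.successor_le hT hξ hb hc hb₀ hc₀ (by omega) (by omega)
      refine ⟨by omega, lt_of_le_of_ne h5 ?_⟩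
      intro h6
      have := h2 b hb hc (T.contourIndex_inj h6.symm)
      omega
  · have hi' := T.contourIndex_blossom_symm hξ.not_isBlossom hb'
    have hinner' : ¬ T.IsBlossom b'.symm.fst := T.not_isBlossom_snd hξ.not_isBlossom hb'
    rw [h1, T.facePotential_blossom ξ φ hb']
    have key : T.arcSum ξ φ (T.contourIndex ξ b₀.symm)
        = T.arcSum ξ φ (T.contourIndex ξ b'.symm) + φ b' := by
      have e0 := T.contourIndex_ne_of_isBlossom (ξ := ξ) hb' hinner
      rw [arcSum, arcSum]
      refine T.sum_ite_eq_add φ (fun b => T.IsBlossom b.fst ∧ T.IsClosed b ∧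
          T.contourIndex ξ b < T.contourIndex ξ b₀.symm ∧
          T.contourIndex ξ b₀.symm < T.contourIndex ξ (T.successor b))
        (fun b => T.IsBlossom b.fst ∧ T.IsClosed b ∧
          T.contourIndex ξ b < T.contourIndex ξ b'.symm ∧
          T.contourIndex ξ b'.symm < T.contourIndex ξ (T.successor b)) b' ?_ ?_ ?_
      · intro b hne _
        refine and_congr_right fun hb => and_congr_right fun hc => ?_
        have e1 := T.contourIndex_ne_of_isBlossom (ξ := ξ) hb hinner
        have e1' := T.contourIndex_ne_of_isBlossom (ξ := ξ) hb hinner'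
        have e2 := T.contourIndex_ne_of_isBlossom (ξ := ξ) hb₀ (T.successor_inner b hc)
        have e2' := T.contourIndex_ne_of_isBlossom (ξ := ξ) hb' (T.successor_inner b hc)
        have e3 := (T.successor_spec hT hξ hb hc).1
        constructor
        · rintro ⟨h3, h4⟩
          rcases lt_trichotomy (T.contourIndex ξ b) (T.contourIndex ξ b') with h5 | h5 | h5
          · omega
          · exact absurd (T.contourIndex_inj h5) hne
          · exfalso
            have h6 := T.successor_le hT hξ hb' hc' hb hc h5 (by rw [hs']; omega)
            have h7 := T.successor_le hT hξ hb hc hb₀ hc₀ (by omega) (by omega)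
            rw [hs'] at h6
            have := h2 b hb hc (T.contourIndex_inj (le_antisymm h6 h7)) (by omega)
            omega
        · rintro ⟨h3, h4⟩
          have h5 := T.successor_le hT hξ hb hc hb' hc' (by omega) (by omega)
          rw [hs'] at h5
          omega
      · intro _
        refine ⟨hb', hc', by omega, ?_⟩
        rw [hs']
        omega
      · rintro ⟨_, _, h3, _⟩
        omega
    rw [key]
    ring

include hopen in
-- A blossom under an arc is closed, so no arc encloses an unclosed one.
theorem arcSum_open {b₀ : T.graph.Dart} (hT : T.IsBlossoming) (hξ : T.IsBalanced ξ)
    (hb₀ : T.IsBlossom b₀.fst) (hc₀ : ¬ T.IsClosed b₀) :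
    T.arcSum ξ φ (T.contourIndex ξ b₀.symm) = 0 ∧ φ b₀ = 0 := by
  have hi₀ := T.contourIndex_blossom_symm hξ.not_isBlossom hb₀
  refine ⟨Finset.sum_eq_zero fun b _ => if_neg ?_, hopen b₀ hb₀ hc₀⟩
  rintro ⟨hb, hc, h1, h2⟩
  exact hc₀ (T.isClosed_of_lt_successor hT hξ hb hc (c' := b₀) (by omega) (by omega))

include hanti hopen

omit hanti in
theorem facePotential_open {b₀ : T.graph.Dart} (hT : T.IsBlossoming) (hξ : T.IsBalanced ξ)
    (hb₀ : T.IsBlossom b₀.fst) (hc₀ : ¬ T.IsClosed b₀) :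
    T.facePotential ξ φ (Sum.inl b₀) = 0 := by
  obtain ⟨h1, h2⟩ := T.arcSum_open hopen hT hξ hb₀ hc₀
  rw [T.facePotential_blossom ξ φ hb₀, h1, h2]
  norm_num

open Classical in
omit hanti in
theorem facePotential_closureNext_inner (hT : T.IsBlossoming) (hξ : T.IsBalanced ξ)
    {x : T.graph.Dart} (hx : ¬ T.IsBlossom x.fst) :
    T.facePotential ξ φ (T.closureNext ξ (Sum.inl x)) =
      T.facePotential ξ φ (Sum.inl x.symm) := by
  have hyi : ¬ T.IsBlossom (T.next x).fst := by rwa [next_fst]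
  rcases (Nat.succ_le_of_lt (T.contourIndex_lt ξ x.symm)).lt_or_eq with hN | hN
  · have hj : T.contourIndex ξ (T.next x) = T.contourIndex ξ x.symm + 1 := by
      rw [next_eq_faceNext_symm]
      exact T.contourIndex_faceNext hN
    set j := T.contourIndex ξ (T.next x) with hjdef
    -- The dart after `x` is the innermost arc that ends in the next tree corner. Its left corner is
    -- under all arcs ending there, whence the non-strict inequality at `j`.
    have hleft : T.facePotential ξ φ (T.closureNext ξ (Sum.inl x)) =
        -∑ b : T.graph.Dart, if T.IsBlossom b.fst ∧ T.IsClosed b ∧ T.contourIndex ξ b < j ∧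
          j ≤ T.contourIndex ξ (T.successor b) then φ b else 0 := by
      rcases T.closureNext_inner ξ hx with ⟨h1, h2⟩ | ⟨b₀, hb₀, hc₀, hs₀, h1, h2⟩
      · rw [h1, T.facePotential_inner ξ φ hyi]
        congr 1
        apply Finset.sum_congr rfl
        intro b _
        congr 1
        rw [eq_iff_iff]
        refine and_congr_right fun hb => and_congr_right fun hc => and_congr_right fun _ => ?_
        refine ⟨le_of_lt, fun h => lt_of_le_of_ne h fun h' => h2 b hb hc ?_⟩
        exact (T.contourIndex_inj h').symm
      · rw [h1, T.facePotential_blossom ξ φ hb₀]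
        have hi₀ := T.contourIndex_blossom_symm hξ.not_isBlossom hb₀
        have hlt₀ := (T.successor_spec hT hξ hb₀ hc₀).1
        have hinner : ¬ T.IsBlossom b₀.symm.fst := T.not_isBlossom_snd hξ.not_isBlossom hb₀
        rw [hs₀, ← hjdef] at hlt₀
        rw [T.sum_ite_eq_add φ (fun b => T.IsBlossom b.fst ∧ T.IsClosed b ∧
          T.contourIndex ξ b < j ∧ j ≤ T.contourIndex ξ (T.successor b)) (fun b => T.IsBlossom b.fst ∧ T.IsClosed b ∧
          T.contourIndex ξ b < T.contourIndex ξ b₀.symm ∧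
          T.contourIndex ξ b₀.symm < T.contourIndex ξ (T.successor b)) b₀, arcSum]
        · ring
        · intro b hne _
          refine and_congr_right fun hb => and_congr_right fun hc => ?_
          have e1 := T.contourIndex_ne_of_isBlossom (ξ := ξ) hb hinner
          constructor
          · rintro ⟨h3, h4⟩
            rcases lt_trichotomy (T.contourIndex ξ b) (T.contourIndex ξ b₀) with h5 | h5 | h5
            · omega
            · exact absurd (T.contourIndex_inj h5) hne
            · exfalso
              have h6 := T.successor_le hT hξ hb₀ hc₀ hb hc h5 (by rw [hs₀]; omega)
              rw [hs₀] at h6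
              have := h2 b hb hc (T.contourIndex_inj (le_antisymm h6 h4))
              omega
          · rintro ⟨h3, h4⟩
            have h5 := T.successor_le hT hξ hb hc hb₀ hc₀ (by omega) (by omega)
            rw [hs₀] at h5
            exact ⟨by omega, h5⟩
        · intro _
          exact ⟨hb₀, hc₀, hlt₀, by rw [hs₀]⟩
        · rintro ⟨_, _, h3, _⟩
          omega
    rw [hleft]
    by_cases hb : T.IsBlossom x.snd
    · have hb' : T.IsBlossom x.symm.fst := hb
      have hst := T.contourIndex_stem hξ.not_isBlossom hb
      rw [T.facePotential_blossom ξ φ hb', SimpleGraph.Dart.symm_symm,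
        T.sum_ite_eq_add φ (fun b => T.IsBlossom b.fst ∧ T.IsClosed b ∧
          T.contourIndex ξ b < j ∧ j ≤ T.contourIndex ξ (T.successor b)) (fun b => T.IsBlossom b.fst ∧ T.IsClosed b ∧
          T.contourIndex ξ b < T.contourIndex ξ x ∧
          T.contourIndex ξ x < T.contourIndex ξ (T.successor b)) x.symm, arcSum]
      · ring
      · intro b hne _
        refine and_congr_right fun hb2 => and_congr_right fun hc2 => ?_
        have e1 := T.contourIndex_ne_of_isBlossom (ξ := ξ) hb2 hx
        have e2 := T.contourIndex_ne_of_isBlossom (ξ := ξ) hb' (T.successor_inner b hc2)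
        have e3 : T.contourIndex ξ b ≠ T.contourIndex ξ x.symm := fun h => hne (T.contourIndex_inj h)
        omega
      · intro h0
        have hc : T.IsClosed x.symm := by
          by_contra hc
          exact h0 (hopen _ hb' hc)
        have := (T.successor_spec hT hξ hb' hc).1
        exact ⟨hb', hc, by omega, by omega⟩
      · rintro ⟨_, _, h3, _⟩
        omega
    · have hb' : ¬ T.IsBlossom x.symm.fst := hb
      rw [T.facePotential_inner ξ φ hb']
      congr 1
      apply Finset.sum_congr rfl
      intro b _
      congr 1
      rw [eq_iff_iff]
      refine and_congr_right fun hb => and_congr_right fun hc => ?_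
      have e1 := T.contourIndex_ne_of_isBlossom (ξ := ξ) hb hb'
      omega
  -- Here the turn passes from the last stem to the root corner, which no arc covers; both sides
  -- vanish.
  · have hroot : T.next x = ξ := by
      rw [next_eq_faceNext_symm]
      exact T.faceNext_eq_root hN
    have hb' : T.IsBlossom x.symm.fst := by
      by_contra h
      have := T.contourIndex_succ_lt_of_inner hξ h
      omega
    rw [T.facePotential_open hopen hT hξ hb' (T.last_not_isClosed hT hξ hb' hN)]
    rcases T.closureNext_inner ξ hx with ⟨h1, _⟩ | ⟨b, hb, hc, hs, _⟩
    · rw [h1, T.facePotential_inner ξ φ hyi, hroot, contourIndex_self, arcSum,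
        Finset.sum_eq_zero, neg_zero]
      intro b _
      exact if_neg fun h => Nat.not_lt_zero _ h.2.2.1
    · rw [hroot] at hs
      exact absurd hs (T.successor_ne_root hT hξ hb hc)

variable (hcirc : ∀ (U : T.ClosureVertex → Prop) [DecidablePred U],
    ∑ d : T.graph.Dart, (if U (T.closureOrigin ξ (Sum.inl d)) then φ d else 0) = 0)

include hcirc

open Classical in
-- The flow out of the subtree below `d` is zero in total. It leaves or enters only through the edge
-- of `d` and through arcs with exactly one end in the subtree, which are those that enclose exactly
-- one of the two corners.
theorem arcSum_child (hT : T.IsBlossoming) (hξ : T.IsBalanced ξ) {d : T.graph.Dart}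
    (h1 : ¬ T.IsBlossom d.fst) (h2 : ¬ T.IsBlossom d.snd)
    (hlt : T.contourIndex ξ d < T.contourIndex ξ d.symm) :
    T.arcSum ξ φ (T.contourIndex ξ d) - T.arcSum ξ φ (T.contourIndex ξ d.symm) = φ d := by
  have h2' : ¬ T.IsBlossom d.symm.fst := h2
  have hU := hcirc (fun v => ∃ y : T.graph.Dart, ¬ T.IsBlossom y.fst ∧
    T.closureOrigin ξ (Sum.inl y) = v ∧ T.contourIndex ξ d < T.contourIndex ξ y ∧
      T.contourIndex ξ y ≤ T.contourIndex ξ d.symm)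
  have hUiff : ∀ x : T.graph.Dart, (∃ y : T.graph.Dart, ¬ T.IsBlossom y.fst ∧
      T.closureOrigin ξ (Sum.inl y) = T.closureOrigin ξ (Sum.inl x) ∧
        T.contourIndex ξ d < T.contourIndex ξ y ∧ T.contourIndex ξ y ≤ T.contourIndex ξ d.symm) ↔
      T.IsAttached x ∧ T.contourIndex ξ d < T.contourIndex ξ (T.cornerOrigin x) ∧
        T.contourIndex ξ (T.cornerOrigin x) ≤ T.contourIndex ξ d.symm := by
    intro x
    constructor
    · rintro ⟨y, hy1, hy2, hy3⟩
      rw [T.closureOrigin_inner ξ hy1] at hy2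
      obtain ⟨h3, h4⟩ := (T.closureOrigin_eq_inner_iff ξ x _).1 hy2.symm
      exact ⟨h3, (T.interval_iff hlt (x := y) h4.symm).1 hy3⟩
    · rintro ⟨h3, h4⟩
      exact ⟨_, T.not_isBlossom_cornerOrigin h3, (T.closureOrigin_attached ξ h3).symm, h4⟩
  simp only [hUiff] at hU
  -- Without `d.symm`, the darts of the subtree come in opposite pairs and their flows cancel.
  have hS : ∑ x : T.graph.Dart, (if T.contourIndex ξ d < T.contourIndex ξ x ∧
      T.contourIndex ξ x < T.contourIndex ξ d.symm then φ x else 0) = 0 := by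
    have hsymm := Equiv.sum_comp T.toMap.rev (fun x : T.graph.Dart =>
      if T.contourIndex ξ d < T.contourIndex ξ x ∧
      T.contourIndex ξ x < T.contourIndex ξ d.symm then φ x else 0)
    have hneg : ∀ x : T.graph.Dart, (if T.contourIndex ξ d < T.contourIndex ξ (T.toMap.rev x) ∧
        T.contourIndex ξ (T.toMap.rev x) < T.contourIndex ξ d.symm then φ (T.toMap.rev x) else 0)
        = -(if T.contourIndex ξ d < T.contourIndex ξ x ∧
          T.contourIndex ξ x < T.contourIndex ξ d.symm then φ x else 0) := by
      intro x
      rw [toMap_rev, hanti]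
      have hiff : (T.contourIndex ξ d < T.contourIndex ξ x.symm ∧
          T.contourIndex ξ x.symm < T.contourIndex ξ d.symm) ↔
          (T.contourIndex ξ d < T.contourIndex ξ x ∧
            T.contourIndex ξ x < T.contourIndex ξ d.symm) := by
        by_cases hxd : x = d
        · rw [hxd]
          omega
        · by_cases hxd' : x = d.symm
          · rw [hxd', SimpleGraph.Dart.symm_symm]
            omega
          · have h3 := T.interval_symm_iff hlt hxd hxd'
            have h4 : T.contourIndex ξ x ≠ T.contourIndex ξ d.symm :=
              fun h => hxd' (T.contourIndex_inj h)
            have h5 : T.contourIndex ξ x.symm ≠ T.contourIndex ξ d.symm := fun h => hxd (by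
              rw [← SimpleGraph.Dart.symm_symm x, T.contourIndex_inj h,
                SimpleGraph.Dart.symm_symm])
            omega
      simp only [hiff]
      split_ifs <;> simp
    rw [Finset.sum_congr rfl fun x _ => hneg x, Finset.sum_neg_distrib] at hsymm
    omega
  -- For a closed blossom this compares the places of its two ends, the blossom and its successor,
  -- with the interval; for an inner dart, only `d.symm` distinguishes the two intervals.
  have key : ∀ x : T.graph.Dart,
      (if T.IsBlossom x.fst ∧ T.IsClosed x ∧ T.contourIndex ξ x < T.contourIndex ξ d ∧
        T.contourIndex ξ d < T.contourIndex ξ (T.successor x) then φ x else 0)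
      - (if T.IsBlossom x.fst ∧ T.IsClosed x ∧ T.contourIndex ξ x < T.contourIndex ξ d.symm ∧
        T.contourIndex ξ d.symm < T.contourIndex ξ (T.successor x) then φ x else 0)
      = (if T.IsAttached x ∧ T.contourIndex ξ d < T.contourIndex ξ (T.cornerOrigin x) ∧
        T.contourIndex ξ (T.cornerOrigin x) ≤ T.contourIndex ξ d.symm then φ x else 0)
      - (if T.contourIndex ξ d < T.contourIndex ξ x ∧
          T.contourIndex ξ x < T.contourIndex ξ d.symm then φ x else 0)
      - (if x = d.symm then φ x else 0) := by
    intro x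
    by_cases hb : T.IsBlossom x.fst
    · by_cases hc : T.IsClosed x
      · have hatt : T.IsAttached x := fun _ => hc
        have e1 := T.contourIndex_ne_of_isBlossom (ξ := ξ) hb h1
        have e2 := T.contourIndex_ne_of_isBlossom (ξ := ξ) hb h2'
        have e3 : x ≠ d.symm := fun h => h2' (h ▸ hb)
        have e4 := (T.successor_spec hT hξ hb hc).1
        rw [T.cornerOrigin_blossom hb]
        simp only [hb, hc, hatt, true_and, e3, if_false, sub_zero]
        split_ifs <;> omega
      · rw [hopen x hb hc]
        simp
    · have hatt : T.IsAttached x := fun h => absurd h hb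
      rw [T.cornerOrigin_inner hb]
      simp only [hb, hatt, true_and, false_and, if_false, sub_zero]
      by_cases hx : x = d.symm
      · subst hx
        simp [hlt]
      · have : T.contourIndex ξ x ≠ T.contourIndex ξ d.symm := fun h => hx (T.contourIndex_inj h)
        simp only [hx, if_false, sub_zero]
        split_ifs <;> omega
  rw [arcSum, arcSum, ← Finset.sum_sub_distrib, Finset.sum_congr rfl fun x _ => key x,
    Finset.sum_sub_distrib, Finset.sum_sub_distrib, hU, hS, Finset.sum_ite_eq',
    if_pos (Finset.mem_univ _), hanti]
  ring

theorem facePotential_symm (hT : T.IsBlossoming) (hξ : T.IsBalanced ξ) (d : T.graph.Dart) :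
    T.facePotential ξ φ (Sum.inl d.symm) = T.facePotential ξ φ (Sum.inl d) + φ d := by
  by_cases h1 : T.IsBlossom d.fst
  · rw [T.facePotential_blossom ξ φ h1, T.facePotential_inner ξ φ (d := d.symm)
      (T.not_isBlossom_snd hξ.not_isBlossom h1)]
    ring
  · by_cases h2 : T.IsBlossom d.snd
    · rw [T.facePotential_blossom ξ φ (d := d.symm) h2, T.facePotential_inner ξ φ h1, hanti,
        SimpleGraph.Dart.symm_symm]
      ring
    · rw [T.facePotential_inner ξ φ (d := d.symm) h2, T.facePotential_inner ξ φ h1]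
      rcases lt_or_gt_of_ne (T.contourIndex_symm_ne ξ d) with h | h
      · have := T.arcSum_child hanti hopen hcirc hT hξ (d := d.symm) h2 h1
          (by rwa [SimpleGraph.Dart.symm_symm])
        rw [hanti, SimpleGraph.Dart.symm_symm] at this
        omega
      · have := T.arcSum_child hanti hopen hcirc hT hξ h1 h2 h
        omega

/-- Applied to a reversed dart, this says that the potential is constant along `faceNext`, hence a
function on the faces. At `A` and `B` everything vanishes. -/
theorem facePotential_next (hT : T.IsBlossoming) (hξ : T.IsBalanced ξ) (x : T.ClosureDart) :
    T.facePotential ξ φ ((T.closure ξ).next x) =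
      T.facePotential ξ φ ((T.closure ξ).rev x) := by
  have hzero : ∀ y : T.ClosureDart, (∀ u, (T.closure ξ).origin y ≠ .inner u) →
      T.facePotential ξ φ y = 0 ∧ T.facePotential ξ φ ((T.closure ξ).rev y) = 0 := by
    rintro (d | b) hy
    · have hatt : ¬ T.IsAttached d := fun h =>
        hy _ ((T.closureOrigin_eq_inner_iff ξ d (T.toInner _ (T.not_isBlossom_cornerOrigin h))).2
          ⟨h, rfl⟩)
      simp only [IsAttached, Classical.not_imp] at hatt
      have h0 := T.facePotential_open hopen hT hξ hatt.1 hatt.2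
      refine ⟨h0, ?_⟩
      rw [closure_rev_inl, T.facePotential_symm hanti hopen hcirc hT hξ, h0,
        hopen d hatt.1 hatt.2]
      rfl
    · exact ⟨rfl, rfl⟩
  by_cases hx : ∃ u, (T.closure ξ).origin x = .inner u
  · obtain ⟨u, hu⟩ := hx
    rcases x with d | b
    · obtain ⟨hatt, _⟩ := (T.closureOrigin_eq_inner_iff ξ d u).1 hu
      rw [closure_next_apply, closure_rev_inl]
      by_cases hb : T.IsBlossom d.fst
      · rw [T.facePotential_closureNext_blossom hT hξ hb (hatt hb), T.facePotential_inner ξ φ]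
        exact T.not_isBlossom_snd hξ.not_isBlossom hb
      · exact T.facePotential_closureNext_inner hopen hT hξ hb
    · cases b <;> cases hu
  · push Not at hx
    rw [(hzero x hx).2]
    refine (hzero _ fun u => ?_).1
    rw [RotationMap.origin_next]
    exact hx u

end Potential

end PlaneTree

namespace RotationMap

variable {V D : Type*} {M : RotationMap V D}

/-! ### Uniqueness of minimal orientations -/

open Classical in
/-- The circulation along a directed cycle. -/
noncomputable def cycleFlow (M : RotationMap V D) (C : List D) (d : D) : ℤ :=
  (if d ∈ C then 1 else 0) - if M.rev d ∈ C then 1 else 0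

theorem cycleFlow_rev (C : List D) (d : D) : M.cycleFlow C (M.rev d) = -M.cycleFlow C d := by
  rw [cycleFlow, cycleFlow, M.rev_rev]
  ring

theorem cycleFlow_of_notMem {C : List D} {d : D} (h1 : d ∉ C) (h2 : M.rev d ∉ C) :
    M.cycleFlow C d = 0 := by
  simp [cycleFlow, h1, h2]

/-- The origins and the targets of the darts of a cycle are the same vertices up to rotation. -/
theorem IsDirectedCycle.sum_cycleFlow [Fintype D] {O : Set D} {C : List D}
    (hC : M.IsDirectedCycle O C) (U : V → Prop) [DecidablePred U] :
    ∑ d, (if U (M.origin d) then M.cycleFlow C d else 0) = 0 := by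
  classical
  have hnodup : C.Nodup := List.Nodup.of_map _ hC.2.2.2
  have hcount : ∀ g : D → V, ∑ d, (if U (g d) then (if d ∈ C then (1 : ℤ) else 0) else 0)
      = (C.map g).countP (fun v => decide (U v)) := by
    intro g
    have h1 : ∀ d, (if U (g d) then (if d ∈ C then (1 : ℤ) else 0) else 0)
        = if d ∈ C ∧ U (g d) then 1 else 0 := by
      intro d
      by_cases h : U (g d) <;> simp [h]
    rw [Finset.sum_congr rfl fun d _ => h1 d, Finset.sum_boole, List.countP_map,
      List.countP_eq_length_filter, ← List.toFinset_card_of_nodup (hnodup.filter _)]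
    congr 2
    ext d
    simp
  have hrev := Equiv.sum_comp M.rev
    (fun d => if U (M.target d) then (if d ∈ C then (1 : ℤ) else 0) else 0)
  simp only [target_rev] at hrev
  have hsplit : ∀ d, (if U (M.origin d) then M.cycleFlow C d else 0)
      = (if U (M.origin d) then (if d ∈ C then (1 : ℤ) else 0) else 0)
        - (if U (M.origin d) then (if M.rev d ∈ C then (1 : ℤ) else 0) else 0) := by
    intro d
    by_cases h : U (M.origin d) <;> simp [h, cycleFlow]
  rw [Finset.sum_congr rfl fun d _ => hsplit d, Finset.sum_sub_distrib, hrev, hcount, hcount,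
    hC.2.2.1, (List.rotate_perm _ 1).countP_eq, sub_self]

/-- The reverse of a directed cycle. -/
theorem IsDirectedCycle.reverse {O O' : Set D} {C : List D} (hC : M.IsDirectedCycle O C)
    (h : ∀ d ∈ C, M.rev d ∈ O') : M.IsDirectedCycle O' (C.map M.rev).reverse := by
  obtain ⟨h1, _, h3, h4⟩ := hC
  have ho : (C.map M.rev).reverse.map M.origin = (C.map M.target).reverse := by
    rw [List.map_reverse, List.map_map]
    rfl
  have ht : (C.map M.rev).reverse.map M.target = (C.map M.origin).reverse := by
    rw [List.map_reverse, List.map_map]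
    congr 1
    exact List.map_congr_left fun d _ => M.target_rev d
  refine ⟨by simpa using h1, ?_, ?_, ?_⟩
  · intro d hd
    obtain ⟨d', hd', rfl⟩ := List.mem_map.1 (List.mem_reverse.1 hd)
    exact h d' hd'
  · rw [ho, ht, h3]
    rcases C with _ | ⟨d, C⟩
    · rfl
    · simp
  · rw [ho, List.nodup_reverse, h3]
    exact List.nodup_rotate.2 h4

/-- A set of darts in which every dart is followed by another one contains a directed cycle. -/
theorem exists_isDirectedCycle [Finite D] {O : Set D} (hne : O.Nonempty)
    (hO : ∀ d ∈ O, ∃ d' ∈ O, M.origin d' = M.target d) : ∃ C, M.IsDirectedCycle O C := by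
  classical
  obtain ⟨d₀, hd₀⟩ := hne
  -- The continuation is chosen for each vertex, not for each dart, so that a minimal period of the
  -- iteration cannot repeat a vertex. The default `d₀` is never used along the iteration.
  let σ : V → D := fun u => if h : ∃ d' ∈ O, M.origin d' = u then h.choose else d₀
  have hσ : ∀ d ∈ O, σ (M.target d) ∈ O ∧ M.origin (σ (M.target d)) = M.target d := by
    intro d hd
    have h := hO d hd
    simp only [σ, dif_pos h]
    exact h.choose_spec
  let F : D → D := fun d => σ (M.target d)
  have hF : ∀ i, F^[i] d₀ ∈ O := by
    intro i
    induction i with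
    | zero => exact hd₀
    | succ i ih =>
      rw [Function.iterate_succ_apply']
      exact (hσ _ ih).1
  obtain ⟨i, j, hij, hcoll⟩ : ∃ i j, i < j ∧ F^[i] d₀ = F^[j] d₀ := by
    obtain ⟨i, j, hne, h⟩ := Finite.exists_ne_map_eq_of_infinite (fun i => F^[i] d₀)
    rcases lt_or_gt_of_ne hne with h' | h'
    · exact ⟨i, j, h', h⟩
    · exact ⟨j, i, h', h.symm⟩
  set x := F^[i] d₀ with hx
  have hper : x ∈ Function.periodicPts F := by
    refine ⟨j - i, by omega, ?_⟩
    change F^[j - i] x = x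
    rw [hx, ← Function.iterate_add_apply, Nat.sub_add_cancel hij.le]
    exact hcoll.symm
  have hn := Function.minimalPeriod_pos_of_mem_periodicPts hper
  set n := Function.minimalPeriod F x with hndef
  have hxO : ∀ k, F^[k] x ∈ O := by
    intro k
    rw [hx, ← Function.iterate_add_apply]
    exact hF _
  have htarget : ∀ k, M.target (F^[k] x) = M.origin (F^[k + 1] x) := by
    intro k
    rw [Function.iterate_succ_apply']
    exact (hσ _ (hxO k)).2.symm
  have hself : ∀ k, F^[k] x = σ (M.origin (F^[k] x)) := by
    intro k
    have h1 : F^[k] x = F^[k + (n - 1) + 1] x := by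
      rw [add_assoc, Nat.sub_add_cancel hn, Function.iterate_add_apply, hndef,
        Function.iterate_minimalPeriod]
    rw [h1, ← htarget, Function.iterate_succ_apply']
  refine ⟨(List.range n).map (fun k => F^[k] x), ?_, ?_, ?_, ?_⟩
  · simp [hn.ne']
  · intro d hd
    obtain ⟨k, _, rfl⟩ := List.mem_map.1 hd
    exact hxO k
  · apply List.ext_getElem
    · simp
    · intro k h1 h2
      rw [List.getElem_rotate]
      simp only [List.map_map, List.getElem_map, List.getElem_range, Function.comp_apply,
        List.length_map, List.length_range]
      rw [htarget, hndef, Function.iterate_mod_minimalPeriod_eq]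
  · rw [List.map_map]
    refine List.Nodup.map_on ?_ List.nodup_range
    intro a ha b hb hab
    refine Function.iterate_injOn_Iio_minimalPeriod (f := F) (x := x) (List.mem_range.1 ha)
      (List.mem_range.1 hb) ?_
    have hab' : M.origin (F^[a] x) = M.origin (F^[b] x) := hab
    simp only
    rw [hself a, hab', ← hself b]

/-- At the endpoint of `d`, the reverse of `d` is outgoing for `O'` only. Equal outdegrees require a
compensating dart that is outgoing for `O` only. -/
theorem exists_mem_diff [Finite D] {O O' : Set D} (hO : M.IsOrientation O)
    (hO' : M.IsOrientation O') (hdeg : ∀ u, M.outdegree O u = M.outdegree O' u) {d : D}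
    (hd : d ∈ O \ O') : ∃ d' ∈ O \ O', M.origin d' = M.target d := by
  by_contra hcon
  push Not at hcon
  have hrev : M.rev d ∈ O' := by
    by_contra h
    exact hd.2 ((hO' d).2 h)
  have hlt := Set.ncard_lt_ncard (s := {x | x ∈ O ∧ M.origin x = M.target d})
    (t := {x | x ∈ O' ∧ M.origin x = M.target d}) ?_ (Set.toFinite _)
  · exact hlt.ne (hdeg _)
  · refine ⟨?_, fun h => ?_⟩
    · rintro x ⟨h1, h2⟩
      refine ⟨?_, h2⟩
      by_contra h3
      exact hcon x ⟨h1, h3⟩ h2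
    · exact (hO d).1 hd.1 (h (show M.rev d ∈ {x | x ∈ O' ∧ M.origin x = M.target d} from
        ⟨hrev, rfl⟩)).1

/-- A corner is not on both sides of a directed cycle, if the circulation along the cycle is the
boundary of a function on the faces. -/
theorem IsDirectedCycle.not_onLeft_reverse [Finite D] {O : Set D} (hO : M.IsOrientation O)
    {C : List D} (hC : M.IsDirectedCycle O C) {f : D → ℤ}
    (hnext : ∀ d, f (M.next d) = f (M.rev d))
    (hrev : ∀ d, f (M.rev d) = f d + M.cycleFlow C d) {ξ : D} (h : M.OnLeft C ξ) :
    ¬ M.OnLeft (C.map M.rev).reverse ξ := by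
  have hstep : ∀ x y, Relation.EqvGen (M.StepAvoiding C) x y → f x = f y := by
    intro x y hxy
    induction hxy with
    | rel x y h =>
      rcases h with rfl | ⟨rfl, h1, h2⟩
      · change f x = f (M.next (M.rev x))
        rw [hnext, M.rev_rev]
      · rw [hrev, cycleFlow_of_notMem h1 h2, add_zero]
    | refl => rfl
    | symm _ _ _ ih => exact ih.symm
    | trans _ _ _ _ _ ih1 ih2 => exact ih1.trans ih2
  have hmem : ∀ x, x ∈ (C.map M.rev).reverse ↔ M.rev x ∈ C := by
    intro x
    rw [List.mem_reverse, List.mem_map]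
    constructor
    · rintro ⟨y, hy, rfl⟩
      rwa [M.rev_rev]
    · intro hx
      exact ⟨_, hx, M.rev_rev x⟩
  rintro ⟨d', hd', h'⟩
  obtain ⟨d, hd, h⟩ := h
  rw [hmem] at hd'
  have h1 : f d' = f ξ := by
    apply hstep
    -- A cycle and its reverse have the same edges, so they forbid the same crossings.
    refine Relation.EqvGen.mono (r := M.StepAvoiding (C.map M.rev).reverse) ?_ _ _ h'
    rintro x y (hxy | ⟨hxy, h2, h3⟩)
    · exact Or.inl hxy
    · rw [hmem] at h2 h3
      rw [M.rev_rev] at h3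
      exact Or.inr ⟨hxy, h3, h2⟩
  have h2 : f d = f ξ := hstep _ _ h
  -- Now `f` agrees on both sides of the edge of `d'`, although crossing it changes `f` by one.
  have h3 : f d = f (M.rev d') := hstep _ _ (hC.eqvGen_of_mem hO hd hd')
  have h4 := hrev d'
  have h5 : d' ∉ C := by
    have := hC.rev_notMem hO hd'
    rwa [M.rev_rev] at this
  have h6 : M.cycleFlow C d' = -1 := by simp [cycleFlow, h5, hd']
  omega

end RotationMap

/-! ### Uniqueness of the minimal 3-orientation of the closure -/

namespace PlaneTree

variable {V : Type*} (T : PlaneTree V) [Finite V] {ξ : T.graph.Dart} (hT : T.IsBlossoming)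
  (hξ : T.IsBalanced ξ)

include hT hξ

/-- All darts of the cycle leave inner vertices, so the cycle avoids `A` and `B` and its flow
vanishes on the new edge and on unclosed stems, as the potential requires. -/
theorem exists_potential {C : List T.ClosureDart}
    (hC : (T.closure ξ).IsDirectedCycle (T.canonicalOrientation ξ) C) :
    ∃ f : T.ClosureDart → ℤ, (∀ x, f ((T.closure ξ).next x) = f ((T.closure ξ).rev x)) ∧
      ∀ x, f ((T.closure ξ).rev x) = f x + (T.closure ξ).cycleFlow C x := by
  classical
  have := T.finite_dart
  have := Fintype.ofFinite T.graph.Dart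
  obtain ⟨_, e, _, he1, he2, _, he4⟩ := T.exists_tree_sequence hC
  have hinr : ∀ b, Sum.inr b ∉ C := by
    intro b hb
    obtain ⟨i, hi⟩ := he2 _ hb
    cases hi
  have hinr0 : ∀ b, (T.closure ξ).cycleFlow C (Sum.inr b) = 0 := fun b =>
    RotationMap.cycleFlow_of_notMem (hinr b) (hinr _)
  have hanti : ∀ d : T.graph.Dart, (T.closure ξ).cycleFlow C (Sum.inl d.symm) =
      -(T.closure ξ).cycleFlow C (Sum.inl d) := fun d => RotationMap.cycleFlow_rev C (Sum.inl d)
  have hopen : ∀ b : T.graph.Dart, T.IsBlossom b.fst → ¬ T.IsClosed b →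
      (T.closure ξ).cycleFlow C (Sum.inl b) = 0 := by
    intro b hb hc
    apply RotationMap.cycleFlow_of_notMem
    · intro h
      exact T.not_isBlossom_of_mem (hC.2.1 _ h) hb
    · intro h
      obtain ⟨i, hi⟩ := he2 _ h
      have h1 := he4 i
      rw [hi, RotationMap.target_rev, closure_origin_apply, closure_origin_apply,
        T.closureOrigin_inner ξ (T.not_isBlossom_of_mem (hC.2.1 _ (he1 (i + 1))))] at h1
      exact hc (((T.closureOrigin_eq_inner_iff ξ b _).1 h1).1 hb)
  have hcirc : ∀ (U : T.ClosureVertex → Prop) [DecidablePred U],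
      ∑ d : T.graph.Dart, (if U (T.closureOrigin ξ (Sum.inl d)) then
        (T.closure ξ).cycleFlow C (Sum.inl d) else 0) = 0 := by
    intro U _
    have h := hC.sum_cycleFlow U
    rw [Fintype.sum_sum_type] at h
    simp only [hinr0, ite_self, Finset.sum_const_zero, add_zero] at h
    exact h
  refine ⟨T.facePotential ξ fun d => (T.closure ξ).cycleFlow C (Sum.inl d),
    T.facePotential_next hanti hopen hcirc hT hξ, ?_⟩
  rintro (d | b)
  · exact T.facePotential_symm hanti hopen hcirc hT hξ d
  · rw [hinr0, add_zero]
    rfl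

/-- The darts of the canonical orientation that are not in `O` contain a directed cycle; minimality
puts the root corner on the left of it and of its reverse. -/
theorem eq_canonicalOrientation {O : Set T.ClosureDart}
    (hO : (T.closure ξ).IsMinimalThreeOrientation (T.rootCorner ξ) O) :
    O = T.canonicalOrientation ξ := by
  have hfin := T.finite_closureDart
  by_contra hne
  obtain ⟨⟨hor, hA, hB, hroot, hrest⟩, hmin⟩ := hO
  obtain ⟨hor', hA', hB', hroot', hrest'⟩ := T.isThreeOrientation_canonicalOrientation hT hξ
  have hdeg : ∀ u, (T.closure ξ).outdegree (T.canonicalOrientation ξ) u =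
      (T.closure ξ).outdegree O u := by
    intro u
    by_cases h1 : u = (T.closure ξ).rootA (T.rootCorner ξ)
    · rw [h1, hA, hA']
    by_cases h2 : u = (T.closure ξ).rootB (T.rootCorner ξ)
    · rw [h2, hB, hB']
    by_cases h3 : u = (T.closure ξ).origin (T.rootCorner ξ)
    · rw [h3, hroot, hroot']
    rw [hrest u h1 h2 h3, hrest' u h1 h2 h3]
  have hnonempty : (T.canonicalOrientation ξ \ O).Nonempty := by
    by_contra hempty
    rw [Set.not_nonempty_iff_eq_empty, Set.sdiff_eq_empty] at hempty
    apply hne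
    refine Set.Subset.antisymm (fun d hd => ?_) hempty
    by_contra hd'
    have : (T.closure ξ).rev d ∈ T.canonicalOrientation ξ := by
      by_contra h
      exact hd' ((hor' d).2 h)
    exact (hor d).1 hd (hempty this)
  obtain ⟨C, hC⟩ := RotationMap.exists_isDirectedCycle hnonempty
    (fun d hd => RotationMap.exists_mem_diff hor' hor hdeg hd)
  have hC1 : (T.closure ξ).IsDirectedCycle (T.canonicalOrientation ξ) C :=
    ⟨hC.1, fun d hd => (hC.2.1 d hd).1, hC.2.2⟩
  have hC2 : (T.closure ξ).IsDirectedCycle O (C.map (T.closure ξ).rev).reverse := by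
    refine hC.reverse fun d hd => ?_
    by_contra h
    exact (hC.2.1 d hd).2 ((hor d).2 h)
  obtain ⟨f, hf1, hf2⟩ := T.exists_potential hT hξ hC1
  exact hC1.not_onLeft_reverse hor' hf1 hf2
    (T.isMinimalOrientation_canonicalOrientation hT hξ C hC1) (hmin _ hC2)

end PlaneTree

theorem mainTheorem8 {V : Type*} [Finite V] (T : PlaneTree V) (hT : T.IsBlossoming)
    (ξ : T.toMap.Corner) (hξ : T.IsBalanced ξ) :
    (∃! O : Set T.ClosureDart, (T.closure ξ).IsMinimalThreeOrientation (T.rootCorner ξ) O) ∧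
    (∀ O : Set T.ClosureDart, (T.closure ξ).IsMinimalThreeOrientation (T.rootCorner ξ) O →
      ∀ e ∈ O, (T.closure ξ).origin e ≠ .B →
        ∃ P : List T.ClosureDart, (T.closure ξ).IsLeftmostPath O e .A P ∧
          (∀ Q : List T.ClosureDart, (T.closure ξ).IsLeftmostPath O e .A Q → Q = P) ∧
          T.closureLabel ξ ((T.closure ξ).leftCorner e) =
            (((T.closure ξ).pathVertices P).length : ℤ)) ∧
    (∀ u : PlaneTree.ClosureVertex T, (T.closure ξ).toGraph.Reachable u .A ∧
      ((T.closure ξ).toGraph.dist u .A : ℤ) ≤ T.closureVertexLabel ξ u - 1) := by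
  refine ⟨⟨T.canonicalOrientation ξ, ⟨T.isThreeOrientation_canonicalOrientation hT hξ,
    T.isMinimalOrientation_canonicalOrientation hT hξ⟩,
    fun O hO => T.eq_canonicalOrientation hT hξ hO⟩, ?_, ?_⟩
  · intro O hO e he heB
    rw [T.eq_canonicalOrientation hT hξ hO] at he ⊢
    rcases e with d | b
    · obtain ⟨P, hP, hlen⟩ := T.exists_leftmostPath hT hξ he
      refine ⟨P, hP, fun Q hQ => hP.unique (fun _ => T.origin_ne_A_of_mem) hQ, ?_⟩
      have hP0 : P ≠ [] := by
        rintro rfl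
        simpa using hP.1
      rw [RotationMap.length_pathVertices hP0, RotationMap.leftCorner,
        T.closureLabel_inner (T.not_isBlossom_of_mem he), hlen]
      push_cast
      rfl
    -- The only oriented new dart leaves `B`, which is excluded.
    · rw [T.inr_mem_canonicalOrientation] at he
      subst he
      exact absurd rfl heB
  · intro u
    obtain ⟨p, hp⟩ := T.exists_walk_A hT hξ u
    refine ⟨⟨p⟩, le_trans ?_ hp⟩
    exact_mod_cast SimpleGraph.dist_le p
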